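/- **Proposition (Isospectrality).** Let $\Lambda$ be the Grassmann algebra over $\mathbb C$ on a totally ordered set of odd generators $(\beta_i)_{i\in\iota}$: its elements are the sums $\sum_I a_I\beta_I$ over the finite subsets $I\subset\iota$, with $a_I\in\mathbb C$ (for finite $\iota$ this is the exterior algebra of $\mathbb C^\iota$; for infinite $\iota$ infinite sums are allowed). The body of such an element is $a_\emptyset$. Let $x,t_2,t_4,\dots$ be even and $\varphi,t_1,t_3,\dots$ odd variables, let $B_T:=\Lambda[[x,\varphi,t_1,t_2,\dots]]$ be the supercommutative ring of formal power series in them, and let $\mathcal D:=\partial_\varphi+\varphi\,\partial_x$, where all derivatives are left derivatives. For $A=\Lambda$ or $A=B_T$ let $V_A:=A((z^{-1}))\oplus A((z^{-1}))\,\theta$, with $z$ even and $\theta$ odd, and put $V:=V_\Lambda$; write $O(z^{-1})$ for an element of $V_A$ in which only negative powers of $z$ occur. Derivatives with respect to $x,\varphi,t_k$ act on $V_{B_T}$ coefficientwise, the coefficients being written on the left of $\theta$ and $z$. Let $\hat h=\theta+\varphi z+O(z^{-1})\in V_{B_T}$ be odd. Put $\hat h^{(0)}:=1$ and $\hat h^{(k+1)}:=(\mathcal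 D+\hat h)\hat h^{(k)}$, and let $\hat H^{(k)}$, $k\ge 0$, be the super currents of $\hat h$, that is, the elements of the $B_T$-span of $\{\hat h^{(k)}\}_{k\ge0}$ of the form $\hat H^{(2k+p)}=\theta^pz^k+O(z^{-1})$, $p=0,1$. Assume that $\hat h$ is a solution of the Jacobian super KP hierarchy, i.e. $$\frac{\partial\hat h}{\partial t_k}=(-1)^k\,\mathcal D\hat H^{(k)}\qquad\text{for all }k\ge1 .$$ A point $(x_0,\varphi_0,\mathbf t_0)$ consists of even elements of $\Lambda$ as values of $x,t_2,t_4,\dots$ and odd elements of $\Lambda$ as values of $\varphi,t_1,t_3,\dots$, all but finitely many of them zero. Call it a specialization point of $\hat h$ if the coefficients of $\hat h$ converge near it in the following sense: every $\mathbb C$-valued component of a coefficient of $\hat h$ (with respect to the monomials in the odd variables and in the $\beta_i$), regarded as a power series in the even variables whose value has body $0$, has as coefficients power series in the remaining even variables, each of which converges absolutely for some radii larger than the absolute values of the bodies of the corresponding values. (If all the bodies are zero, this always holds.) Let $W_{T_0}\subset V$ be the $\Lambda$-span of the values of the super currents $\hat H^{(k)}$ at $(x_0,\varphi_0,\mathbf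 t_0)$, and let $$\mathcal A_{(x_0,\varphi_0,\mathbf t_0)}:=\{f\in V:\ f\,W_{T_0}\subset W_{T_0}\}.$$ Then $\mathcal A_{(x_0,\varphi_0,\mathbf t_0)}$ is the same subalgebra of $V$ for all specialization points $(x_0,\varphi_0,\mathbf t_0)$ of $\hat h$. -/

import Mathlib

noncomputable section

namespace SuperKP

/-! ### Super rings and Grassmann algebras -/

/-- A `ℤ/2`-grading of a ring (in which `2` is invertible), given by its parity
automorphism `a ↦ (-1)^{|a|} a`. -/
class Super (A : Type*) [Ring A] where
  parity : A →+* A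
  parity_parity : ∀ a, parity (parity a) = a

/-- Homogeneous elements of parity `0`. -/
def IsEven {A : Type*} [Ring A] [Super A] (a : A) : Prop := Super.parity a = a

/-- Homogeneous elements of parity `1`. -/
def IsOdd {A : Type*} [Ring A] [Super A] (a : A) : Prop := Super.parity a = -a

/-- The complex numbers are purely even. -/
instance : Super ℂ where
  parity := RingHom.id ℂ
  parity_parity _ := rfl

/-- Power series in even (central) variables: the parity is that of the coefficients. -/
instance {E A : Type*} [Ring A] [Super A] : Super (MvPowerSeries E A) where
  parity := MvPowerSeries.map Super.parity
  parity_parity f := by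
    ext m
    simp [Super.parity_parity]

/-- The number of inversions of a pair of sets of odd generators. -/
def inv {O : Type*} [LinearOrder O] (J K : Finset O) : ℕ :=
  ((J ×ˢ K).filter fun x => x.2 < x.1).card

/-- The Grassmann algebra in the odd generators `ξ_o`, `o ∈ O`, over the super ring `A`: formal
sums `∑_J a_J ξ_J`, where `J` runs over the finite subsets `{j₁ < ⋯ < jᵣ}` of `O`,
`ξ_J = ξ_{j₁} ⋯ ξ_{jᵣ}` and `a_J ∈ A`. If `O` is finite and `A = ℂ`, this is the exterior algebra
of `ℂ^O`; if `O` is infinite, infinite sums are allowed. -/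
@[ext]
structure Grassmann (O A : Type*) where
  /-- The coefficient of `ξ_J`. -/
  coeff : Finset O → A

namespace Grassmann

variable {O A : Type*}

instance addCommGroup [AddCommGroup A] : AddCommGroup (Grassmann O A) where
  zero := ⟨0⟩
  add f g := ⟨f.coeff + g.coeff⟩
  neg f := ⟨-f.coeff⟩
  sub f g := ⟨f.coeff - g.coeff⟩
  nsmul n f := ⟨n • f.coeff⟩
  zsmul n f := ⟨n • f.coeff⟩
  add_assoc f g h := Grassmann.ext (add_assoc f.coeff g.coeff h.coeff)
  add_comm f g := Grassmann.ext (add_comm f.coeff g.coeff)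
  zero_add f := Grassmann.ext (zero_add f.coeff)
  add_zero f := Grassmann.ext (add_zero f.coeff)
  neg_add_cancel f := Grassmann.ext (neg_add_cancel f.coeff)
  sub_eq_add_neg f g := Grassmann.ext (sub_eq_add_neg f.coeff g.coeff)
  nsmul_zero f := Grassmann.ext (zero_nsmul f.coeff)
  nsmul_succ n f := Grassmann.ext (succ_nsmul f.coeff n)
  zsmul_zero' f := Grassmann.ext (zero_zsmul f.coeff)
  zsmul_succ' n f := Grassmann.ext (SubNegMonoid.zsmul_succ' n f.coeff)
  zsmul_neg' n f := Grassmann.ext (SubNegMonoid.zsmul_neg' n f.coeff)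

@[simp]
theorem coeff_zero [AddCommGroup A] (K : Finset O) : (0 : Grassmann O A).coeff K = 0 := rfl

@[simp]
theorem coeff_add [AddCommGroup A] (f g : Grassmann O A) (K : Finset O) :
    (f + g).coeff K = f.coeff K + g.coeff K := rfl

@[simp]
theorem coeff_neg [AddCommGroup A] (f : Grassmann O A) (K : Finset O) :
    (-f).coeff K = -f.coeff K := rfl

/-- Multiplication of the coefficients on the left by scalars. -/
instance {R : Type*} [Ring R] [AddCommGroup A] [Module R A] : Module R (Grassmann O A) where
  smul r f := ⟨r • f.coeff⟩
  one_smul f := Grassmann.ext (one_smul R f.coeff)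
  mul_smul r s f := Grassmann.ext (mul_smul r s f.coeff)
  smul_zero r := Grassmann.ext (smul_zero r)
  smul_add r f g := Grassmann.ext (smul_add r f.coeff g.coeff)
  add_smul r s f := Grassmann.ext (add_smul r s f.coeff)
  zero_smul f := Grassmann.ext (zero_smul R f.coeff)

/-- The element `a ξ_J`. -/
def monomial [DecidableEq O] [AddCommGroup A] (J : Finset O) (a : A) : Grassmann O A :=
  ⟨fun K => if K = J then a else 0⟩

/-- Coefficientwise application of a map that preserves `0`. -/
def mapCoeff {A' : Type*} [AddCommGroup A] [AddCommGroup A'] (g : ZeroHom A A') :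
    ZeroHom (Grassmann O A) (Grassmann O A') where
  toFun f := ⟨fun K => g (f.coeff K)⟩
  map_zero' := Grassmann.ext (funext fun _ => g.map_zero)

theorem inv_union_left [LinearOrder O] {J K : Finset O} (L : Finset O) (h : Disjoint J K) :
    inv (J ∪ K) L = inv J L + inv K L := by
  unfold inv
  rw [Finset.union_product, Finset.filter_union, Finset.card_union_of_disjoint]
  apply Finset.disjoint_filter_filter
  exact Finset.disjoint_product.2 (Or.inl h)

theorem inv_union_right [LinearOrder O] (J : Finset O) {K L : Finset O} (h : Disjoint K L) :
    inv J (K ∪ L) = inv J K + inv J L := by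
  unfold inv
  rw [Finset.product_union, Finset.filter_union, Finset.card_union_of_disjoint]
  apply Finset.disjoint_filter_filter
  exact Finset.disjoint_product.2 (Or.inr h)

/-- The `n`-th power of the parity automorphism. -/
def par [Ring A] [Super A] (n : ℕ) : A →+* A := if Even n then RingHom.id A else Super.parity

theorem par_add [Ring A] [Super A] (m n : ℕ) (a : A) : par (m + n) a = par m (par n a) := by
  unfold par
  by_cases hm : Even m <;> by_cases hn : Even n <;>
    simp [hm, hn, Nat.even_add, Super.parity_parity]

theorem par_parity [Ring A] [Super A] (n : ℕ) (a : A) :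
    par n (Super.parity a) = Super.parity (par n a) := by
  unfold par
  by_cases hn : Even n <;> simp [hn]

instance [DecidableEq O] [Ring A] : One (Grassmann O A) := ⟨monomial ∅ 1⟩

theorem coeff_one [DecidableEq O] [Ring A] (K : Finset O) :
    (1 : Grassmann O A).coeff K = if K = ∅ then 1 else 0 := rfl

variable [LinearOrder O] [Ring A] [Super A]

/-- The product determined by `(a ξ_J) (b ξ_K) = (-1)^{|J| |b|} a b ξ_J ξ_K` and by
`ξ_i ξ_j = - ξ_j ξ_i`, `ξ_i ξ_i = 0`. -/
instance : Mul (Grassmann O A) where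
  mul f g := ⟨fun K => ∑ J ∈ K.powerset,
    (-1 : ℤ) ^ inv J (K \ J) • (f.coeff J * par J.card (g.coeff (K \ J)))⟩

theorem coeff_mul (f g : Grassmann O A) (K : Finset O) :
    (f * g).coeff K = ∑ J ∈ K.powerset,
      (-1 : ℤ) ^ inv J (K \ J) • (f.coeff J * par J.card (g.coeff (K \ J))) := rfl

protected theorem mul_assoc (f g h : Grassmann O A) : f * g * h = f * (g * h) := by
  ext K
  simp only [coeff_mul, Finset.sum_mul, Finset.mul_sum, map_sum, Finset.smul_sum,
    Finset.sum_sigma']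
  refine Finset.sum_bij' (fun x _ => ⟨x.2, x.1 \ x.2⟩) (fun x _ => ⟨x.1 ∪ x.2, x.1⟩) ?_ ?_ ?_ ?_ ?_
  · rintro ⟨M, J⟩ hx
    simp only [Finset.mem_sigma, Finset.mem_powerset] at hx ⊢
    exact ⟨hx.2.trans hx.1, Finset.sdiff_subset_sdiff hx.1 le_rfl⟩
  · rintro ⟨J, L⟩ hx
    simp only [Finset.mem_sigma, Finset.mem_powerset] at hx ⊢
    exact ⟨Finset.union_subset hx.1 (hx.2.trans Finset.sdiff_subset), Finset.subset_union_left⟩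
  · rintro ⟨M, J⟩ hx
    simp only [Finset.mem_sigma, Finset.mem_powerset] at hx
    simp only [Finset.union_sdiff_of_subset hx.2]
  · rintro ⟨J, L⟩ hx
    simp only [Finset.mem_sigma, Finset.mem_powerset] at hx
    have hd : Disjoint J L := Finset.disjoint_of_subset_right hx.2 Finset.disjoint_sdiff
    simp only [Finset.union_sdiff_cancel_left hd]
  · rintro ⟨M, J⟩ hx
    simp only [Finset.mem_sigma, Finset.mem_powerset] at hx
    obtain ⟨hM, hJ⟩ := hx
    have hN : (K \ J) \ (M \ J) = K \ M := by
      ext i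
      simp only [Finset.mem_sdiff]
      have := @hJ i
      tauto
    have hKJ : K \ J = (M \ J) ∪ (K \ M) := by
      ext i
      simp only [Finset.mem_sdiff, Finset.mem_union]
      have := @hJ i
      have := @hM i
      tauto
    have hd : Disjoint (M \ J) (K \ M) :=
      Finset.disjoint_of_subset_left Finset.sdiff_subset Finset.disjoint_sdiff
    have h1 : inv J (K \ J) = inv J (M \ J) + inv J (K \ M) := by
      rw [hKJ, inv_union_right J hd]
    have h2 : inv M (K \ M) = inv J (K \ M) + inv (M \ J) (K \ M) := by
      rw [← inv_union_left (K \ M) Finset.disjoint_sdiff, Finset.union_sdiff_of_subset hJ]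
    have h3 : M.card = J.card + (M \ J).card := by
      rw [Finset.card_sdiff_of_subset hJ]
      have := Finset.card_le_card hJ
      omega
    simp only [hN]
    rw [h1, h2, h3]
    simp only [map_mul, map_zsmul, mul_smul_comm, smul_mul_assoc, smul_smul, par_add, mul_assoc]
    congr 1
    ring

protected theorem one_mul (f : Grassmann O A) : 1 * f = f := by
  ext K
  rw [coeff_mul, Finset.sum_eq_single ∅]
  · simp [coeff_one, inv, par]
  · intro J _ hJ
    simp [coeff_one, hJ]
  · simp

protected theorem mul_one (f : Grassmann O A) : f * 1 = f := by
  ext K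
  rw [coeff_mul, Finset.sum_eq_single K]
  · simp [coeff_one, inv]
  · intro J hJ hne
    have : K \ J ≠ ∅ := fun h =>
      hne (Finset.Subset.antisymm (Finset.mem_powerset.1 hJ) (Finset.sdiff_eq_empty_iff_subset.1 h))
    simp [coeff_one, this]
  · simp

instance : Ring (Grassmann O A) where
  __ := (addCommGroup : AddCommGroup (Grassmann O A))
  left_distrib f g h := by
    ext K
    simp only [coeff_mul, coeff_add, map_add, mul_add, smul_add, Finset.sum_add_distrib]
  right_distrib f g h := by
    ext K
    simp only [coeff_mul, coeff_add, add_mul, smul_add, Finset.sum_add_distrib]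
  zero_mul f := by
    ext K
    simp only [coeff_mul, coeff_zero, zero_mul, smul_zero, Finset.sum_const_zero]
  mul_zero f := by
    ext K
    simp only [coeff_mul, coeff_zero, map_zero, mul_zero, smul_zero, Finset.sum_const_zero]
  mul_assoc := Grassmann.mul_assoc
  one_mul := Grassmann.one_mul
  mul_one := Grassmann.mul_one

/-- The parity of `a ξ_J` is `|a| + |J|`. -/
instance : Super (Grassmann O A) where
  parity :=
    { toFun := fun f => ⟨fun K => (-1 : ℤ) ^ K.card • Super.parity (f.coeff K)⟩
      map_zero' := by
        ext K
        simp
      map_one' := by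
        ext K
        by_cases hK : K = ∅ <;> simp [coeff_one, hK]
      map_add' := fun f g => by
        ext K
        simp
      map_mul' := fun f g => by
        ext K
        simp only [coeff_mul, map_sum, Finset.smul_sum]
        refine Finset.sum_congr rfl fun J hJ => ?_
        have hJ' := Finset.mem_powerset.1 hJ
        have hc : K.card = J.card + (K \ J).card := by
          rw [Finset.card_sdiff_of_subset hJ']
          have := Finset.card_le_card hJ'
          omega
        rw [hc]
        simp only [map_mul, map_zsmul, mul_smul_comm, smul_mul_assoc, smul_smul, par_parity]
        congr 1
        ring }
  parity_parity f := by
    ext K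
    change (-1 : ℤ) ^ K.card • Super.parity ((-1 : ℤ) ^ K.card • Super.parity (f.coeff K)) = _
    rw [map_zsmul, Super.parity_parity, smul_smul, ← mul_pow]
    simp

/-- The left derivative `∂/∂ξ_j`, an odd derivation: for `j ∉ K`, the coefficient of `ξ_K` in
`∂_j f` comes from `a ξ_{K ∪ {j}} = ± a ξ_j ξ_K` and `∂_j (a ξ_j ξ_K) = (-1)^{|a|} a ξ_K`. -/
def oddDeriv (j : O) : Grassmann O A →+ Grassmann O A where
  toFun f := ⟨fun K => if j ∈ K then 0 else
    (-1 : ℤ) ^ (K.filter (· < j)).card • Super.parity (f.coeff (insert j K))⟩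
  map_zero' := by
    ext K
    simp
  map_add' f g := by
    ext K
    by_cases h : j ∈ K <;> simp [h]

end Grassmann

/-! ### The rings of the hierarchy -/

/-- The Grassmann algebra `Λ` over `ℂ` with generators indexed by `ι`. -/
abbrev Lam (ι : Type*) : Type _ := Grassmann ι ℂ

/-- The body of an element of `Λ`. -/
def body {ι : Type*} (a : Lam ι) : ℂ := a.coeff ∅

/-- The ring `Λ[[x, φ, t]]` of power series in infinitely many variables. The even variables are
indexed by `ℕ`: number `0` is `x` and number `k ≥ 1` is `t_{2k}`. The odd variables are indexed
by `ℕ`: number `0` is `φ` and number `k ≥ 1` is `t_{2k-1}`. -/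
abbrev BT (ι : Type*) : Type _ := Grassmann ℕ (MvPowerSeries ℕ (Lam ι))

/-- `V(A) = A((z⁻¹)) ⊕ A((z⁻¹)) θ`, as Laurent series in `z⁻¹` over `A[θ] = A ⊕ A θ`. The
coefficient of `z^k` is `HahnSeries.coeff f (-k)`. For `A = Λ` this is `V`, for `A = Λ[[x, φ, t]]`
it is the extension of scalars of `V`. -/
abbrev V (A : Type*) [Ring A] [Super A] : Type _ := LaurentSeries (Grassmann Unit A)

section V

variable {A : Type*} [Ring A] [Super A]

/-- `a θ^p z^k`, for `p = 0, 1`. -/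
def vMonomial (a : A) (p : Fin 2) (k : ℤ) : V A :=
  HahnSeries.single (-k) (Grassmann.monomial (if p = 0 then ∅ else {()}) a)

/-- `f = O(z⁻¹)`: only negative powers of `z` occur in `f`. -/
def IsNeg (f : V A) : Prop := ∀ k : ℤ, 0 ≤ k → f.coeff (-k) = 0

/-- `f` is odd; `z` is even and `θ` is odd. -/
def IsOddV (f : V A) : Prop := ∀ k : ℤ, IsOdd (f.coeff k)

end V

/-- Coefficientwise application of a map (preserving `0`) to elements `∑ (a_k + b_k θ) z^k`. -/
def mapV {A A' : Type*} [Ring A] [Super A] [Ring A'] [Super A'] (g : ZeroHom A A') (f : V A) : V A' :=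
  HahnSeries.map f (Grassmann.mapCoeff (O := Unit) g)

section Derivations

variable {ι : Type*} [LinearOrder ι]

/-- The partial derivative of power series with respect to the `i`-th even variable. -/
def pderiv {A : Type*} [Ring A] (i : ℕ) : MvPowerSeries ℕ A →+ MvPowerSeries ℕ A where
  toFun f := fun m => (m i + 1) • MvPowerSeries.coeff (m + Finsupp.single i 1) f
  map_zero' := by
    funext m
    simp only [map_zero, smul_zero]
    rfl
  map_add' f g := by
    funext m
    simp only [map_add, smul_add]
    rfl

/-- The derivative on `Λ[[x, φ, t]]` with respect to the `i`-th even variable. -/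
def evenDeriv (i : ℕ) : BT ι →+ BT ι where
  toFun f := ⟨fun K => pderiv i (f.coeff K)⟩
  map_zero' := Grassmann.ext (funext fun _ => map_zero (pderiv i))
  map_add' f g := Grassmann.ext (funext fun K => map_add (pderiv i) (f.coeff K) (g.coeff K))

/-- The odd variable `φ`. -/
def phi : BT ι := Grassmann.monomial {0} 1

/-- `𝓓 = ∂_φ + φ ∂_x`. -/
def superD : BT ι →+ BT ι :=
  Grassmann.oddDeriv 0 + (AddMonoidHom.mulLeft (phi : BT ι)).comp (evenDeriv 0)

/-- `∂/∂t_k` for `k ≥ 1`; the parity of `t_k` is that of `k`. -/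
def timeDeriv (k : ℕ) : BT ι →+ BT ι :=
  if Even k then evenDeriv (k / 2) else Grassmann.oddDeriv ((k + 1) / 2)

/-- `𝓓` on `V(Λ[[x, φ, t]])`. Left derivations act on coefficients that stand on the left. -/
def superDV (f : V (BT ι)) : V (BT ι) := mapV (superD : BT ι →+ BT ι) f

/-- `∂/∂t_k` on `V(Λ[[x, φ, t]])`. -/
def timeDerivV (k : ℕ) (f : V (BT ι)) : V (BT ι) := mapV (timeDeriv k : BT ι →+ BT ι) f

end Derivations

/-! ### The Jacobian super KP hierarchy -/

section Hierarchy

variable {ι : Type*} [LinearOrder ι]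

/-- Faà di Bruno generators: odd elements `θ + φ z + O(z⁻¹)`. -/
structure IsFaaDiBrunoGenerator (h : V (BT ι)) : Prop where
  odd : IsOddV h
  asymptotics : IsNeg (h - (vMonomial 1 1 0 + vMonomial phi 0 1))

/-- The Faà di Bruno polynomials `h^(0) = 1`, `h^(k+1) = (𝓓 + h) h^(k)`. -/
def faaDiBruno (h : V (BT ι)) : ℕ → V (BT ι)
  | 0 => 1
  | k + 1 => superDV (faaDiBruno h k) + h * faaDiBruno h k

/-- The `H^(k)` are the super currents of `h`: they are the elements
`H^(2k+p) = θ^p z^k + O(z⁻¹)`, `p = 0, 1`, of the span of the Faà di Bruno polynomials over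
`Λ[[x, φ, t]]`. -/
structure IsSuperCurrents (h : V (BT ι)) (H : ℕ → V (BT ι)) : Prop where
  mem : ∀ k, H k ∈ Submodule.span (BT ι) (Set.range (faaDiBruno h))
  asymptotics : ∀ (k : ℕ) (p : Fin 2), IsNeg (H (2 * k + p) - vMonomial 1 p k)

/-- `h` is a solution of the Jacobian super KP hierarchy, with super currents `H`:
`∂h/∂t_k = (-1)^k 𝓓 H^(k)` for all `k ≥ 1`. -/
structure IsJSKPSolution (h : V (BT ι)) (H : ℕ → V (BT ι)) : Prop where
  generator : IsFaaDiBrunoGenerator h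
  currents : IsSuperCurrents h H
  flow : ∀ k, 1 ≤ k → timeDerivV k h = (-1) ^ k * superDV (H k)

end Hierarchy

/-! ### Specialization -/

section Specialization

variable {ι : Type*} [LinearOrder ι]

/-- A point `(x₀, φ₀, t₀)` with coordinates in `Λ`, of which only finitely many do not vanish: the
`i`-th even (odd) variable takes the even (odd) value `even i` (`odd i`). -/
structure SuperPoint (ι : Type*) [LinearOrder ι] where
  even : ℕ →₀ Lam ι
  odd : ℕ →₀ Lam ι
  isEven : ∀ i, IsEven (even i)
  isOdd : ∀ i, IsOdd (odd i)

/-- The value at `p` of the monomial in the even variables with exponent `m`. -/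
def SuperPoint.evenMonomial (p : SuperPoint ι) (m : ℕ →₀ ℕ) : Lam ι :=
  ((m.support.sort (· ≤ ·)).map fun i => p.even i ^ m i).prod

/-- The value at `p` of the product of the odd variables with indices in `J`, in increasing
order. -/
def SuperPoint.oddMonomial (p : SuperPoint ι) (J : Finset ℕ) : Lam ι :=
  ((J.sort (· ≤ ·)).map fun j => p.odd j).prod

/-- The value of a power series at `p`: the sum of the values of its terms, coordinate by
coordinate with respect to the basis of `Λ` of products of generators. -/
def SuperPoint.eval (p : SuperPoint ι) : ZeroHom (BT ι) (Lam ι) where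
  toFun f := ⟨fun I => ∑' x : Finset ℕ × (ℕ →₀ ℕ),
    (MvPowerSeries.coeff x.2 (f.coeff x.1) * p.evenMonomial x.2 * p.oddMonomial x.1).coeff I⟩
  map_zero' := by
    ext I
    simp

/-- `f` converges near `p`. Regard every component of `f` as a power series in the even variables
whose value at `p` has a vanishing body; its coefficients are power series in the other even
variables, and they have to converge absolutely for some radii that are larger than the absolute
values of the bodies at `p`. If all bodies vanish (as in the case of nilpotent coordinates), this
holds for every formal power series `f`. -/
def SuperPoint.ConvergesAt (p : SuperPoint ι) (f : BT ι) : Prop :=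
  ∀ (J : Finset ℕ) (I : Finset ι) (n : ℕ →₀ ℕ), ∃ r : ℕ → ℝ,
    (∀ i, 0 ≤ r i) ∧ (∀ i, body (p.even i) ≠ 0 → ‖body (p.even i)‖ < r i) ∧
      Summable fun m : ℕ →₀ ℕ =>
        ‖(MvPowerSeries.coeff (n + m) (f.coeff J)).coeff I‖ * m.prod fun i e => r i ^ e

/-- `h` can be specialized at `p`: all its coefficients converge near `p`. -/
def SuperPoint.CanSpecialize (p : SuperPoint ι) (h : V (BT ι)) : Prop :=
  ∀ (k : ℤ) (s : Finset Unit), p.ConvergesAt ((h.coeff k).coeff s)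

/-- The specialization at `p` of the space spanned by the `H^(k)`: the span over `Λ` of their
specializations. -/
def specializedSpace (H : ℕ → V (BT ι)) (p : SuperPoint ι) : Submodule (Lam ι) (V (Lam ι)) :=
  Submodule.span (Lam ι) (Set.range fun k => mapV p.eval (H k))

/-- The algebra of the elements of `V` that map `W` into itself by multiplication. -/
def stabilizer (W : Submodule (Lam ι) (V (Lam ι))) : Subring (V (Lam ι)) where
  carrier := {f | ∀ w ∈ W, f * w ∈ W}
  mul_mem' := fun {f g} hf hg w hw => by
    rw [mul_assoc]
    exact hf _ (hg w hw)
  one_mem' := fun w hw => by rwa [one_mul]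
  add_mem' := fun {f g} hf hg w hw => by
    rw [add_mul]
    exact W.add_mem (hf w hw) (hg w hw)
  zero_mem' := fun w _ => by
    rw [zero_mul]
    exact W.zero_mem
  neg_mem' := fun {f} hf w hw => by
    rw [neg_mul]
    exact W.neg_mem (hf w hw)

end Specialization

end SuperKP

end

/-! Fix `f` in the stabilizer at `p` and regard it as an element of V_{B_T} with constant
coefficients. The span W of the super currents is the span of the Faà di Bruno polynomials, so ∇ = 𝓓
+ ĥ preserves it. The hierarchy is the zero-curvature equation saying that ∇_k = ∂_{t_k} + Ĥ^(k)
supercommutes with ∇ (`connection_timeDeriv_superD`); as ∇_k 1 = Ĥ^(k) lies in W, every ∇_k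
preserves W as well. Up to parity all these connections commute with multiplication by `f`, because
`f` does not depend on the variables.

Every element of V_{B_T} is uniquely the sum of an element of W and a series O(z⁻¹). Let I be the
ideal generated by the coefficients of the O(z⁻¹) parts r of f Ĥ^(k), together with those for the
parity conjugate of `f`. Modulo I multiplication by `f` preserves W, so the connections send r into
W; the derivatives of r are again O(z⁻¹) and therefore vanish modulo I
(`IsSuperDeriv.negProj_mem_coeffsIn`). So I is stable under 𝓓 and all ∂_{t_k}, hence under every
partial derivative, since 𝓓² = ∂_x. At `p` each r vanishes, because the specialized span contains no
nonzero series O(z⁻¹). A differential ideal of convergent series that vanishes at one point is zero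
(`eq_zero_of_eval_eq_zero`), so f Ĥ^(k) lies in W formally. This identity no longer refers to `p`
and can be specialized at `q`; no path from `p` to `q` is needed.

The analysis takes place in the ring `convSubring p`, which is closed under derivatives and on which
evaluation is multiplicative (`eval_mul`). By elimination without division the currents have
coefficients there as soon as ĥ does (`IsUnitriangular.mem_comb_of_reduced`). A coordinate with body
0 has powers whose components of any given degree eventually vanish, so it imposes no radius; the
shifts in `NearSummable` take care of it. For the identity theorem put g(s) = F(s p), with all
coordinates scaled. The Euler operator computes (s d/ds)^k g at s = 1, so g vanishes identically and
F has constant term g(0) = 0. Applied to all derivatives of F this gives F = 0. -/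

noncomputable section

namespace SuperKP

set_option linter.unusedSectionVars false

open Grassmann

/-! ### Homogeneous elements and supercommutativity -/

section Parity

variable {A : Type*} [Ring A] [Super A]

/-- Homogeneous elements of parity `n` modulo `2`. -/
def IsPar (n : ℕ) (a : A) : Prop := Super.parity a = (-1 : ℤ) ^ n • a

theorem par_of_even {n : ℕ} (hn : Even n) (a : A) : par n a = a := by simp [par, hn]

theorem par_of_odd {n : ℕ} (hn : ¬ Even n) (a : A) : par n a = Super.parity a := by simp [par, hn]

@[simp] theorem par_zero (a : A) : par 0 a = a := by simp [par]

@[simp] theorem par_one (a : A) : par 1 a = Super.parity a := by simp [par]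

@[simp] theorem par_par (n : ℕ) (a : A) : par n (par n a) = a := by
  rw [← par_add, par_of_even ⟨n, rfl⟩]

theorem IsOdd.isPar {a : A} (h : IsOdd a) : IsPar 1 a := by
  simpa [IsPar, IsOdd] using h

theorem IsEven.isPar {a : A} (h : IsEven a) : IsPar 0 a := by
  simpa [IsPar, IsEven] using h

theorem neg_one_pow_zsmul_of_even {M : Type*} [AddCommGroup M] {n : ℕ} (hn : Even n) (a : M) :
    (-1 : ℤ) ^ n • a = a := by rw [hn.neg_one_pow, one_smul]

theorem neg_one_pow_zsmul_of_not_even {M : Type*} [AddCommGroup M] {n : ℕ} (hn : ¬ Even n)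
    (a : M) : (-1 : ℤ) ^ n • a = -a := by
  rw [(Nat.not_even_iff_odd.1 hn).neg_one_pow, neg_smul, one_smul]

theorem IsPar.par_eq {m : ℕ} {a : A} (h : IsPar m a) (n : ℕ) :
    par n a = (-1 : ℤ) ^ (n * m) • a := by
  by_cases hn : Even n
  · rw [par_of_even hn, neg_one_pow_zsmul_of_even (hn.mul_right m)]
  · rw [par_of_odd hn, h]
    by_cases hm : Even m
    · rw [neg_one_pow_zsmul_of_even hm, neg_one_pow_zsmul_of_even (hm.mul_left n)]
    · rw [neg_one_pow_zsmul_of_not_even hm, neg_one_pow_zsmul_of_not_even]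
      simp [Nat.even_mul, hn, hm]

theorem IsPar.mul {m n : ℕ} {a b : A} (ha : IsPar m a) (hb : IsPar n b) :
    IsPar (m + n) (a * b) := by
  unfold IsPar at *
  rw [map_mul, ha, hb, smul_mul_smul_comm, pow_add]

theorem IsPar.congr {m n : ℕ} {a : A} (ha : IsPar m a) (h : (-1 : ℤ) ^ m = (-1) ^ n) :
    IsPar n a := by
  unfold IsPar at *
  rw [ha, h]

theorem isPar_one : IsPar 0 (1 : A) := by simp [IsPar]

/-- Supercommutativity. -/
class SuperComm (A : Type*) [Ring A] [Super A] : Prop where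
  mul_eq : ∀ (n : ℕ) (a b : A), IsPar n a → a * b = par n b * a

theorem IsPar.mul_eq [SuperComm A] {n : ℕ} {a : A} (h : IsPar n a) (b : A) :
    a * b = par n b * a := SuperComm.mul_eq n a b h

theorem IsPar.mul_comm_sign [SuperComm A] {m n : ℕ} {a b : A} (ha : IsPar m a) (hb : IsPar n b) :
    a * b = (-1 : ℤ) ^ (m * n) • (b * a) := by
  rw [ha.mul_eq, hb.par_eq, smul_mul_assoc]

/-- The square equals its own negative and 2 is invertible. It is applied to φ, to the odd
coordinates of a point and to the Faà di Bruno generator. -/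
theorem IsPar.mul_self_eq_zero [SuperComm A] [Module ℚ A] {a : A} (h : IsPar 1 a) : a * a = 0 := by
  have h1 : a * a = -(a * a) := by
    have := h.mul_comm_sign h
    simpa using this
  have h2 : (2 : ℚ) • (a * a) = 0 := by
    rw [two_smul]
    nth_rewrite 1 [h1]
    simp
  have h3 := congrArg (fun x => (2⁻¹ : ℚ) • x) h2
  simpa [smul_smul] using h3

/-- The homogeneous component of parity `n`. -/
def homPart [Module ℚ A] (n : ℕ) (a : A) : A := (2⁻¹ : ℚ) • (a + (-1 : ℤ) ^ n • Super.parity a)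

theorem isPar_homPart [Module ℚ A] (n : ℕ) (a : A) : IsPar n (homPart n a) := by
  unfold IsPar homPart
  have h : (-1 : ℤ) ^ n • (a + (-1 : ℤ) ^ n • Super.parity a) =
      Super.parity a + (-1 : ℤ) ^ n • a := by
    rw [smul_add, smul_smul, ← mul_pow]
    simp [add_comm]
  rw [map_rat_smul Super.parity, map_add, map_zsmul, Super.parity_parity, smul_comm, h]

theorem homPart_add_homPart [Module ℚ A] (a : A) : homPart 0 a + homPart 1 a = a := by
  unfold homPart
  rw [← smul_add]
  have : a + (-1 : ℤ) ^ 0 • Super.parity a + (a + (-1 : ℤ) ^ 1 • Super.parity a) = (2 : ℚ) • a := by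
    rw [two_smul]
    simp only [pow_zero, one_smul, pow_one, neg_smul]
    abel
  rw [this, smul_smul]
  norm_num

instance : SuperComm ℂ where
  mul_eq n a b _ := by
    have : par n b = b := by
      by_cases hn : Even n
      · rw [par_of_even hn]
      · rw [par_of_odd hn]; rfl
    rw [this, mul_comm]

theorem par_complex (n : ℕ) (a : ℂ) : par n a = a := by
  by_cases hn : Even n
  · rw [par_of_even hn]
  · rw [par_of_odd hn]; rfl

end Parity

/-! ### Signs and supercommutativity in Grassmann algebras. -/

namespace Grassmann

variable {O A : Type*}

/-- The coefficient of `ξ_K` as an additive map. -/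
def coeffHom [AddCommGroup A] (K : Finset O) : Grassmann O A →+ A where
  toFun f := f.coeff K
  map_zero' := rfl
  map_add' _ _ := rfl

@[simp] theorem coeff_sub [AddCommGroup A] (f g : Grassmann O A) (K : Finset O) :
    (f - g).coeff K = f.coeff K - g.coeff K := rfl

@[simp] theorem coeff_smul {R : Type*} [Ring R] [AddCommGroup A] [Module R A] (r : R)
    (f : Grassmann O A) (K : Finset O) : (r • f).coeff K = r • f.coeff K := rfl

@[simp] theorem coeff_zsmul [AddCommGroup A] (n : ℤ) (f : Grassmann O A) (K : Finset O) :
    (n • f).coeff K = n • f.coeff K := map_zsmul (coeffHom K) n f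

@[simp] theorem coeff_sum [AddCommGroup A] {κ : Type*} (s : Finset κ) (f : κ → Grassmann O A)
    (K : Finset O) : (∑ i ∈ s, f i).coeff K = ∑ i ∈ s, (f i).coeff K :=
  map_sum (coeffHom K) f s

theorem coeff_monomial [DecidableEq O] [AddCommGroup A] (J K : Finset O) (a : A) :
    (monomial J a).coeff K = if K = J then a else 0 := rfl

@[simp] theorem mapCoeff_coeff {A' : Type*} [AddCommGroup A] [AddCommGroup A'] (g : ZeroHom A A')
    (f : Grassmann O A) (K : Finset O) : (mapCoeff g f).coeff K = g (f.coeff K) := rfl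

/-- Swapping the entries turns the inversions of `(K, J)` into the non-inversions of `(J, K)`;
disjointness excludes equal entries, so the two counts are complementary in `J ×ˢ K`. -/
theorem inv_add_inv [LinearOrder O] {J K : Finset O} (h : Disjoint J K) :
    inv J K + inv K J = J.card * K.card := by
  have h1 : inv K J = ((J ×ˢ K).filter fun x => ¬ x.2 < x.1).card := by
    unfold inv
    refine Finset.card_bij' (fun x _ => (x.2, x.1)) (fun x _ => (x.2, x.1)) ?_ ?_ ?_ ?_
    · rintro ⟨a, b⟩ hx
      simp only [Finset.mem_filter, Finset.mem_product] at hx ⊢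
      exact ⟨⟨hx.1.2, hx.1.1⟩, not_lt.2 hx.2.le⟩
    · rintro ⟨a, b⟩ hx
      simp only [Finset.mem_filter, Finset.mem_product] at hx ⊢
      refine ⟨⟨hx.1.2, hx.1.1⟩, lt_of_le_of_ne (not_lt.1 hx.2) ?_⟩
      rintro rfl
      exact Finset.disjoint_left.1 h hx.1.1 hx.1.2
    · simp
    · simp
  rw [h1, inv, Finset.card_filter_add_card_filter_not, Finset.card_product]

variable [LinearOrder O] [Ring A] [Super A]

theorem coeff_parity (f : Grassmann O A) (K : Finset O) :
    (Super.parity f).coeff K = (-1 : ℤ) ^ K.card • Super.parity (f.coeff K) := rfl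

theorem coeff_par (n : ℕ) (f : Grassmann O A) (K : Finset O) :
    (par n f).coeff K = (-1 : ℤ) ^ (n * K.card) • par n (f.coeff K) := by
  by_cases hn : Even n
  · rw [par_of_even hn, par_of_even hn, neg_one_pow_zsmul_of_even (hn.mul_right _)]
  · rw [par_of_odd hn, par_of_odd hn, coeff_parity, pow_mul,
      (Nat.not_even_iff_odd.1 hn).neg_one_pow]

theorem isPar_iff {n : ℕ} {f : Grassmann O A} :
    IsPar n f ↔ ∀ K, IsPar (n + K.card) (f.coeff K) := by
  unfold IsPar
  constructor
  · intro h K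
    have := congrArg (fun g => (-1 : ℤ) ^ K.card • Grassmann.coeff g K) h
    simp only [coeff_parity, coeff_zsmul, smul_smul, ← pow_add] at this
    rwa [← two_mul, pow_mul, neg_one_sq, one_pow, one_smul, add_comm] at this
  · intro h
    ext K
    rw [coeff_parity, h, smul_smul, ← pow_add, coeff_zsmul, show K.card + (n + K.card) =
      n + 2 * K.card by ring, pow_add, pow_mul _ 2, neg_one_sq, one_pow, mul_one]

instance [SuperComm A] : SuperComm (Grassmann O A) where
  mul_eq n f g hf := by
    ext K
    rw [coeff_mul, coeff_mul]
    refine Finset.sum_bij' (fun J _ => K \ J) (fun J _ => K \ J) ?_ ?_ ?_ ?_ ?_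
    · intro J _
      exact Finset.mem_powerset.2 Finset.sdiff_subset
    · intro J _
      exact Finset.mem_powerset.2 Finset.sdiff_subset
    · intro J hJ
      exact Finset.sdiff_sdiff_eq_self (Finset.mem_powerset.1 hJ)
    · intro J hJ
      exact Finset.sdiff_sdiff_eq_self (Finset.mem_powerset.1 hJ)
    · intro J hJ
      rw [Finset.sdiff_sdiff_eq_self (Finset.mem_powerset.1 hJ)]
      have hfJ := isPar_iff.1 hf J
      rw [hfJ.mul_eq, hfJ.par_eq, coeff_par, ← par_add,
        show n + J.card + J.card = n + 2 * J.card by ring, par_add n,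
        par_of_even (even_two_mul J.card)]
      rw [smul_mul_assoc, mul_smul_comm, smul_smul, smul_smul, ← pow_add, ← pow_add]
      have h := inv_add_inv (Finset.disjoint_sdiff (s := J) (t := K))
      -- Reordering ξ_J past ξ_{K \ J} costs |J| |K \ J| transpositions, which is the sum of the two
      -- inversion numbers; the twists by `n` occur twice and cancel.
      have h' : (-1 : ℤ) ^ (inv (K \ J) J + (n * (K \ J).card + (K \ J).card * (n + J.card))) =
          (-1) ^ inv J (K \ J) := by
        rw [show inv (K \ J) J + (n * (K \ J).card + (K \ J).card * (n + J.card)) =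
          2 * (n * (K \ J).card) + (inv (K \ J) J + J.card * (K \ J).card) by ring, ← h,
          show inv (K \ J) J + (inv J (K \ J) + inv (K \ J) J) =
            2 * inv (K \ J) J + inv J (K \ J) by ring, pow_add, pow_add _ (2 * _), pow_mul,
            pow_mul]
        simp
      rw [add_assoc, h']

end Grassmann

/-! ### Supercommutativity of power series in even variables. -/

section PowerSeries

variable {E A : Type*} [Ring A] [Super A]

theorem coeff_parity_mvPowerSeries (f : MvPowerSeries E A) (m : E →₀ ℕ) :
    MvPowerSeries.coeff m (Super.parity f) = Super.parity (MvPowerSeries.coeff m f) :=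
  MvPowerSeries.coeff_map _ _ _

theorem coeff_par_mvPowerSeries (n : ℕ) (f : MvPowerSeries E A) (m : E →₀ ℕ) :
    MvPowerSeries.coeff m (par n f) = par n (MvPowerSeries.coeff m f) := by
  by_cases hn : Even n
  · rw [par_of_even hn, par_of_even hn]
  · rw [par_of_odd hn, par_of_odd hn, coeff_parity_mvPowerSeries]

theorem isPar_mvPowerSeries_iff {n : ℕ} {f : MvPowerSeries E A} :
    IsPar n f ↔ ∀ m, IsPar n (MvPowerSeries.coeff m f) := by
  unfold IsPar
  rw [MvPowerSeries.ext_iff]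
  refine forall_congr' fun m => ?_
  rw [coeff_parity_mvPowerSeries, map_zsmul]

instance [SuperComm A] : SuperComm (MvPowerSeries E A) where
  mul_eq n f g hf := by
    classical
    ext m
    rw [MvPowerSeries.coeff_mul, MvPowerSeries.coeff_mul]
    refine Finset.sum_nbij' Prod.swap Prod.swap ?_ ?_ (by simp) (by simp) ?_
    · intro x hx
      simpa [Finset.HasAntidiagonal.mem_antidiagonal, add_comm] using hx
    · intro x hx
      simpa [Finset.HasAntidiagonal.mem_antidiagonal, add_comm] using hx
    · intro x _
      rw [coeff_par_mvPowerSeries, (isPar_mvPowerSeries_iff.1 hf _).mul_eq]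
      rfl

end PowerSeries

/-! ### Superderivations -/

section SuperDeriv

variable {A : Type*} [Ring A] [Super A]

/-- `δ` is a left derivation of parity `n`. -/
structure IsSuperDeriv (n : ℕ) (δ : A →+ A) : Prop where
  leibniz : ∀ a b, δ (a * b) = δ a * b + par n a * δ b
  parity : ∀ a, δ (Super.parity a) = (-1 : ℤ) ^ n • Super.parity (δ a)

theorem IsSuperDeriv.par {n : ℕ} {δ : A →+ A} (h : IsSuperDeriv n δ) (m : ℕ) (a : A) :
    δ (par m a) = (-1 : ℤ) ^ (n * m) • Grassmann.par m (δ a) := by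
  by_cases hm : Even m
  · rw [par_of_even hm, par_of_even hm, neg_one_pow_zsmul_of_even (hm.mul_left n)]
  · rw [par_of_odd hm, par_of_odd hm, h.parity, mul_comm, pow_mul,
      (Nat.not_even_iff_odd.1 hm).neg_one_pow]

theorem IsSuperDeriv.map_one {n : ℕ} {δ : A →+ A} (h : IsSuperDeriv n δ) : δ 1 = 0 := by
  have := h.leibniz 1 1
  simpa using this

theorem IsSuperDeriv.add {n : ℕ} {δ ε : A →+ A} (h : IsSuperDeriv n δ) (h' : IsSuperDeriv n ε) :
    IsSuperDeriv n (δ + ε) where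
  leibniz a b := by
    simp only [AddMonoidHom.add_apply, h.leibniz, h'.leibniz, add_mul, mul_add]
    abel
  parity a := by
    simp only [AddMonoidHom.add_apply, h.parity, h'.parity, map_add, smul_add]

/-- Moving the odd factor `c` past `a` produces the sign in the Leibniz rule of an odd derivation.
This covers the summand φ ∂_x of 𝓓. -/
theorem IsSuperDeriv.mulLeft_odd [SuperComm A] {δ : A →+ A} (h : IsSuperDeriv 0 δ) {c : A}
    (hc : IsPar 1 c) : IsSuperDeriv 1 ((AddMonoidHom.mulLeft c).comp δ) where
  leibniz a b := by
    simp only [AddMonoidHom.comp_apply, AddMonoidHom.coe_mulLeft, h.leibniz, par_zero, mul_add,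
      ← mul_assoc, hc.mul_eq a]
  parity a := by
    have hc' : Super.parity c = -c := by simpa [IsPar] using hc
    simp [h.parity, hc']

/-- Coefficientwise application of an additive map. -/
def mapCoeffAdd {O A' : Type*} [Ring A'] (δ : A →+ A') : Grassmann O A →+ Grassmann O A' where
  toFun f := ⟨fun K => δ (f.coeff K)⟩
  map_zero' := by
    ext K
    simp
  map_add' f g := by
    ext K
    simp

@[simp] theorem coeff_mapCoeffAdd {O A' : Type*} [Ring A'] (δ : A →+ A') (f : Grassmann O A)
    (K : Finset O) : (mapCoeffAdd δ f).coeff K = δ (f.coeff K) := rfl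

/-- The product twists the second coefficient by `par J.card`. The sign from commuting `δ` with this
twist is the sign that `par n` produces on ξ_J, so the Leibniz rule holds summand by summand. -/
theorem IsSuperDeriv.mapCoeffAdd {O : Type*} [LinearOrder O] {n : ℕ} {δ : A →+ A}
    (h : IsSuperDeriv n δ) : IsSuperDeriv n (mapCoeffAdd δ : Grassmann O A →+ Grassmann O A) where
  leibniz f g := by
    ext K
    simp only [coeff_mapCoeffAdd, coeff_add, coeff_mul, map_sum, ← Finset.sum_add_distrib]
    refine Finset.sum_congr rfl fun J _ => ?_
    rw [map_zsmul, h.leibniz, h.par, coeff_par, smul_add, smul_mul_assoc, mul_smul_comm]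
  parity f := by
    ext K
    simp only [coeff_mapCoeffAdd, coeff_parity, coeff_zsmul, map_zsmul, h.parity]
    rw [smul_comm]

end SuperDeriv

/-! ### Odd partial derivatives. -/

section OddDeriv

variable {O A : Type*} [LinearOrder O] [Ring A] [Super A]

theorem inv_singleton_left (j : O) (K : Finset O) : inv {j} K = (K.filter (· < j)).card := by
  unfold inv
  rw [Finset.singleton_product, Finset.filter_map, Finset.card_map]
  rfl

theorem coeff_oddDeriv (j : O) (f : Grassmann O A) (K : Finset O) :
    (oddDeriv j f).coeff K = if j ∈ K then 0 else
      (-1 : ℤ) ^ inv {j} K • Super.parity (f.coeff (insert j K)) := by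
  rw [inv_singleton_left]
  rfl

theorem inv_insert_left {j : O} {J : Finset O} (hj : j ∉ J) (L : Finset O) :
    inv (insert j J) L = inv {j} L + inv J L := by
  rw [Finset.insert_eq, inv_union_left _ (Finset.disjoint_singleton_left.2 hj)]

theorem inv_insert_right {j : O} {L : Finset O} (hj : j ∉ L) (J : Finset O) :
    inv J (insert j L) = inv J {j} + inv J L := by
  rw [Finset.insert_eq, inv_union_right _ (Finset.disjoint_singleton_left.2 hj)]

theorem inv_singleton_add {j : O} {J : Finset O} (hj : j ∉ J) :
    inv {j} J + inv J {j} = J.card := by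
  rw [inv_add_inv (Finset.disjoint_singleton_left.2 hj), Finset.card_singleton, one_mul]

theorem neg_one_pow_eq_of_mod {m n : ℕ} (h : m % 2 = n % 2) : (-1 : ℤ) ^ m = (-1) ^ n := by
  rw [← Nat.mod_add_div m 2, ← Nat.mod_add_div n 2, pow_add, pow_add, pow_mul, pow_mul, h]
  simp

/-- For `j ∉ K` the subsets of `insert j K` either contain `j` or not, that is, ξ_j comes from the
first or from the second factor, and this gives the two Leibniz terms. For `j ∈ K` the left side is
0 and the right side cancels in pairs. -/
theorem isSuperDeriv_oddDeriv (j : O) :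
    IsSuperDeriv 1 (oddDeriv j : Grassmann O A →+ Grassmann O A) where
  parity f := by
    ext K
    rw [coeff_zsmul, coeff_parity, coeff_oddDeriv, coeff_oddDeriv]
    by_cases hj : j ∈ K
    · simp [hj]
    · simp only [hj, if_false, coeff_parity, map_zsmul, Super.parity_parity, smul_smul,
        Finset.card_insert_of_notMem hj]
      congr 1
      ring
  leibniz f g := by
    ext K
    rw [coeff_add, coeff_oddDeriv]
    by_cases hj : j ∈ K
    · obtain ⟨K, hjK, rfl⟩ : ∃ K', j ∉ K' ∧ insert j K' = K :=
        ⟨K.erase j, Finset.notMem_erase j K, Finset.insert_erase hj⟩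
      rw [if_pos hj, coeff_mul, coeff_mul, Finset.sum_powerset_insert hjK,
        Finset.sum_powerset_insert hjK]
      -- Of the four sums, two vanish because a derivative by ξ_j has no component containing `j`.
      -- In the other two, the summands for the same `J` both involve `f` at `insert j J` and `g` at
      -- `insert j (K \ J)`, with opposite signs.
      rw [Finset.sum_eq_zero (s := K.powerset) (f := fun J => (-1 : ℤ) ^ inv (insert j J) _ • _),
        Finset.sum_eq_zero (s := K.powerset) (f := fun J => (-1 : ℤ) ^ inv J (insert j K \ J) •
          ((par 1 f).coeff J * _)), add_zero, zero_add, ← Finset.sum_add_distrib]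
      · refine (Finset.sum_eq_zero fun J hJ => ?_).symm
        have hJK := Finset.mem_powerset.1 hJ
        have hjJ : j ∉ J := fun h => hjK (hJK h)
        have hjL : j ∉ K \ J := fun h => hjK (Finset.sdiff_subset h)
        have h1 : insert j K \ J = insert j (K \ J) := Finset.insert_sdiff_of_notMem _ hjJ
        have h2 : insert j K \ insert j J = K \ J := by
          rw [Finset.insert_sdiff_insert, Finset.sdiff_insert_of_notMem hjK]
        rw [h1, h2, coeff_oddDeriv, coeff_oddDeriv, if_neg hjJ, if_neg hjL, coeff_par,
          Finset.card_insert_of_notMem hjJ, par_add J.card 1, par_one, map_zsmul,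
          map_zsmul, par_one, Super.parity_parity]
        simp only [smul_mul_assoc, mul_smul_comm, smul_smul, ← pow_add]
        rw [inv_insert_left hjJ, inv_insert_right hjL]
        have h3 := inv_singleton_add hjJ
        have h4 : (-1 : ℤ) ^ (inv {j} (K \ J) + inv J (K \ J) + (inv {j} (K \ J) + 1 * (J.card + 1)))
            = - (-1) ^ (inv J {j} + inv J (K \ J) + inv {j} J) := by
          rw [← mul_neg_one ((-1 : ℤ) ^ (inv J {j} + _ + _)), ← pow_succ]
          exact neg_one_pow_eq_of_mod (by omega)
        rw [h4, neg_smul, add_neg_cancel]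
      · intro J hJ
        have hjJ : j ∉ J := fun h => hjK (Finset.mem_powerset.1 hJ h)
        rw [coeff_oddDeriv, if_pos, map_zero, mul_zero, smul_zero]
        simp [hjJ]
      · intro J _
        rw [coeff_oddDeriv, if_pos (Finset.mem_insert_self j J), zero_mul, smul_zero]
    · rw [if_neg hj, coeff_mul, coeff_mul, coeff_mul, Finset.sum_powerset_insert hj, map_add,
        smul_add, add_comm]
      congr 1
      · rw [map_sum, Finset.smul_sum]
        refine Finset.sum_congr rfl fun J hJ => ?_
        have hJK := Finset.mem_powerset.1 hJ
        have hjJ : j ∉ J := fun h => hj (hJK h)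
        have hjL : j ∉ K \ J := fun h => hj (Finset.sdiff_subset h)
        have h2 : insert j K \ insert j J = K \ J := by
          rw [Finset.insert_sdiff_insert, Finset.sdiff_insert_of_notMem hj]
        have h5 : inv {j} K = inv {j} J + inv {j} (K \ J) := by
          rw [← inv_union_right _ Finset.disjoint_sdiff, Finset.union_sdiff_of_subset hJK]
        rw [h2, coeff_oddDeriv, if_neg hjJ, Finset.card_insert_of_notMem hjJ, par_add J.card 1,
          par_one, par_parity, map_zsmul, map_mul, Super.parity_parity]
        simp only [smul_mul_assoc, smul_smul, ← pow_add]
        rw [inv_insert_left hjJ, h5]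
        congr 1
        exact neg_one_pow_eq_of_mod (by omega)
      · rw [map_sum, Finset.smul_sum]
        refine Finset.sum_congr rfl fun J hJ => ?_
        have hJK := Finset.mem_powerset.1 hJ
        have hjJ : j ∉ J := fun h => hj (hJK h)
        have hjL : j ∉ K \ J := fun h => hj (Finset.sdiff_subset h)
        have h1 : insert j K \ J = insert j (K \ J) := Finset.insert_sdiff_of_notMem _ hjJ
        have h5 : inv {j} K = inv {j} J + inv {j} (K \ J) := by
          rw [← inv_union_right _ Finset.disjoint_sdiff, Finset.union_sdiff_of_subset hJK]
        have h3 := inv_singleton_add hjJ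
        rw [h1, coeff_oddDeriv, if_neg hjL, coeff_par, par_one, map_zsmul, map_zsmul, par_parity,
          map_mul]
        simp only [smul_mul_assoc, mul_smul_comm, smul_smul, ← pow_add]
        rw [inv_insert_right hjL, h5]
        congr 1
        exact neg_one_pow_eq_of_mod (by omega)

theorem oddDeriv_comm (i j : O) (f : Grassmann O A) :
    oddDeriv i (oddDeriv j f) = -oddDeriv j (oddDeriv i f) := by
  ext K
  simp only [coeff_neg, coeff_oddDeriv, Finset.mem_insert]
  by_cases hij : i = j
  · simp [hij]
  by_cases hi : i ∈ K
  · simp [hi]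
  by_cases hj : j ∈ K
  · simp [hj]
  have hji : ¬ j = i := fun h => hij h.symm
  simp only [hi, hj, hij, hji, if_false, or_self, map_zsmul, smul_smul, ← neg_smul,
    Finset.insert_comm i j]
  rw [inv_insert_right hi, inv_insert_right hj, ← pow_add, ← pow_add,
    ← mul_neg_one ((-1 : ℤ) ^ (inv {j} K + _)), ← pow_succ]
  -- For `i ≠ j` exactly one of the two orders is an inversion; this is the only source of the sign.
  have h := inv_singleton_add (j := i) (J := {j}) (by simpa using hij)
  rw [Finset.card_singleton] at h
  congr 1
  exact neg_one_pow_eq_of_mod (by omega)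

end OddDeriv

/-! ### Even partial derivatives, 𝓓 and the time derivatives. -/

section EvenDeriv

variable {A : Type*} [Ring A] [Super A]

theorem coeff_pderiv (i : ℕ) (f : MvPowerSeries ℕ A) (m : ℕ →₀ ℕ) :
    MvPowerSeries.coeff m (pderiv i f) =
      (m i + 1) • MvPowerSeries.coeff (m + Finsupp.single i 1) f := rfl

theorem sum_antidiagonal_swap {M : Type*} [AddCommMonoid M] (m : ℕ →₀ ℕ)
    (F : (ℕ →₀ ℕ) × (ℕ →₀ ℕ) → M) :
    ∑ x ∈ Finset.HasAntidiagonal.antidiagonal m, F x =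
      ∑ x ∈ Finset.HasAntidiagonal.antidiagonal m, F x.swap :=
  Finset.sum_nbij' Prod.swap Prod.swap
    (by simp [Finset.HasAntidiagonal.mem_antidiagonal, add_comm])
    (by simp [Finset.HasAntidiagonal.mem_antidiagonal, add_comm]) (by simp) (by simp) (by simp)

/-- Splittings whose first part does not involve variable `i` contribute nothing, and the others
arise by adding one unit to the first part of a splitting of `m`. Used once for each factor in the
product rule of `pderiv`. -/
theorem sum_antidiagonal_add_single {M : Type*} [AddCommMonoid M] (m : ℕ →₀ ℕ) (i : ℕ)
    (F : (ℕ →₀ ℕ) × (ℕ →₀ ℕ) → M) (hF : ∀ x, x.1 i = 0 → F x = 0) :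
    ∑ x ∈ Finset.HasAntidiagonal.antidiagonal (m + Finsupp.single i 1), F x =
      ∑ x ∈ Finset.HasAntidiagonal.antidiagonal m, F (x.1 + Finsupp.single i 1, x.2) := by
  symm
  refine Finset.sum_of_injOn (fun x => (x.1 + Finsupp.single i 1, x.2)) ?_ ?_ ?_ ?_
  · rintro ⟨a, b⟩ _ ⟨c, d⟩ _ h
    simpa using h
  · rintro ⟨a, b⟩ h
    simp only [Finset.mem_coe, Finset.HasAntidiagonal.mem_antidiagonal] at h ⊢
    rw [← h]
    abel
  · rintro ⟨a, b⟩ h h'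
    refine hF _ ?_
    by_contra h0
    refine h' ⟨(a - Finsupp.single i 1, b), ?_, ?_⟩
    · simp only [Finset.mem_coe, Finset.HasAntidiagonal.mem_antidiagonal] at h ⊢
      have ha : Finsupp.single i 1 ≤ a := by
        simpa [Finsupp.single_le_iff] using Nat.one_le_iff_ne_zero.2 h0
      rw [← add_right_cancel_iff (a := Finsupp.single i 1), ← h, add_right_comm,
        tsub_add_cancel_of_le ha]
    · have ha : Finsupp.single i 1 ≤ a := by
        simpa [Finsupp.single_le_iff] using Nat.one_le_iff_ne_zero.2 h0
      simp [tsub_add_cancel_of_le ha]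
  · simp

theorem isSuperDeriv_pderiv (i : ℕ) :
    IsSuperDeriv 0 (pderiv i : MvPowerSeries ℕ A →+ MvPowerSeries ℕ A) where
  parity f := by
    ext m
    simp [coeff_pderiv, coeff_parity_mvPowerSeries]
  leibniz f g := by
    classical
    ext m
    rw [map_add, coeff_pderiv, MvPowerSeries.coeff_mul, MvPowerSeries.coeff_mul,
      MvPowerSeries.coeff_mul, par_zero]
    have h1 := sum_antidiagonal_add_single m i
      (fun x => x.1 i • (MvPowerSeries.coeff x.1 f * MvPowerSeries.coeff x.2 g))
      (fun x hx => by simp [hx])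
    have h2 := sum_antidiagonal_add_single m i
      (fun x => x.1 i • (MvPowerSeries.coeff x.2 f * MvPowerSeries.coeff x.1 g))
      (fun x hx => by simp [hx])
    rw [sum_antidiagonal_swap, sum_antidiagonal_swap m] at h2
    have h3 := congrArg₂ (· + ·) h1 h2
    simp only [← Finset.sum_add_distrib, Prod.fst_swap, Prod.snd_swap] at h3 ⊢
    -- The factor m_i + 1 is the sum of the exponents of variable `i` in the two factors, so it
    -- distributes the derivative over them.
    have h4 : ∀ x ∈ Finset.HasAntidiagonal.antidiagonal (m + Finsupp.single i 1),
        (m i + 1) • (MvPowerSeries.coeff x.1 f * MvPowerSeries.coeff x.2 g) =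
          x.1 i • (MvPowerSeries.coeff x.1 f * MvPowerSeries.coeff x.2 g) +
          x.2 i • (MvPowerSeries.coeff x.1 f * MvPowerSeries.coeff x.2 g) := by
      intro x hx
      rw [Finset.HasAntidiagonal.mem_antidiagonal] at hx
      have := DFunLike.congr_fun hx i
      simp only [Finsupp.add_apply, Finsupp.single_eq_same] at this
      rw [← add_smul, this]
    rw [Finset.smul_sum, Finset.sum_congr rfl h4, h3]
    simp only [coeff_pderiv, Finsupp.add_apply, Finsupp.single_eq_same, smul_mul_assoc,
      mul_smul_comm]

theorem pderiv_comm (i j : ℕ) (f : MvPowerSeries ℕ A) :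
    pderiv i (pderiv j f) = pderiv j (pderiv i f) := by
  ext m
  simp only [coeff_pderiv, smul_smul, add_right_comm m (Finsupp.single i 1)]
  by_cases h : i = j
  · rw [h]
  · have h' : ¬ j = i := fun h' => h h'.symm
    simp [h, h', mul_comm]

variable {ι : Type*} [LinearOrder ι]

theorem coeff_evenDeriv (i : ℕ) (f : BT ι) (K : Finset ℕ) :
    (evenDeriv i f).coeff K = pderiv i (f.coeff K) := rfl

theorem isSuperDeriv_evenDeriv (i : ℕ) : IsSuperDeriv 0 (evenDeriv i : BT ι →+ BT ι) :=
  (isSuperDeriv_pderiv i).mapCoeffAdd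

theorem evenDeriv_comm (i j : ℕ) (f : BT ι) :
    evenDeriv i (evenDeriv j f) = evenDeriv j (evenDeriv i f) := by
  ext K : 2
  exact pderiv_comm i j _

theorem evenDeriv_oddDeriv (i j : ℕ) (f : BT ι) :
    evenDeriv i (oddDeriv j f) = oddDeriv j (evenDeriv i f) := by
  ext K : 2
  rw [coeff_evenDeriv, coeff_oddDeriv, coeff_oddDeriv]
  by_cases h : j ∈ K
  · simp [h]
  · simp only [h, if_false, map_zsmul, (isSuperDeriv_pderiv i).parity, coeff_evenDeriv, pow_zero,
      one_smul]

theorem isPar_phi : IsPar 1 (phi : BT ι) := by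
  rw [isPar_iff]
  intro K
  unfold phi
  rw [coeff_monomial]
  split_ifs with h
  · subst h
    exact isPar_one.congr (by simp)
  · simp [IsPar]

theorem evenDeriv_phi (i : ℕ) : evenDeriv i (phi : BT ι) = 0 := by
  ext K : 2
  rw [coeff_evenDeriv, phi, coeff_monomial]
  split_ifs with h
  · exact (isSuperDeriv_pderiv i).map_one
  · simp

theorem oddDeriv_phi (j : ℕ) : oddDeriv j (phi : BT ι) = if j = 0 then 1 else 0 := by
  ext K : 2
  rw [coeff_oddDeriv, phi, coeff_monomial]
  by_cases hj : j = 0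
  · subst hj
    rw [if_pos rfl, coeff_one]
    by_cases hK : K = ∅
    · subst hK
      simp [inv]
    · by_cases h0 : 0 ∈ K
      · simp [h0, hK]
      · have : insert 0 K ≠ {0} := by
          intro h
          have h1 := Finset.card_insert_of_notMem h0
          rw [h, Finset.card_singleton] at h1
          exact hK (Finset.card_eq_zero.1 (by omega))
        simp [h0, hK, this]
  · have : insert j K ≠ {0} := by
      intro h
      have := h ▸ Finset.mem_insert_self j K
      exact hj (Finset.mem_singleton.1 this)
    simp [hj, this]

theorem superD_apply (f : BT ι) : superD f = oddDeriv 0 f + phi * evenDeriv 0 f := rfl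

theorem isSuperDeriv_superD : IsSuperDeriv 1 (superD : BT ι →+ BT ι) :=
  (isSuperDeriv_oddDeriv 0).add ((isSuperDeriv_evenDeriv 0).mulLeft_odd isPar_phi)

theorem isSuperDeriv_timeDeriv (k : ℕ) : IsSuperDeriv (k % 2) (timeDeriv k : BT ι →+ BT ι) := by
  unfold timeDeriv
  split_ifs with h
  · rw [Nat.even_iff.1 h]
    exact isSuperDeriv_evenDeriv _
  · rw [Nat.not_even_iff.1 h]
    exact isSuperDeriv_oddDeriv _

theorem oddDeriv_self (j : ℕ) (f : BT ι) : oddDeriv j (oddDeriv j f) = 0 := by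
  ext K : 2
  simp [coeff_oddDeriv]

theorem phi_mul_phi : (phi : BT ι) * phi = 0 := isPar_phi.mul_self_eq_zero

/-- With ∂_φ² = 0 and φ² = 0 only the mixed terms remain: ∂_φ(φ ∂_x f) = ∂_x f − φ ∂_φ ∂_x f, whose
last term cancels φ ∂_x ∂_φ f. -/
theorem superD_superD (f : BT ι) : superD (superD f) = evenDeriv 0 f := by
  simp only [superD_apply, map_add, (isSuperDeriv_oddDeriv (A := MvPowerSeries ℕ (Lam ι)) 0).leibniz,
    (isSuperDeriv_evenDeriv (ι := ι) 0).leibniz, oddDeriv_self, oddDeriv_phi, evenDeriv_phi,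
    par_one, par_zero, mul_add, ← mul_assoc, phi_mul_phi, evenDeriv_oddDeriv]
  have : Super.parity (phi : BT ι) = -phi := by simpa [IsPar] using isPar_phi (ι := ι)
  simp [this]

/-- The times are independent of x and φ, so ∂_{t_k} annihilates the coefficient φ of 𝓓 and only the
sign of two derivations passing each other is left. -/
theorem timeDeriv_superD {k : ℕ} (hk : 1 ≤ k) (f : BT ι) :
    timeDeriv k (superD f) = (-1 : ℤ) ^ k • superD (timeDeriv k f) := by
  unfold timeDeriv
  split_ifs with h
  · rw [neg_one_pow_zsmul_of_even h]
    simp only [superD_apply, map_add, (isSuperDeriv_evenDeriv (ι := ι) _).leibniz, evenDeriv_phi,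
      evenDeriv_oddDeriv, par_zero, evenDeriv_comm 0]
    simp
  · rw [neg_one_pow_zsmul_of_not_even h]
    have h0 : (k + 1) / 2 ≠ 0 := by omega
    have : Super.parity (phi : BT ι) = -phi := by simpa [IsPar] using isPar_phi (ι := ι)
    simp only [superD_apply, map_add,
      (isSuperDeriv_oddDeriv (A := MvPowerSeries ℕ (Lam ι)) _).leibniz, oddDeriv_phi, if_neg h0,
      par_one, this, evenDeriv_oddDeriv, oddDeriv_comm 0]
    simp [add_comm]

end EvenDeriv

/-! ### Super structure on Laurent series -/

/-- Coefficientwise operations can shrink the support. Enlarging the index set allows products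
before and after such an operation to be compared term by term. -/
theorem coeff_mul_of_support_subset {R : Type*} [Ring R] {x y : LaurentSeries R} {s t : Set ℤ}
    (hs : s.IsPWO) (ht : t.IsPWO) (hxs : x.support ⊆ s) (hyt : y.support ⊆ t) (a : ℤ) :
    (x * y).coeff a = ∑ ij ∈ Finset.antidiagonal hs ht a, x.coeff ij.1 * y.coeff ij.2 := by
  rw [HahnSeries.coeff_mul]
  refine Finset.sum_subset (fun ij h => ?_) fun ij h h' => ?_
  · rw [Finset.mem_antidiagonal] at h ⊢
    exact ⟨hxs h.1, hyt h.2.1, h.2.2⟩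
  · rw [Finset.mem_antidiagonal] at h h'
    by_cases h1 : x.coeff ij.1 = 0
    · rw [h1, zero_mul]
    · by_cases h2 : y.coeff ij.2 = 0
      · rw [h2, mul_zero]
      · exact absurd ⟨h1, h2, h.2.2⟩ h'

theorem support_map_subset {R S : Type*} [AddCommGroup R] [AddCommGroup S] {F : Type*}
    [FunLike F R S] [AddMonoidHomClass F R S] (x : LaurentSeries R) (f : F) :
    (HahnSeries.map x f).support ⊆ x.support :=
  fun k hk h0 => hk (by rw [HahnSeries.map_coeff, h0, map_zero])

section Laurent

variable {A : Type*} [Ring A] [Super A]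

@[simp] theorem coeff_mapV {A' : Type*} [Ring A'] [Super A'] (g : ZeroHom A A') (f : V A) (k : ℤ) :
    (mapV g f).coeff k = Grassmann.mapCoeff g (f.coeff k) := rfl

instance : Super (V A) where
  parity :=
    { toFun := fun f => HahnSeries.map f (Super.parity : Grassmann Unit A →+* Grassmann Unit A)
      map_zero' := by
        ext k : 2
        simp
      map_one' := by
        ext k : 2
        rw [HahnSeries.map_coeff, HahnSeries.coeff_one]
        split_ifs
        · exact map_one _
        · exact map_zero _
      map_add' := fun f g => by
        ext k : 2
        simp
      map_mul' := fun f g => by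
        ext k : 2
        rw [HahnSeries.map_coeff, HahnSeries.coeff_mul, map_sum,
          coeff_mul_of_support_subset f.isPWO_support g.isPWO_support
          (support_map_subset f _) (support_map_subset g _)]
        simp }
  parity_parity f := by
    ext k : 2
    exact Super.parity_parity _

theorem coeff_parityV (f : V A) (k : ℤ) :
    (Super.parity f).coeff k = Super.parity (f.coeff k) := rfl

theorem coeff_parV (n : ℕ) (f : V A) (k : ℤ) : (par n f).coeff k = par n (f.coeff k) := by
  by_cases hn : Even n
  · rw [par_of_even hn, par_of_even hn]
  · rw [par_of_odd hn, par_of_odd hn, coeff_parityV]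

theorem coeff_zsmulV (n : ℤ) (f : V A) (k : ℤ) : (n • f).coeff k = n • f.coeff k :=
  map_zsmul (HahnSeries.coeff.addMonoidHom k) n f

theorem coeff_sumV {κ : Type*} (s : Finset κ) (f : κ → V A) (k : ℤ) :
    (∑ i ∈ s, f i).coeff k = ∑ i ∈ s, (f i).coeff k :=
  map_sum (HahnSeries.coeff.addMonoidHom k) f s

theorem isParV_iff {n : ℕ} {f : V A} : IsPar n f ↔ ∀ k, IsPar n (f.coeff k) := by
  unfold IsPar
  rw [HahnSeries.ext_iff, funext_iff]
  refine forall_congr' fun k => ?_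
  rw [coeff_parityV, coeff_zsmulV]

theorem IsOddV.isPar {f : V A} (h : IsOddV f) : IsPar 1 f :=
  isParV_iff.2 fun k => (h k).isPar

instance [SuperComm A] : SuperComm (V A) where
  mul_eq n f g hf := by
    ext k : 2
    rw [HahnSeries.coeff_mul, coeff_mul_of_support_subset (x := par n g) g.isPWO_support
      f.isPWO_support ?_ subset_rfl]
    · refine Finset.sum_nbij' Prod.swap Prod.swap ?_ ?_ (by simp) (by simp) ?_
      · intro x hx
        simp only [Finset.mem_antidiagonal] at hx ⊢
        exact ⟨hx.2.1, hx.1, by rw [← hx.2.2]; exact add_comm _ _⟩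
      · intro x hx
        simp only [Finset.mem_antidiagonal] at hx ⊢
        exact ⟨hx.2.1, hx.1, by rw [← hx.2.2]; exact add_comm _ _⟩
      · intro x _
        rw [(isParV_iff.1 hf _).mul_eq, coeff_parV]
        rfl
    · intro k hk h0
      refine hk ?_
      rw [coeff_parV, h0, map_zero]

/-- Coefficientwise application of an additive map to elements `∑ (a_k + b_k θ) z^k`. -/
def mapVAdd {A' : Type*} [Ring A'] [Super A'] (δ : A →+ A') : V A →+ V A' where
  toFun f := mapV (δ : ZeroHom A A') f
  map_zero' := by
    ext k : 2
    exact map_zero (Grassmann.mapCoeff (O := Unit) (δ : ZeroHom A A'))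
  map_add' f g := by
    ext k K
    simp

theorem coeff_mapVAdd {A' : Type*} [Ring A'] [Super A'] (δ : A →+ A') (f : V A) (k : ℤ) :
    (mapVAdd δ f).coeff k = mapCoeffAdd δ (f.coeff k) := rfl

theorem IsSuperDeriv.mapVAdd {n : ℕ} {δ : A →+ A} (h : IsSuperDeriv n δ) :
    IsSuperDeriv n (mapVAdd δ) where
  leibniz f g := by
    ext k : 2
    have h1 : (SuperKP.mapVAdd δ f).support ⊆ f.support :=
      support_map_subset _ (SuperKP.mapCoeffAdd δ : Grassmann Unit A →+ _)
    have h2 : (SuperKP.mapVAdd δ g).support ⊆ g.support :=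
      support_map_subset _ (SuperKP.mapCoeffAdd δ : Grassmann Unit A →+ _)
    have h3 : (Grassmann.par n f).support ⊆ f.support := by
      intro k hk h0
      refine hk ?_
      rw [coeff_parV, h0, map_zero]
    rw [coeff_mapVAdd, HahnSeries.coeff_add, HahnSeries.coeff_mul,
      coeff_mul_of_support_subset f.isPWO_support g.isPWO_support h1 subset_rfl,
      coeff_mul_of_support_subset f.isPWO_support g.isPWO_support h3 h2, map_sum,
      ← Finset.sum_add_distrib]
    refine Finset.sum_congr rfl fun x _ => ?_
    rw [h.mapCoeffAdd.leibniz, coeff_mapVAdd, coeff_mapVAdd, coeff_parV]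
  parity f := by
    ext k : 2
    rw [coeff_mapVAdd, coeff_zsmulV, coeff_parityV, coeff_parityV, coeff_mapVAdd,
      h.mapCoeffAdd.parity]

/-! ### Scalars -/

/-- An element of `A` as a constant element of `V(A)`. -/
def constV (c : A) : V A := HahnSeries.C (Grassmann.monomial ∅ c)

theorem monomial_empty_mul {O : Type*} [LinearOrder O] [DecidableEq O] (c : A) (f : Grassmann O A) :
    Grassmann.monomial ∅ c * f = c • f := by
  ext K
  rw [coeff_mul, Finset.sum_eq_single ∅]
  · simp [coeff_monomial, inv]
  · intro J _ hJ
    simp [coeff_monomial, hJ]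
  · simp

theorem constV_mul (c : A) (v : V A) : constV c * v = c • v := by
  ext k : 2
  rw [constV, HahnSeries.C_mul_eq_smul, HahnSeries.coeff_smul, HahnSeries.coeff_smul, smul_eq_mul,
    monomial_empty_mul]

theorem coeff_constV (c : A) (k : ℤ) :
    (constV c).coeff k = if k = 0 then Grassmann.monomial ∅ c else 0 :=
  by classical exact (HahnSeries.coeff_single ..).trans (by congr)

theorem parity_monomial_empty {O : Type*} [LinearOrder O] [DecidableEq O] (c : A) :
    Super.parity (Grassmann.monomial ∅ c : Grassmann O A) =
      Grassmann.monomial ∅ (Super.parity c) := by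
  ext K
  rw [coeff_parity, coeff_monomial, coeff_monomial]
  split_ifs with h <;> simp [h]

theorem parity_constV (c : A) : Super.parity (constV c) = constV (Super.parity c) := by
  ext k : 2
  rw [coeff_parityV, coeff_constV, coeff_constV]
  split_ifs with h
  · exact parity_monomial_empty c
  · simp

theorem par_constV (n : ℕ) (c : A) : par n (constV c) = constV (par n c) := by
  by_cases hn : Even n
  · rw [par_of_even hn, par_of_even hn]
  · rw [par_of_odd hn, par_of_odd hn, parity_constV]

theorem constV_zsmul (n : ℤ) (c : A) : constV (n • c) = n • constV c := by
  ext k K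
  rw [coeff_zsmulV, coeff_constV, coeff_constV]
  split_ifs with h
  · rw [coeff_zsmul, coeff_monomial, coeff_monomial]
    split_ifs <;> simp
  · simp

theorem IsPar.constV {n : ℕ} {c : A} (h : IsPar n c) : IsPar n (constV c) := by
  unfold IsPar at *
  rw [parity_constV, h, constV_zsmul]

theorem parity_smulV (c : A) (v : V A) : Super.parity (c • v) = Super.parity c • Super.parity v := by
  rw [← constV_mul, map_mul, parity_constV, constV_mul]

theorem IsPar.mul_smulV [SuperComm A] {n : ℕ} {u : V A} (h : IsPar n u) (c : A) (v : V A) :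
    u * (c • v) = par n c • (u * v) := by
  rw [← constV_mul, ← mul_assoc, h.mul_eq, par_constV, mul_assoc, constV_mul]

theorem mul_smulV_of_isPar [SuperComm A] {n : ℕ} {c : A} (h : IsPar n c) (u v : V A) :
    u * (c • v) = c • (par n u * v) := by
  rw [← constV_mul, ← constV_mul, ← mul_assoc, ← mul_assoc, h.constV.mul_eq, par_par]

/-- An odd scalar leaves a product only by twisting the factor it passes. For this reason invariance
under `f` is always treated together with invariance under its parity conjugate. -/
theorem mul_smulV [SuperComm A] [Module ℚ A] (c : A) (u v : V A) :
    u * (c • v) = homPart 0 c • (u * v) + homPart 1 c • (Super.parity u * v) := by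
  conv_lhs => rw [← homPart_add_homPart c, add_smul, mul_add,
    mul_smulV_of_isPar (isPar_homPart 0 c), mul_smulV_of_isPar (isPar_homPart 1 c)]
  rw [par_zero, par_one]

theorem mapVAdd_constV (δ : A →+ A) (c : A) : mapVAdd δ (constV c) = constV (δ c) := by
  ext k K
  rw [coeff_mapVAdd, coeff_constV, coeff_constV]
  split_ifs with h
  · by_cases hK : K = ∅ <;> simp [coeff_monomial, hK]
  · simp

theorem IsSuperDeriv.mapVAdd_smul {n : ℕ} {δ : A →+ A} (h : IsSuperDeriv n δ) (c : A) (v : V A) :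
    SuperKP.mapVAdd δ (c • v) = δ c • v + Grassmann.par n c • SuperKP.mapVAdd δ v := by
  rw [← constV_mul, h.mapVAdd.leibniz, mapVAdd_constV, par_constV, constV_mul, constV_mul]

end Laurent

/-! ### Families that are summable with weights slightly larger than `b` -/

section Weights

/-- The value at `b` of the monomial with exponent `m`. -/
def weight (b : ℕ → ℝ) (m : ℕ →₀ ℕ) : ℝ := m.prod fun i e => b i ^ e

theorem weight_add (b : ℕ → ℝ) (m n : ℕ →₀ ℕ) : weight b (m + n) = weight b m * weight b n :=
  Finsupp.prod_add_index' (fun _ => pow_zero _) fun _ _ _ => pow_add _ _ _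

theorem weight_nonneg {b : ℕ → ℝ} (hb : ∀ i, 0 ≤ b i) (m : ℕ →₀ ℕ) : 0 ≤ weight b m :=
  Finset.prod_nonneg fun i _ => pow_nonneg (hb i) _

theorem weight_mono {b c : ℕ → ℝ} (hb : ∀ i, 0 ≤ b i) (hbc : ∀ i, b i ≤ c i) (m : ℕ →₀ ℕ) :
    weight b m ≤ weight c m :=
  Finset.prod_le_prod (fun i _ => pow_nonneg (hb i) _) fun i _ => pow_le_pow_left₀ (hb i) (hbc i) _

theorem weight_mul (ρ : ℝ) (b : ℕ → ℝ) (m : ℕ →₀ ℕ) :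
    weight (fun i => ρ * b i) m = ρ ^ m.degree * weight b m := by
  unfold weight Finsupp.prod
  simp only [mul_pow, Finset.prod_mul_distrib]
  rw [Finset.prod_pow_eq_pow_sum]
  rfl

/-- All shifts of the family `u` are summable with weights slightly larger than `b`. -/
def NearSummable (b : ℕ → ℝ) (u : (ℕ →₀ ℕ) → ℝ) : Prop :=
  ∀ n : ℕ →₀ ℕ, ∃ ρ : ℝ, 1 < ρ ∧ Summable fun m => u (n + m) * weight (fun i => ρ * b i) m

variable {b : ℕ → ℝ} {u v : (ℕ →₀ ℕ) → ℝ}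

theorem summable_weight_anti (hb : ∀ i, 0 ≤ b i) (hu : ∀ m, 0 ≤ u m) {ρ σ : ℝ} (hσ : 0 ≤ σ)
    (h : σ ≤ ρ) (hs : Summable fun m => u m * weight (fun i => ρ * b i) m) :
    Summable fun m => u m * weight (fun i => σ * b i) m :=
  hs.of_nonneg_of_le
    (fun m => mul_nonneg (hu m) (weight_nonneg (fun i => mul_nonneg hσ (hb i)) m))
    fun m => mul_le_mul_of_nonneg_left (weight_mono (fun i => mul_nonneg hσ (hb i))
      (fun i => mul_le_mul_of_nonneg_right h (hb i)) m) (hu m)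

theorem NearSummable.exists_of_finset (hb : ∀ i, 0 ≤ b i) (hu : ∀ m, 0 ≤ u m)
    (h : NearSummable b u) (T : Finset (ℕ →₀ ℕ)) : ∃ ρ : ℝ, 1 < ρ ∧ ∀ n ∈ T,
      Summable fun m => u (n + m) * weight (fun i => ρ * b i) m := by
  classical
  induction T using Finset.induction_on with
  | empty => exact ⟨2, one_lt_two, by simp⟩
  | insert n T _ ih =>
    obtain ⟨ρ, hρ, hT⟩ := ih
    obtain ⟨σ, hσ, hn⟩ := h n
    have h0 : (0 : ℝ) ≤ min ρ σ := le_min (by linarith) (by linarith)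
    refine ⟨min ρ σ, lt_min hρ hσ, fun k hk => ?_⟩
    rcases Finset.mem_insert.1 hk with rfl | hk
    · exact summable_weight_anti hb (fun m => hu (k + m)) h0 (min_le_right _ _) hn
    · exact summable_weight_anti hb (fun m => hu (k + m)) h0 (min_le_left _ _) (hT k hk)

theorem NearSummable.mono (hb : ∀ i, 0 ≤ b i) (hu : ∀ m, 0 ≤ u m) (huv : ∀ m, u m ≤ v m)
    (h : NearSummable b v) : NearSummable b u := by
  intro n
  obtain ⟨ρ, hρ, hs⟩ := h n
  have hw : ∀ m, 0 ≤ weight (fun i => ρ * b i) m :=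
    weight_nonneg fun i => mul_nonneg (by linarith) (hb i)
  exact ⟨ρ, hρ, hs.of_nonneg_of_le (fun m => mul_nonneg (hu _) (hw m))
    fun m => mul_le_mul_of_nonneg_right (huv _) (hw m)⟩

theorem NearSummable.add (hb : ∀ i, 0 ≤ b i) (hu : ∀ m, 0 ≤ u m) (hv : ∀ m, 0 ≤ v m)
    (h : NearSummable b u) (h' : NearSummable b v) : NearSummable b fun m => u m + v m := by
  intro n
  obtain ⟨ρ, hρ, hs⟩ := h n
  obtain ⟨σ, hσ, hs'⟩ := h' n
  have h0 : (0 : ℝ) ≤ min ρ σ := le_min (by linarith) (by linarith)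
  refine ⟨min ρ σ, lt_min hρ hσ, ?_⟩
  simpa only [add_mul] using
    (summable_weight_anti hb (fun m => hu (n + m)) h0 (min_le_left _ _) hs).add
    (summable_weight_anti hb (fun m => hv (n + m)) h0 (min_le_right _ _) hs')

theorem NearSummable.of_finite_support (h : (Function.support u).Finite) : NearSummable b u := by
  intro n
  refine ⟨2, one_lt_two, summable_of_hasFiniteSupport ?_⟩
  refine (h.preimage (f := fun m => n + m) ((add_right_injective n).injOn)).subset ?_
  intro m hm
  exact left_ne_zero_of_mul hm

theorem NearSummable.sum (hb : ∀ i, 0 ≤ b i) {κ : Type*} (s : Finset κ)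
    (w : κ → (ℕ →₀ ℕ) → ℝ) (hw : ∀ k m, 0 ≤ w k m) (h : ∀ k ∈ s, NearSummable b (w k)) :
    NearSummable b fun m => ∑ k ∈ s, w k m := by
  classical
  induction s using Finset.induction_on with
  | empty => exact NearSummable.of_finite_support (by simp [Function.support])
  | insert k s hk ih =>
    simp only [Finset.sum_insert hk]
    exact (h k (Finset.mem_insert_self k s)).add hb (hw k)
      (fun m => Finset.sum_nonneg fun j _ => hw j m)
      (ih fun j hj => h j (Finset.mem_insert_of_mem hj))

/-- Every splitting of `n + m` is the sum of a splitting of `n` and one of `m`, for example with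
first part `x.1 ⊓ n` on `n`. Several choices may give the same `x`, which is harmless as `F ≥ 0`. -/
theorem sum_antidiagonal_add_le (m n : ℕ →₀ ℕ) (F : (ℕ →₀ ℕ) × (ℕ →₀ ℕ) → ℝ) (hF : ∀ x, 0 ≤ F x) :
    ∑ x ∈ Finset.HasAntidiagonal.antidiagonal (n + m), F x ≤
      ∑ a ∈ Finset.HasAntidiagonal.antidiagonal n, ∑ c ∈ Finset.HasAntidiagonal.antidiagonal m,
        F (a.1 + c.1, a.2 + c.2) := by
  classical
  rw [← Finset.sum_product']
  rw [← Finset.sum_fiberwise_of_maps_to (t := Finset.HasAntidiagonal.antidiagonal (n + m))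
    (g := fun y : ((ℕ →₀ ℕ) × (ℕ →₀ ℕ)) × ((ℕ →₀ ℕ) × (ℕ →₀ ℕ)) => (y.1.1 + y.2.1, y.1.2 + y.2.2))]
  · refine Finset.sum_le_sum fun x hx => ?_
    rw [Finset.HasAntidiagonal.mem_antidiagonal] at hx
    have hmem : ((x.1 ⊓ n, n - x.1 ⊓ n), (x.1 - x.1 ⊓ n, x.2 - (n - x.1 ⊓ n))) ∈
        (Finset.HasAntidiagonal.antidiagonal n ×ˢ
          Finset.HasAntidiagonal.antidiagonal m).filter
          fun y => (y.1.1 + y.2.1, y.1.2 + y.2.2) = x := by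
      simp only [Finset.mem_filter, Finset.mem_product, Finset.HasAntidiagonal.mem_antidiagonal]
      refine ⟨⟨?_, ?_⟩, ?_⟩
      · ext i
        simp only [Finsupp.add_apply, Finsupp.inf_apply, Finsupp.tsub_apply]
        omega
      · ext i
        have := DFunLike.congr_fun hx i
        simp only [Finsupp.add_apply, Finsupp.inf_apply, Finsupp.tsub_apply] at this ⊢
        omega
      · refine Prod.ext ?_ ?_
        · ext i
          simp only [Finsupp.add_apply, Finsupp.inf_apply, Finsupp.tsub_apply]
          omega
        · ext i
          have := DFunLike.congr_fun hx i
          simp only [Finsupp.add_apply, Finsupp.inf_apply, Finsupp.tsub_apply] at this ⊢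
          omega
    refine le_trans (le_of_eq ?_) (Finset.single_le_sum (fun y _ => hF _) hmem)
    exact congrArg F (Finset.mem_filter.1 hmem).2.symm
  · rintro ⟨a, c⟩ h
    simp only [Finset.mem_product, Finset.HasAntidiagonal.mem_antidiagonal] at h ⊢
    rw [← h.1, ← h.2]
    abel

/-- The shift by `n` of a convolution is dominated by the finite sum, over the splittings of `n`, of
Cauchy products of shifted families. The smallest of the finitely many ratios works for all of them.
-/
theorem NearSummable.convolution (hb : ∀ i, 0 ≤ b i) (hu : ∀ m, 0 ≤ u m) (hv : ∀ m, 0 ≤ v m)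
    (h : NearSummable b u) (h' : NearSummable b v) :
    NearSummable b fun m => ∑ x ∈ Finset.HasAntidiagonal.antidiagonal m, u x.1 * v x.2 := by
  classical
  intro n
  obtain ⟨ρ, hρ, hs⟩ := h.exists_of_finset hb hu
    ((Finset.HasAntidiagonal.antidiagonal n).image Prod.fst)
  obtain ⟨σ, hσ, hs'⟩ := h'.exists_of_finset hb hv
    ((Finset.HasAntidiagonal.antidiagonal n).image Prod.snd)
  set τ := min ρ σ with hτ
  have h0 : (0 : ℝ) ≤ τ := le_min (by linarith) (by linarith)
  have hw : ∀ m, 0 ≤ weight (fun i => τ * b i) m := weight_nonneg fun i => mul_nonneg h0 (hb i)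
  refine ⟨τ, lt_min hρ hσ, ?_⟩
  have key : Summable fun m => ∑ a ∈ Finset.HasAntidiagonal.antidiagonal n,
      ∑ c ∈ Finset.HasAntidiagonal.antidiagonal m,
        (u (a.1 + c.1) * weight (fun i => τ * b i) c.1) *
          (v (a.2 + c.2) * weight (fun i => τ * b i) c.2) := by
    refine summable_sum fun a ha => ?_
    refine summable_sum_mul_antidiagonal_of_summable_mul
      (f := fun m => u (a.1 + m) * weight (fun i => τ * b i) m)
      (g := fun m => v (a.2 + m) * weight (fun i => τ * b i) m) ?_
    refine Summable.mul_of_nonneg (f := fun m => u (a.1 + m) * weight (fun i => τ * b i) m)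
      (g := fun m => v (a.2 + m) * weight (fun i => τ * b i) m) ?_ ?_ ?_ ?_
    · exact summable_weight_anti hb (fun m => hu _) h0 (min_le_left _ _)
        (hs _ (Finset.mem_image_of_mem _ ha))
    · exact summable_weight_anti hb (fun m => hv _) h0 (min_le_right _ _)
        (hs' _ (Finset.mem_image_of_mem _ ha))
    · exact fun m => mul_nonneg (hu _) (hw m)
    · exact fun m => mul_nonneg (hv _) (hw m)
  refine key.of_nonneg_of_le
    (fun m => mul_nonneg (Finset.sum_nonneg fun x _ => mul_nonneg (hu _) (hv _)) (hw m))
    fun m => ?_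
  refine (mul_le_mul_of_nonneg_right (sum_antidiagonal_add_le m n
    (fun x => u x.1 * v x.2) fun x => mul_nonneg (hu _) (hv _)) (hw m)).trans (le_of_eq ?_)
  rw [Finset.sum_mul]
  refine Finset.sum_congr rfl fun a _ => ?_
  rw [Finset.sum_mul]
  refine Finset.sum_congr rfl fun c hc => ?_
  rw [Finset.HasAntidiagonal.mem_antidiagonal] at hc
  rw [← hc, weight_add]
  ring

/-- The shift by `n` of the derivative is a shift of `u` by one more unit, times a linear factor.
That factor is absorbed by lowering the ratio from `ρ` to the midpoint of 1 and `ρ`. -/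
theorem NearSummable.deriv (hb : ∀ i, 0 ≤ b i) (hu : ∀ m, 0 ≤ u m) (h : NearSummable b u) (i : ℕ) :
    NearSummable b fun m => (m i + 1) * u (m + Finsupp.single i 1) := by
  intro n
  obtain ⟨ρ, hρ, hs⟩ := h (n + Finsupp.single i 1)
  set σ := (1 + ρ) / 2 with hσ
  have hσ1 : 1 < σ := by rw [hσ]; linarith
  have hσρ : σ < ρ := by rw [hσ]; linarith
  have hρ0 : 0 < ρ := by linarith
  have hlt : σ / ρ < 1 := (div_lt_one hρ0).2 hσρ
  have hpos : 0 ≤ σ / ρ := div_nonneg (by linarith) hρ0.le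
  have hbdd : ∃ C : ℝ, 0 ≤ C ∧ ∀ k : ℕ, ((n i : ℝ) + k + 1) * (σ / ρ) ^ k ≤ C := by
    have h1 : Filter.Tendsto (fun k : ℕ => ((n i : ℝ) + k + 1) * (σ / ρ) ^ k) Filter.atTop
        (nhds 0) := by
      have h2 := tendsto_self_mul_const_pow_of_lt_one hpos hlt
      have h3 := (tendsto_pow_atTop_nhds_zero_of_lt_one hpos hlt).const_mul ((n i : ℝ) + 1)
      have h4 := h2.add h3
      simp only [mul_zero, add_zero] at h4
      refine h4.congr fun k => ?_
      ring
    obtain ⟨C, hC⟩ := h1.bddAbove_range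
    exact ⟨C, le_trans (by positivity) (hC ⟨0, rfl⟩), fun k => hC ⟨k, rfl⟩⟩
  obtain ⟨C, hC0, hC⟩ := hbdd
  refine ⟨σ, hσ1, ?_⟩
  have hw : ∀ m, 0 ≤ weight b m := weight_nonneg hb
  refine (hs.mul_left C).of_nonneg_of_le (fun m => ?_) fun m => ?_
  · exact mul_nonneg (mul_nonneg (by positivity) (hu _))
      (weight_nonneg (fun i => mul_nonneg (by linarith) (hb i)) m)
  · beta_reduce
    rw [weight_mul, weight_mul, Finsupp.add_apply, add_right_comm n m]
    have hdeg : m i ≤ m.degree := Finsupp.le_degree i m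
    have h1 : (((n i + m i : ℕ) : ℝ) + 1) * σ ^ m.degree ≤ C * ρ ^ m.degree := by
      have h2 := hC m.degree
      rw [div_pow, mul_div_assoc', div_le_iff₀ (pow_pos hρ0 _)] at h2
      refine le_trans (mul_le_mul_of_nonneg_right ?_ (pow_nonneg (by linarith) _)) h2
      push_cast
      have : (m i : ℝ) ≤ m.degree := by exact_mod_cast hdeg
      linarith
    calc (((n i + m i : ℕ) : ℝ) + 1) * u (n + Finsupp.single i 1 + m) *
          (σ ^ m.degree * weight b m)
        = ((((n i + m i : ℕ) : ℝ) + 1) * σ ^ m.degree) *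
          (u (n + Finsupp.single i 1 + m) * weight b m) := by ring
      _ ≤ (C * ρ ^ m.degree) * (u (n + Finsupp.single i 1 + m) * weight b m) :=
          mul_le_mul_of_nonneg_right h1 (mul_nonneg (hu _) (hw m))
      _ = _ := by ring

end Weights

/-! ### The ring of convergent series -/

section Convergent

variable {ι : Type*} [LinearOrder ι]

theorem norm_coeff_par (n : ℕ) (a : Lam ι) (I : Finset ι) :
    ‖(par n a).coeff I‖ = ‖a.coeff I‖ := by
  rw [coeff_par, par_complex]
  rcases neg_one_pow_eq_or ℤ (n * I.card) with h | h <;> simp [h]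

theorem norm_zsmul_neg_one_pow (n : ℕ) (a : ℂ) : ‖(-1 : ℤ) ^ n • a‖ = ‖a‖ := by
  rcases neg_one_pow_eq_or ℤ n with h | h <;> simp [h]

theorem norm_coeff_neg_one_pow_smul (n : ℕ) (a : Lam ι) (I : Finset ι) :
    ‖((-1 : ℤ) ^ n • a).coeff I‖ = ‖a.coeff I‖ := by
  rw [coeff_zsmul, norm_zsmul_neg_one_pow]

theorem norm_coeff_mul_le (a c : Lam ι) (I : Finset ι) :
    ‖(a * c).coeff I‖ ≤ ∑ I' ∈ I.powerset, ‖a.coeff I'‖ * ‖c.coeff (I \ I')‖ := by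
  rw [coeff_mul]
  refine (norm_sum_le _ _).trans (Finset.sum_le_sum fun J _ => ?_)
  rw [norm_zsmul_neg_one_pow, par_complex, norm_mul]

/-- The absolute values of the components of `F`. -/
def absCoeff (F : BT ι) (J : Finset ℕ) (I : Finset ι) (m : ℕ →₀ ℕ) : ℝ :=
  ‖(MvPowerSeries.coeff m (F.coeff J)).coeff I‖

theorem absCoeff_nonneg (F : BT ι) (J : Finset ℕ) (I : Finset ι) (m : ℕ →₀ ℕ) :
    0 ≤ absCoeff F J I m := norm_nonneg _

theorem absCoeff_mul_le (F G : BT ι) (J : Finset ℕ) (I : Finset ι) (m : ℕ →₀ ℕ) :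
    absCoeff (F * G) J I m ≤ ∑ J' ∈ J.powerset, ∑ I' ∈ I.powerset,
      ∑ x ∈ Finset.HasAntidiagonal.antidiagonal m,
        absCoeff F J' I' x.1 * absCoeff G (J \ J') (I \ I') x.2 := by
  classical
  unfold absCoeff
  rw [coeff_mul, map_sum, coeff_sum]
  refine (norm_sum_le _ _).trans (Finset.sum_le_sum fun J' _ => ?_)
  rw [map_zsmul, norm_coeff_neg_one_pow_smul, MvPowerSeries.coeff_mul, coeff_sum, Finset.sum_comm]
  refine (norm_sum_le _ _).trans (Finset.sum_le_sum fun x _ => ?_)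
  refine (norm_coeff_mul_le _ _ _).trans (Finset.sum_le_sum fun I' _ => ?_)
  rw [coeff_par_mvPowerSeries, norm_coeff_par]

/-- The absolute values of the bodies of the even coordinates. -/
def SuperPoint.radius (p : SuperPoint ι) (i : ℕ) : ℝ := ‖body (p.even i)‖

theorem SuperPoint.radius_nonneg (p : SuperPoint ι) (i : ℕ) : 0 ≤ p.radius i := norm_nonneg _

theorem absCoeff_parity (F : BT ι) (J : Finset ℕ) (I : Finset ι) (m : ℕ →₀ ℕ) :
    absCoeff (Super.parity F) J I m = absCoeff F J I m := by
  unfold absCoeff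
  rw [coeff_parity, map_zsmul, norm_coeff_neg_one_pow_smul, coeff_parity_mvPowerSeries,
    ← par_one (MvPowerSeries.coeff m _), norm_coeff_par]

theorem nearSummable_of_finite (p : SuperPoint ι) {F : BT ι} {J : Finset ℕ} {I : Finset ι}
    (h : {m | MvPowerSeries.coeff m (F.coeff J) ≠ 0}.Finite) :
    NearSummable p.radius (absCoeff F J I) := by
  refine NearSummable.of_finite_support (h.subset fun m hm h0 => hm ?_)
  unfold absCoeff
  rw [h0, coeff_zero, norm_zero]

/-- The element `a x^m ξ_J` of `Λ[[x, φ, t]]`. -/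
def btMonomial (J : Finset ℕ) (m : ℕ →₀ ℕ) (a : Lam ι) : BT ι :=
  Grassmann.monomial J (MvPowerSeries.monomial m a)

theorem finite_btMonomial (J : Finset ℕ) (m : ℕ →₀ ℕ) (a : Lam ι) (K : Finset ℕ) :
    {n | MvPowerSeries.coeff n ((btMonomial J m a).coeff K) ≠ 0}.Finite := by
  classical
  refine (Set.finite_singleton m).subset fun n hn => ?_
  by_contra h
  refine hn ?_
  rw [btMonomial, coeff_monomial]
  split_ifs
  · rw [MvPowerSeries.coeff_monomial, if_neg (by simpa using h)]
  · simp

theorem btMonomial_one : (1 : BT ι) = btMonomial ∅ 0 1 := by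
  unfold btMonomial
  rw [MvPowerSeries.monomial_zero_one]
  rfl

/-- The ring of the power series that converge near `p`. -/
def convSubring (p : SuperPoint ι) : Subring (BT ι) where
  carrier := {F | ∀ J I, NearSummable p.radius (absCoeff F J I)}
  mul_mem' {F G} hF hG J I := by
    refine NearSummable.mono p.radius_nonneg (absCoeff_nonneg _ _ _)
      (absCoeff_mul_le F G J I) ?_
    have hnn : ∀ J' I' (m : ℕ →₀ ℕ), 0 ≤ ∑ x ∈ Finset.HasAntidiagonal.antidiagonal m,
        absCoeff F J' I' x.1 * absCoeff G (J \ J') (I \ I') x.2 := fun J' I' m =>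
      Finset.sum_nonneg fun x _ => mul_nonneg (absCoeff_nonneg ..) (absCoeff_nonneg ..)
    refine NearSummable.sum p.radius_nonneg _ _
      (fun J' m => Finset.sum_nonneg fun I' _ => hnn J' I' m) fun J' _ => ?_
    refine NearSummable.sum p.radius_nonneg _ _ (fun I' m => hnn J' I' m) fun I' _ => ?_
    exact (hF J' I').convolution p.radius_nonneg (absCoeff_nonneg _ _ _) (absCoeff_nonneg _ _ _)
      (hG (J \ J') (I \ I'))
  one_mem' J I := by
    rw [btMonomial_one]
    exact nearSummable_of_finite p (finite_btMonomial ..)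
  add_mem' {F G} hF hG J I :=
    NearSummable.mono p.radius_nonneg (absCoeff_nonneg _ _ _)
      (fun m => by
        unfold absCoeff
        rw [coeff_add, map_add, coeff_add]
        exact norm_add_le _ _)
      ((hF J I).add p.radius_nonneg (absCoeff_nonneg _ _ _) (absCoeff_nonneg _ _ _) (hG J I))
  zero_mem' J I := nearSummable_of_finite p (by simp)
  neg_mem' {F} hF J I := by
    refine NearSummable.mono p.radius_nonneg (absCoeff_nonneg _ _ _) (fun m => ?_) (hF J I)
    unfold absCoeff
    rw [coeff_neg, map_neg, coeff_neg, norm_neg]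

variable {p : SuperPoint ι}

theorem btMonomial_mem_convSubring (J : Finset ℕ) (m : ℕ →₀ ℕ) (a : Lam ι) :
    btMonomial J m a ∈ convSubring p :=
  fun _ _ => nearSummable_of_finite p (finite_btMonomial ..)

theorem phi_eq_btMonomial : (phi : BT ι) = btMonomial {0} 0 1 := by
  unfold btMonomial
  rw [MvPowerSeries.monomial_zero_one]
  rfl

theorem phi_mem_convSubring : (phi : BT ι) ∈ convSubring p := by
  rw [phi_eq_btMonomial (ι := ι)]
  exact btMonomial_mem_convSubring _ _ _

theorem parity_mem_convSubring {F : BT ι} (hF : F ∈ convSubring p) :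
    Super.parity F ∈ convSubring p := by
  intro J I
  convert hF J I using 1
  ext m
  exact absCoeff_parity F J I m

theorem evenDeriv_mem_convSubring (i : ℕ) {F : BT ι} (hF : F ∈ convSubring p) :
    evenDeriv i F ∈ convSubring p := by
  intro J I
  convert (hF J I).deriv p.radius_nonneg (absCoeff_nonneg _ _ _) i using 1
  ext m
  unfold absCoeff
  rw [coeff_evenDeriv, coeff_pderiv, ← natCast_zsmul, coeff_zsmul, zsmul_eq_mul, norm_mul]
  congr 1
  rw [Int.cast_natCast, Complex.norm_natCast]
  push_cast
  rfl

theorem oddDeriv_mem_convSubring (j : ℕ) {F : BT ι} (hF : F ∈ convSubring p) :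
    oddDeriv j F ∈ convSubring p := by
  intro J I
  refine NearSummable.mono p.radius_nonneg (absCoeff_nonneg _ _ _) (fun m => ?_)
    (hF (insert j J) I)
  unfold absCoeff
  rw [coeff_oddDeriv]
  split_ifs
  · simp
  · rw [map_zsmul, norm_coeff_neg_one_pow_smul, coeff_parity_mvPowerSeries,
      ← par_one (MvPowerSeries.coeff m _), norm_coeff_par]

theorem superD_mem_convSubring {F : BT ι} (hF : F ∈ convSubring p) :
    superD F ∈ convSubring p :=
  add_mem (oddDeriv_mem_convSubring 0 hF)
    (mul_mem phi_mem_convSubring (evenDeriv_mem_convSubring 0 hF))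

theorem timeDeriv_mem_convSubring (k : ℕ) {F : BT ι} (hF : F ∈ convSubring p) :
    timeDeriv k F ∈ convSubring p := by
  unfold timeDeriv
  split_ifs
  · exact evenDeriv_mem_convSubring _ hF
  · exact oddDeriv_mem_convSubring _ hF

/-- Only finitely many coordinates are nonzero, so a single ratio above 1 fits under all the radii
that exceed a nonzero body. Where the body is 0 the scaled weight stays 0. -/
theorem SuperPoint.ConvergesAt.mem_convSubring {F : BT ι} (hF : p.ConvergesAt F) :
    F ∈ convSubring p := by
  intro J I n
  obtain ⟨r, hr0, hr, hs⟩ := hF J I n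
  have hev : ∀ᶠ ρ : ℝ in nhdsWithin 1 (Set.Ioi 1), ∀ i ∈ p.even.support,
      body (p.even i) ≠ 0 → ρ * p.radius i < r i := by
    rw [Filter.eventually_all_finset]
    intro i _
    by_cases hi : body (p.even i) = 0
    · simp [hi]
    · have h1 : Filter.Tendsto (fun ρ : ℝ => ρ * p.radius i) (nhds 1) (nhds (1 * p.radius i)) :=
        Filter.Tendsto.mul_const _ Filter.tendsto_id
      rw [one_mul] at h1
      exact ((h1.mono_left nhdsWithin_le_nhds).eventually_lt_const (hr i hi)).mono
        fun _ h _ => h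
  obtain ⟨ρ, hρ, hρ1⟩ := (hev.and self_mem_nhdsWithin).exists
  have hρ1 : 1 < ρ := hρ1
  have hle : ∀ i, ρ * p.radius i ≤ r i := by
    intro i
    by_cases hi : body (p.even i) = 0
    · simpa [SuperPoint.radius, hi] using hr0 i
    · refine (hρ i ?_ hi).le
      rw [Finsupp.mem_support_iff]
      intro h0
      exact hi (by rw [h0]; rfl)
  refine ⟨ρ, hρ1, hs.of_nonneg_of_le (fun m => mul_nonneg (absCoeff_nonneg ..)
    (weight_nonneg (fun i => mul_nonneg (by linarith) (p.radius_nonneg i)) m)) fun m => ?_⟩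
  exact mul_le_mul_of_nonneg_left (weight_mono
    (fun i => mul_nonneg (by linarith) (p.radius_nonneg i)) hle m) (norm_nonneg _)

end Convergent

/-! ### Monomials at a point -/

section Monomials

variable {ι : Type*} [LinearOrder ι] (p : SuperPoint ι)

theorem IsEven.mem_center {a : Lam ι} (h : IsEven a) : a ∈ Subring.center (Lam ι) := by
  rw [Subring.mem_center_iff]
  intro c
  rw [h.isPar.mul_eq, par_zero]

/-- Even elements are central, so the ordered product can be computed in the commutative ring
`Subring.center`, where the rules for `Finsupp.prod` are available. -/
theorem SuperPoint.evenMonomial_eq (m : ℕ →₀ ℕ) : p.evenMonomial m =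
    ((m.prod fun i e => (⟨p.even i, (p.isEven i).mem_center⟩ : Subring.center (Lam ι)) ^ e :
      Subring.center (Lam ι)) : Lam ι) := by
  unfold SuperPoint.evenMonomial Finsupp.prod
  rw [Finset.prod, ← Finset.sort_eq m.support (· ≤ ·), Multiset.map_coe, Multiset.prod_coe,
    ← Subring.subtype_apply, map_list_prod, List.map_map]
  rfl

theorem SuperPoint.evenMonomial_add (m n : ℕ →₀ ℕ) :
    p.evenMonomial (m + n) = p.evenMonomial m * p.evenMonomial n := by
  rw [p.evenMonomial_eq, p.evenMonomial_eq, p.evenMonomial_eq,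
    Finsupp.prod_add_index' (fun _ => pow_zero _) fun _ _ _ => pow_add _ _ _]
  rfl

theorem SuperPoint.evenMonomial_zero : p.evenMonomial 0 = 1 := by
  simp [SuperPoint.evenMonomial]

theorem SuperPoint.evenMonomial_mem_center (m : ℕ →₀ ℕ) :
    p.evenMonomial m ∈ Subring.center (Lam ι) := by
  rw [p.evenMonomial_eq]
  exact Subtype.property _

theorem SuperPoint.evenMonomial_comm (m : ℕ →₀ ℕ) (a : Lam ι) :
    a * p.evenMonomial m = p.evenMonomial m * a :=
  Subring.mem_center_iff.1 (p.evenMonomial_mem_center m) a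

theorem isPar_list_prod_zero {A : Type*} [Ring A] [Super A] (l : List A)
    (h : ∀ a ∈ l, IsPar 0 a) : IsPar 0 l.prod := by
  induction l with
  | nil => exact isPar_one
  | cons a l ih =>
    rw [List.prod_cons]
    exact (h a (by simp)).mul (ih fun c hc => h c (by simp [hc]))

theorem SuperPoint.isPar_evenMonomial (m : ℕ →₀ ℕ) : IsPar 0 (p.evenMonomial m) := by
  refine isPar_list_prod_zero _ fun a ha => ?_
  obtain ⟨i, _, rfl⟩ := List.mem_map.1 ha
  have h := p.isEven i
  simp only [IsPar, IsEven, map_pow] at h ⊢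
  rw [h]
  simp

theorem SuperPoint.isPar_odd (j : ℕ) : IsPar 1 (p.odd j) := (p.isOdd j).isPar

theorem SuperPoint.oddMonomial_empty : p.oddMonomial ∅ = 1 := by
  simp [SuperPoint.oddMonomial]

theorem SuperPoint.oddMonomial_insert_of_lt {j : ℕ} {J : Finset ℕ} (h : ∀ k ∈ J, j < k) :
    p.oddMonomial (insert j J) = p.odd j * p.oddMonomial J := by
  unfold SuperPoint.oddMonomial
  rw [Finset.sort_insert _ (fun b hb => (h b hb).le) fun hj => lt_irrefl _ (h j hj), List.map_cons,
    List.prod_cons]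

theorem SuperPoint.isPar_oddMonomial (J : Finset ℕ) : IsPar J.card (p.oddMonomial J) := by
  induction J using Finset.induction_on_min with
  | empty => rw [p.oddMonomial_empty]; exact isPar_one
  | insert a s ha ih =>
    rw [p.oddMonomial_insert_of_lt ha, Finset.card_insert_of_notMem fun h => lt_irrefl _ (ha a h),
      add_comm]
    exact (p.isPar_odd a).mul ih

theorem SuperPoint.oddMonomial_eq_zero {J : Finset ℕ} (h : ¬ J ⊆ p.odd.support) :
    p.oddMonomial J = 0 := by
  obtain ⟨j, hj, hj'⟩ := Finset.not_subset.1 h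
  unfold SuperPoint.oddMonomial
  refine List.prod_eq_zero (List.mem_map.2 ⟨j, (Finset.mem_sort _).2 hj, ?_⟩)
  simpa using hj'

theorem SuperPoint.odd_mul_oddMonomial (j : ℕ) (J : Finset ℕ) :
    p.odd j * p.oddMonomial J =
      if j ∈ J then 0 else (-1 : ℤ) ^ inv {j} J • p.oddMonomial (insert j J) := by
  induction J using Finset.induction_on_min with
  | empty =>
    rw [← p.oddMonomial_insert_of_lt (by simp)]
    simp [inv]
  | insert a s ha ih =>
    have has : a ∉ s := fun h => lt_irrefl _ (ha a h)
    rcases lt_trichotomy j a with hja | rfl | hja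
    · have h1 : ∀ k ∈ insert a s, j < k := by
        intro k hk
        rcases Finset.mem_insert.1 hk with rfl | hk
        · exact hja
        · exact hja.trans (ha k hk)
      have h2 : inv {j} (insert a s) = 0 := by
        rw [inv_singleton_left, Finset.card_eq_zero, Finset.filter_eq_empty_iff]
        exact fun k hk => (h1 k hk).le.not_gt
      rw [if_neg fun h => lt_irrefl _ (h1 j h), h2, pow_zero, one_smul,
        p.oddMonomial_insert_of_lt h1]
    · rw [if_pos (Finset.mem_insert_self j s), p.oddMonomial_insert_of_lt ha, ← mul_assoc,
        (p.isPar_odd j).mul_self_eq_zero, zero_mul]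
    · rw [p.oddMonomial_insert_of_lt ha, ← mul_assoc,
        (p.isPar_odd j).mul_comm_sign (p.isPar_odd a), smul_mul_assoc, mul_assoc, ih]
      by_cases hjs : j ∈ s
      · simp [hjs]
      · rw [if_neg hjs, if_neg (by simp [hjs, hja.ne']), Finset.insert_comm j a,
          p.oddMonomial_insert_of_lt (J := insert j s), mul_smul_comm, smul_smul, inv_insert_right has,
          inv_singleton_left j {a}, Finset.filter_true_of_mem (by simpa using hja), ← pow_add]
        · simp
        · intro k hk
          rcases Finset.mem_insert.1 hk with rfl | hk
          · exact hja
          · exact ha k hk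

/-- The values of the odd variables obey the sign rule of the formal ones. Together with the
centrality of the even values this makes evaluation multiplicative. -/
theorem SuperPoint.oddMonomial_mul (J K : Finset ℕ) :
    p.oddMonomial J * p.oddMonomial K =
      if Disjoint J K then (-1 : ℤ) ^ inv J K • p.oddMonomial (J ∪ K) else 0 := by
  induction J using Finset.induction_on_min with
  | empty => simp [p.oddMonomial_empty, inv]
  | insert a s ha ih =>
    have has : a ∉ s := fun h => lt_irrefl _ (ha a h)
    rw [p.oddMonomial_insert_of_lt ha, mul_assoc, ih]
    by_cases hd : Disjoint s K
    · rw [if_pos hd, mul_smul_comm, p.odd_mul_oddMonomial]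
      by_cases haK : a ∈ K
      · rw [if_pos (Finset.mem_union_right _ haK), smul_zero, if_neg]
        simp [haK]
      · have h0 : inv {a} s = 0 := by
          rw [inv_singleton_left, Finset.card_eq_zero, Finset.filter_eq_empty_iff]
          exact fun k hk => (ha k hk).le.not_gt
        rw [if_neg (by simp [has, haK]), if_pos (by simp [haK, hd]), smul_smul, ← pow_add,
          inv_insert_left has, inv_union_right _ hd, h0, Finset.insert_union]
        congr 2
        ring
    · rw [if_neg hd, mul_zero, if_neg]
      simp [hd]

/-- The value at `p` of the term of `F` with exponents `x`. -/
def SuperPoint.term (F : BT ι) (x : Finset ℕ × (ℕ →₀ ℕ)) : Lam ι :=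
  MvPowerSeries.coeff x.2 (F.coeff x.1) * p.evenMonomial x.2 * p.oddMonomial x.1

theorem SuperPoint.coeff_eval (F : BT ι) (I : Finset ι) :
    (p.eval F).coeff I = ∑' x, (p.term F x).coeff I := rfl

theorem SuperPoint.term_mul_term (F G : BT ι) (x y : Finset ℕ × (ℕ →₀ ℕ)) :
    p.term F x * p.term G y = MvPowerSeries.coeff x.2 (F.coeff x.1) *
      par x.1.card (MvPowerSeries.coeff y.2 (G.coeff y.1)) * p.evenMonomial (x.2 + y.2) *
        (p.oddMonomial x.1 * p.oddMonomial y.1) := by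
  unfold SuperPoint.term
  rw [p.evenMonomial_add]
  set a := MvPowerSeries.coeff x.2 (F.coeff x.1)
  set c := MvPowerSeries.coeff y.2 (G.coeff y.1)
  set e := p.evenMonomial x.2
  set e' := p.evenMonomial y.2
  have h1 : p.oddMonomial x.1 * c = par x.1.card c * p.oddMonomial x.1 :=
    (p.isPar_oddMonomial x.1).mul_eq c
  have h2 : ∀ b, e * b = b * e := fun b => (p.evenMonomial_comm x.2 b).symm
  have h3 : ∀ b, e' * b = b * e' := fun b => (p.evenMonomial_comm y.2 b).symm
  calc a * e * p.oddMonomial x.1 * (c * e' * p.oddMonomial y.1)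
      = a * e * (p.oddMonomial x.1 * c) * e' * p.oddMonomial y.1 := by simp only [mul_assoc]
    _ = a * (e * par x.1.card c) * (p.oddMonomial x.1 * e') * p.oddMonomial y.1 := by
        rw [h1]; simp only [mul_assoc]
    _ = _ := by rw [h2, ← h3]; simp only [mul_assoc]

theorem SuperPoint.term_mul (F G : BT ι) (x : Finset ℕ × (ℕ →₀ ℕ)) :
    p.term (F * G) x = ∑ J ∈ x.1.powerset, ∑ y ∈ Finset.HasAntidiagonal.antidiagonal x.2,
      p.term F (J, y.1) * p.term G (x.1 \ J, y.2) := by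
  classical
  conv_lhs => rw [SuperPoint.term, coeff_mul, map_sum, Finset.sum_mul, Finset.sum_mul]
  refine Finset.sum_congr rfl fun J hJ => ?_
  rw [map_zsmul, MvPowerSeries.coeff_mul, Finset.smul_sum, Finset.sum_mul, Finset.sum_mul]
  refine Finset.sum_congr rfl fun y hy => ?_
  rw [Finset.HasAntidiagonal.mem_antidiagonal] at hy
  rw [p.term_mul_term, p.oddMonomial_mul, if_pos Finset.disjoint_sdiff,
    Finset.union_sdiff_of_subset (Finset.mem_powerset.1 hJ), hy, coeff_par_mvPowerSeries]
  simp only [smul_mul_assoc, mul_smul_comm]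

/-- Such pairs do not occur in the product of the series; since they also have value 0, the product
of the values may be summed over all pairs. -/
theorem SuperPoint.term_mul_term_of_not_disjoint (F G : BT ι) {x y : Finset ℕ × (ℕ →₀ ℕ)}
    (h : ¬ Disjoint x.1 y.1) : p.term F x * p.term G y = 0 := by
  rw [p.term_mul_term, p.oddMonomial_mul, if_neg h, mul_zero]

theorem SuperPoint.term_add (F G : BT ι) (x : Finset ℕ × (ℕ →₀ ℕ)) :
    p.term (F + G) x = p.term F x + p.term G x := by
  simp [SuperPoint.term, add_mul]

theorem SuperPoint.term_parity (F : BT ι) (x : Finset ℕ × (ℕ →₀ ℕ)) :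
    p.term (Super.parity F) x = Super.parity (p.term F x) := by
  unfold SuperPoint.term
  have h1 : Super.parity (p.evenMonomial x.2) = p.evenMonomial x.2 := by
    simpa [IsPar] using p.isPar_evenMonomial x.2
  have h2 : Super.parity (p.oddMonomial x.1) = _ := p.isPar_oddMonomial x.1
  rw [map_mul, map_mul, h1, h2, coeff_parity, map_zsmul, coeff_parity_mvPowerSeries]
  simp only [smul_mul_assoc, mul_smul_comm]

end Monomials

/-! ### A seminorm on the Grassmann algebra -/

section Seminorm

variable {ι : Type*} [LinearOrder ι]

/-- The weighted `ℓ¹` norm of the components with index set in `I`. -/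
def lamNorm (I : Finset ι) (ε : ℝ) (a : Lam ι) : ℝ :=
  ∑ I' ∈ I.powerset, ε ^ I'.card * ‖a.coeff I'‖

variable (I : Finset ι) {ε : ℝ}

theorem lamNorm_nonneg (hε : 0 ≤ ε) (a : Lam ι) : 0 ≤ lamNorm I ε a :=
  Finset.sum_nonneg fun _ _ => mul_nonneg (pow_nonneg hε _) (norm_nonneg _)

theorem lamNorm_one : lamNorm I ε 1 = 1 := by
  unfold lamNorm
  rw [Finset.sum_eq_single ∅]
  · simp [coeff_one]
  · intro J _ hJ
    simp [coeff_one, hJ]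
  · simp

/-- `(K, J) ↦ (J, K \ J)` is injective and cardinalities add, so the terms of the left side are
among those of the expanded right side. -/
theorem lamNorm_mul_le (hε : 0 ≤ ε) (a c : Lam ι) :
    lamNorm I ε (a * c) ≤ lamNorm I ε a * lamNorm I ε c := by
  unfold lamNorm
  rw [Finset.sum_mul_sum, ← Finset.sum_product']
  have h1 : ∑ K ∈ I.powerset, ε ^ K.card * ‖(a * c).coeff K‖ ≤
      ∑ x ∈ I.powerset.sigma fun K => K.powerset,
        (ε ^ x.2.card * ‖a.coeff x.2‖) * (ε ^ (x.1 \ x.2).card * ‖c.coeff (x.1 \ x.2)‖) := by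
    rw [Finset.sum_sigma]
    refine Finset.sum_le_sum fun K _ => ?_
    refine (mul_le_mul_of_nonneg_left (norm_coeff_mul_le a c K) (pow_nonneg hε _)).trans
      (le_of_eq ?_)
    rw [Finset.mul_sum]
    refine Finset.sum_congr rfl fun J hJ => ?_
    have hJ' := Finset.mem_powerset.1 hJ
    have hc : K.card = J.card + (K \ J).card := by
      rw [Finset.card_sdiff_of_subset hJ']
      have := Finset.card_le_card hJ'
      omega
    simp only
    rw [hc, pow_add]
    ring
  refine h1.trans ?_
  have hinj : Set.InjOn (fun x : (_ : Finset ι) × Finset ι => (x.2, x.1 \ x.2))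
      (I.powerset.sigma fun K => K.powerset) := by
    rintro ⟨K, J⟩ hx ⟨K', J'⟩ hx' h
    simp only [Finset.mem_coe, Finset.mem_sigma, Finset.mem_powerset] at hx hx'
    simp only [Prod.mk.injEq] at h
    obtain ⟨rfl, h⟩ := h
    have : K = K' := by
      rw [← Finset.union_sdiff_of_subset hx.2, h, Finset.union_sdiff_of_subset hx'.2]
    rw [this]
  rw [← Finset.sum_image (f := fun y : Finset ι × Finset ι =>
    (ε ^ y.1.card * ‖a.coeff y.1‖) * (ε ^ y.2.card * ‖c.coeff y.2‖)) hinj]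
  refine Finset.sum_le_sum_of_subset_of_nonneg ?_ fun y _ _ => ?_
  · intro y hy
    obtain ⟨⟨K, J⟩, hx, rfl⟩ := Finset.mem_image.1 hy
    simp only [Finset.mem_sigma, Finset.mem_powerset] at hx
    simp only [Finset.mem_product, Finset.mem_powerset]
    exact ⟨hx.2.trans hx.1, Finset.sdiff_subset.trans hx.1⟩
  · have := pow_nonneg hε
    exact mul_nonneg (mul_nonneg (this _) (norm_nonneg _)) (mul_nonneg (this _) (norm_nonneg _))

theorem lamNorm_pow_le (hε : 0 ≤ ε) (a : Lam ι) (n : ℕ) :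
    lamNorm I ε (a ^ n) ≤ lamNorm I ε a ^ n := by
  induction n with
  | zero => simp [lamNorm_one]
  | succ n ih =>
    rw [pow_succ, pow_succ]
    exact (lamNorm_mul_le I hε _ _).trans
      (mul_le_mul_of_nonneg_right ih (lamNorm_nonneg I hε a))

theorem lamNorm_list_prod_le (hε : 0 ≤ ε) (l : List (Lam ι)) :
    lamNorm I ε l.prod ≤ (l.map (lamNorm I ε)).prod := by
  induction l with
  | nil => simp [lamNorm_one]
  | cons a l ih =>
    rw [List.prod_cons, List.map_cons, List.prod_cons]
    exact (lamNorm_mul_le I hε _ _).trans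
      (mul_le_mul_of_nonneg_left ih (lamNorm_nonneg I hε a))

/-- Without body, each factor contributes at least one generator, so an `n`-fold product starts in
degree `n`. -/
theorem coeff_pow_eq_zero {a : Lam ι} (ha : body a = 0) {n : ℕ} :
    ∀ {K : Finset ι}, K.card < n → (a ^ n).coeff K = 0 := by
  induction n with
  | zero => simp
  | succ n ih =>
    intro K hK
    rw [pow_succ', coeff_mul]
    refine Finset.sum_eq_zero fun J hJ => ?_
    by_cases h : J = ∅
    · have : a.coeff ∅ = 0 := ha
      rw [h, this, zero_mul, smul_zero]
    · rw [ih, map_zero, mul_zero, smul_zero]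
      have h1 := Finset.card_sdiff_add_card_eq_card (Finset.mem_powerset.1 hJ)
      have h2 := Finset.card_pos.2 (Finset.nonempty_iff_ne_empty.2 h)
      omega

theorem lamNorm_pow_eq_zero {a : Lam ι} (ha : body a = 0) {n : ℕ} (hn : I.card < n) :
    lamNorm I ε (a ^ n) = 0 := by
  refine Finset.sum_eq_zero fun J hJ => ?_
  rw [coeff_pow_eq_zero ha ((Finset.card_le_card (Finset.mem_powerset.1 hJ)).trans_lt hn),
    norm_zero, mul_zero]

/-- For small `ε` the seminorm of a coordinate is close to the absolute value of its body, so
convergence conditions that involve only bodies control full Grassmann values. -/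
theorem tendsto_lamNorm (a : Lam ι) :
    Filter.Tendsto (fun ε => lamNorm I ε a) (nhds 0) (nhds ‖body a‖) := by
  have h : Continuous fun ε : ℝ => lamNorm I ε a := by
    unfold lamNorm
    fun_prop
  have h0 : lamNorm I 0 a = ‖body a‖ := by
    unfold lamNorm
    rw [Finset.sum_eq_single ∅]
    · simp [body]
    · intro J _ hJ
      rw [zero_pow (by simpa using hJ), zero_mul]
    · simp
  rw [← h0]
  exact h.tendsto 0

theorem norm_coeff_le_lamNorm (hε : 0 ≤ ε) (a : Lam ι) :
    ε ^ I.card * ‖a.coeff I‖ ≤ lamNorm I ε a :=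
  Finset.single_le_sum (f := fun I' : Finset ι => ε ^ I'.card * ‖a.coeff I'‖)
    (fun _ _ => mul_nonneg (pow_nonneg hε _) (norm_nonneg _)) (Finset.mem_powerset_self I)

theorem lamNorm_evenMonomial_le (p : SuperPoint ι) (hε : 0 ≤ ε) (m : ℕ →₀ ℕ) :
    lamNorm I ε (p.evenMonomial m) ≤ ∏ i ∈ m.support, lamNorm I ε (p.even i ^ m i) := by
  refine (lamNorm_list_prod_le I hε _).trans (le_of_eq ?_)
  rw [Finset.prod, ← Finset.sort_eq m.support (· ≤ ·), Multiset.map_coe, Multiset.prod_coe,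
    List.map_map]
  rfl

/-- Take for `n` the part of `m` in the coordinates with body 0. If some exponent there exceeds
`I.card`, the monomial has seminorm 0; otherwise `n ≤ N`, this part is bounded by `K`, and the
remaining coordinates have seminorm at most τ times the radius. `N` precedes `τ` because the
admissible ratio is found only once the finitely many shifts are known. -/
theorem exists_lamNorm_evenMonomial_le (p : SuperPoint ι) : ∃ N : ℕ →₀ ℕ, ∀ τ : ℝ, 1 < τ →
    ∃ ε : ℝ, 0 < ε ∧ ε ≤ 1 ∧ ∃ K : ℝ, 0 ≤ K ∧ ∀ m, lamNorm I ε (p.evenMonomial m) ≤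
      ∑ n ∈ Finset.Iic N, if n ≤ m then K * weight (fun i => τ * p.radius i) (m - n) else 0 := by
  classical
  refine ⟨Finsupp.onFinset p.even.support
    (fun i => if p.even i = 0 then 0 else I.card) (by intro i hi; simp at hi ⊢; tauto), ?_⟩
  set N := Finsupp.onFinset p.even.support
    (fun i => if p.even i = 0 then 0 else I.card) (by intro i hi; simp at hi ⊢; tauto) with hN
  intro τ hτ
  have hev : ∀ᶠ ε : ℝ in nhdsWithin 0 (Set.Ioi 0), ∀ i ∈ p.even.support,
      p.radius i ≠ 0 → lamNorm I ε (p.even i) < τ * p.radius i := by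
    rw [Filter.eventually_all_finset]
    intro i _
    by_cases hi : p.radius i = 0
    · simp [hi]
    · have h0 : 0 < p.radius i := lt_of_le_of_ne (p.radius_nonneg i) (Ne.symm hi)
      refine (((tendsto_lamNorm I (p.even i)).mono_left
        nhdsWithin_le_nhds).eventually_lt_const ?_).mono fun _ h _ => h
      exact lt_mul_of_one_lt_left h0 hτ
  have hev1 : ∀ᶠ ε : ℝ in nhdsWithin 0 (Set.Ioi 0), ε ≤ 1 :=
    nhdsWithin_le_nhds (Iic_mem_nhds one_pos)
  obtain ⟨ε, ⟨hε, hε1⟩, hε0⟩ := ((hev.and hev1).and self_mem_nhdsWithin).exists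
  have hε0 : 0 < ε := hε0
  -- The maximum with 1 makes this bound all powers up to `I.card`, and lets the product be extended
  -- to all nonzero coordinates.
  set k : ℕ → ℝ := fun i => max 1 (lamNorm I ε (p.even i)) ^ I.card with hk
  have hk1 : ∀ i, 1 ≤ k i := fun i => one_le_pow₀ (le_max_left _ _)
  have hk0 : ∀ i, 0 ≤ k i := fun i => zero_le_one.trans (hk1 i)
  have hKnn : 0 ≤ ∏ i ∈ p.even.support, k i := Finset.prod_nonneg fun i _ => hk0 i
  have hwnn : ∀ m, 0 ≤ weight (fun i => τ * p.radius i) m :=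
    weight_nonneg fun i => mul_nonneg (by linarith) (p.radius_nonneg i)
  refine ⟨ε, hε0, hε1, ∏ i ∈ p.even.support, k i, hKnn, fun m => ?_⟩
  have hsum : ∀ n ∈ Finset.Iic N, 0 ≤ if n ≤ m then
      (∏ i ∈ p.even.support, k i) * weight (fun i => τ * p.radius i) (m - n) else 0 := by
    intro n _
    split_ifs
    · exact mul_nonneg hKnn (hwnn _)
    · exact le_rfl
  refine (lamNorm_evenMonomial_le I p hε0.le m).trans ?_
  by_cases hn : m.filter (fun i => p.radius i = 0) ≤ N
  · refine le_trans ?_ (Finset.single_le_sum hsum (Finset.mem_Iic.2 hn))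
    have hle : m.filter (fun i => p.radius i = 0) ≤ m := by
      intro i
      rw [Finsupp.filter_apply]
      split_ifs <;> simp
    have hsub : m - m.filter (fun i => p.radius i = 0) = m.filter fun i => ¬ p.radius i = 0 := by
      ext i
      rw [Finsupp.tsub_apply, Finsupp.filter_apply, Finsupp.filter_apply]
      by_cases h : p.radius i = 0 <;> simp [h]
    rw [if_pos hle, hsub]
    have hpt : ∀ i ∈ m.support, lamNorm I ε (p.even i ^ m i) ≤
        if p.radius i = 0 then k i else (τ * p.radius i) ^ m i := by
      intro i _
      refine (lamNorm_pow_le I hε0.le _ _).trans ?_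
      split_ifs with h
      · have hmi : m i ≤ I.card := by
          have h1 := hn i
          rw [Finsupp.filter_apply, if_pos h] at h1
          refine h1.trans ?_
          rw [hN, Finsupp.onFinset_apply]
          split_ifs <;> simp
        calc lamNorm I ε (p.even i) ^ m i ≤ max 1 (lamNorm I ε (p.even i)) ^ m i :=
              pow_le_pow_left₀ (lamNorm_nonneg I hε0.le _) (le_max_right _ _) _
          _ ≤ k i := pow_le_pow_right₀ (le_max_left _ _) hmi
      · refine pow_le_pow_left₀ (lamNorm_nonneg I hε0.le _) (hε i ?_ h).le _
        rw [Finsupp.mem_support_iff]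
        intro h0
        exact h (by simp [SuperPoint.radius, h0, body])
    refine (Finset.prod_le_prod (fun i _ => lamNorm_nonneg I hε0.le _) hpt).trans ?_
    rw [Finset.prod_ite]
    refine mul_le_mul ?_ (le_of_eq ?_) (Finset.prod_nonneg fun i _ =>
      pow_nonneg (mul_nonneg (by linarith) (p.radius_nonneg i)) _) hKnn
    · refine Finset.prod_le_prod_of_subset_of_one_le ?_ (fun i _ => hk0 i) fun i _ _ => hk1 i
      intro i hi
      rw [Finset.mem_filter, Finsupp.mem_support_iff] at hi
      rw [Finsupp.mem_support_iff]
      intro h0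
      have h1 := hn i
      rw [Finsupp.filter_apply, if_pos hi.2, hN, Finsupp.onFinset_apply, if_pos h0] at h1
      exact hi.1 (by omega)
    · unfold weight Finsupp.prod
      rw [Finsupp.support_filter]
      refine Finset.prod_congr rfl fun i hi => ?_
      rw [Finsupp.filter_apply, if_pos (Finset.mem_filter.1 hi).2]
  · refine le_trans (le_of_eq ?_) (Finset.sum_nonneg hsum)
    obtain ⟨i, hi⟩ : ∃ i, ¬ m.filter (fun i => p.radius i = 0) i ≤ N i := by
      by_contra! h
      exact hn h
    rw [Finsupp.filter_apply] at hi
    by_cases hr : p.radius i = 0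
    · rw [if_pos hr, hN, Finsupp.onFinset_apply] at hi
      have hmi : m i ≠ 0 := by
        intro h
        rw [h] at hi
        exact hi (Nat.zero_le _)
      refine Finset.prod_eq_zero (Finsupp.mem_support_iff.2 hmi) ?_
      by_cases h0 : p.even i = 0
      · rw [h0, zero_pow hmi]
        simp [lamNorm]
      · rw [if_neg h0] at hi
        exact lamNorm_pow_eq_zero I (norm_eq_zero.1 hr) (by omega)
    · rw [if_neg hr] at hi
      exact absurd (Nat.zero_le _) hi

end Seminorm

/-! ### Evaluation of convergent series -/

section Evaluation

variable {ι : Type*} [LinearOrder ι] {p : SuperPoint ι}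

/-- The total degree of a monomial in the odd and even variables. -/
def totalDegree (x : Finset ℕ × (ℕ →₀ ℕ)) : ℕ := x.1.card + x.2.degree

/-- The sum factors into a finite one over the odd monomials in nonzero coordinates and one over
even exponents, dominated by finitely many shifts of the components of `F`. The surplus factor `ρ >
1` per degree yields holomorphy beyond the unit disc in the identity theorem. -/
theorem summable_term_near {F : BT ι} (hF : F ∈ convSubring p) (I : Finset ι) :
    ∃ ρ : ℝ, 1 < ρ ∧ Summable fun x => ρ ^ totalDegree x * ‖(p.term F x).coeff I‖ := by
  classical
  obtain ⟨N, hN⟩ := exists_lamNorm_evenMonomial_le I p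
  set u : (ℕ →₀ ℕ) → ℝ := fun m => ∑ J ∈ p.odd.support.powerset, ∑ I' ∈ I.powerset,
    absCoeff F J I' m with hu
  have hu0 : ∀ m, 0 ≤ u m := fun m =>
    Finset.sum_nonneg fun J _ => Finset.sum_nonneg fun I' _ => absCoeff_nonneg ..
  have hus : NearSummable p.radius u :=
    NearSummable.sum p.radius_nonneg _ _
      (fun J m => Finset.sum_nonneg fun I' _ => absCoeff_nonneg ..) fun J _ =>
      NearSummable.sum p.radius_nonneg _ _ (fun I' m => absCoeff_nonneg ..) fun I' _ => hF J I'
  obtain ⟨ρ₀, hρ₀, hs⟩ := hus.exists_of_finset p.radius_nonneg hu0 (Finset.Iic N)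
  -- The ratio is split into two equal factors: one pays for `ρ ^ totalDegree`, the other for the
  -- seminorm of the even monomial.
  set ρ := Real.sqrt ρ₀ with hρ
  have hρρ : ρ * ρ = ρ₀ := Real.mul_self_sqrt (by linarith)
  have hρ1 : 1 < ρ := Real.lt_sqrt_of_sq_lt (by simpa using hρ₀)
  have hρ0 : 0 ≤ ρ := by linarith
  obtain ⟨ε, hε0, hε1, K, hK, hE⟩ := hN ρ hρ1
  have hwnn : ∀ m, 0 ≤ weight (fun i => ρ * p.radius i) m :=
    weight_nonneg fun i => mul_nonneg hρ0 (p.radius_nonneg i)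
  set v : (ℕ →₀ ℕ) → ℝ := fun m => ∑ n ∈ Finset.Iic N,
    if n ≤ m then ρ ^ m.degree * (u m * (K * weight (fun i => ρ * p.radius i) (m - n))) else 0
    with hv
  have hv0 : ∀ m, 0 ≤ v m := by
    intro m
    refine Finset.sum_nonneg fun n _ => ?_
    split_ifs
    · exact mul_nonneg (pow_nonneg hρ0 _) (mul_nonneg (hu0 m) (mul_nonneg hK (hwnn _)))
    · exact le_rfl
  have hvs : Summable v := by
    refine summable_sum fun n hn => ?_
    have hinj : Function.Injective fun m : ℕ →₀ ℕ => n + m := add_right_injective n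
    rw [← hinj.summable_iff]
    · refine ((hs n hn).mul_left (ρ ^ n.degree * K)).congr fun m => ?_
      simp only [Function.comp_apply]
      rw [if_pos le_self_add, add_tsub_cancel_left, map_add, pow_add, weight_mul, weight_mul,
        ← hρρ, mul_pow]
      ring
    · intro m hm
      rw [if_neg]
      intro h
      exact hm ⟨m - n, add_tsub_cancel_of_le h⟩
  set c : Finset ℕ → ℝ := fun J => if J ∈ p.odd.support.powerset then
    ρ ^ J.card * lamNorm I ε (p.oddMonomial J) / ε ^ I.card else 0 with hc
  have hc0 : ∀ J, 0 ≤ c J := by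
    intro J
    simp only [hc]
    split_ifs
    · exact div_nonneg (mul_nonneg (pow_nonneg hρ0 _) (lamNorm_nonneg I hε0.le _))
        (pow_nonneg hε0.le _)
    · exact le_rfl
  have hcs : Summable c := by
    refine summable_of_ne_finset_zero (s := p.odd.support.powerset) fun J hJ => ?_
    simp only [hc, if_neg hJ]
  refine ⟨ρ, hρ1, (hcs.mul_of_nonneg hvs hc0 hv0).of_nonneg_of_le
    (fun x => mul_nonneg (pow_nonneg hρ0 _) (norm_nonneg _)) ?_⟩
  rintro ⟨J, m⟩
  by_cases hJ : J ⊆ p.odd.support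
  · have hJ' : J ∈ p.odd.support.powerset := Finset.mem_powerset.2 hJ
    have h1 : ε ^ I.card * ‖(p.term F (J, m)).coeff I‖ ≤
        u m * lamNorm I ε (p.evenMonomial m) * lamNorm I ε (p.oddMonomial J) := by
      refine (norm_coeff_le_lamNorm I hε0.le _).trans ?_
      refine (lamNorm_mul_le I hε0.le _ _).trans ?_
      refine mul_le_mul_of_nonneg_right ?_ (lamNorm_nonneg I hε0.le _)
      refine (lamNorm_mul_le I hε0.le _ _).trans ?_
      refine mul_le_mul_of_nonneg_right ?_ (lamNorm_nonneg I hε0.le _)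
      refine le_trans ?_ (Finset.single_le_sum (f := fun J => ∑ I' ∈ I.powerset,
        absCoeff F J I' m) (fun J _ => Finset.sum_nonneg fun I' _ => absCoeff_nonneg ..) hJ')
      refine Finset.sum_le_sum fun I' _ => ?_
      exact mul_le_of_le_one_left (norm_nonneg _) (pow_le_one₀ hε0.le hε1)
    have h2 : ρ ^ m.degree * (u m * lamNorm I ε (p.evenMonomial m)) ≤ v m := by
      have h3 := mul_le_mul_of_nonneg_left (mul_le_mul_of_nonneg_left (hE m) (hu0 m))
        (pow_nonneg hρ0 m.degree)
      refine h3.trans (le_of_eq ?_)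
      simp only [hv, Finset.mul_sum]
      refine Finset.sum_congr rfl fun n _ => ?_
      split_ifs <;> simp
    have hεI : 0 < ε ^ I.card := pow_pos hε0 _
    simp only [hc, if_pos hJ', totalDegree]
    rw [pow_add, div_mul_eq_mul_div, le_div_iff₀ hεI]
    calc ρ ^ J.card * ρ ^ m.degree * ‖(p.term F (J, m)).coeff I‖ * ε ^ I.card
        = ρ ^ J.card * ρ ^ m.degree * (ε ^ I.card * ‖(p.term F (J, m)).coeff I‖) := by ring
      _ ≤ ρ ^ J.card * ρ ^ m.degree *
          (u m * lamNorm I ε (p.evenMonomial m) * lamNorm I ε (p.oddMonomial J)) :=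
          mul_le_mul_of_nonneg_left h1 (mul_nonneg (pow_nonneg hρ0 _) (pow_nonneg hρ0 _))
      _ = ρ ^ J.card * lamNorm I ε (p.oddMonomial J) *
          (ρ ^ m.degree * (u m * lamNorm I ε (p.evenMonomial m))) := by ring
      _ ≤ _ := mul_le_mul_of_nonneg_left h2
          (mul_nonneg (pow_nonneg hρ0 _) (lamNorm_nonneg I hε0.le _))
  · have : p.term F (J, m) = 0 := by
      rw [SuperPoint.term, p.oddMonomial_eq_zero hJ, mul_zero]
    rw [this, coeff_zero, norm_zero, mul_zero]
    exact mul_nonneg (hc0 _) (hv0 _)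

theorem summable_norm_term {F : BT ι} (hF : F ∈ convSubring p) (I : Finset ι) :
    Summable fun x => ‖(p.term F x).coeff I‖ := by
  obtain ⟨ρ, hρ, hs⟩ := summable_term_near hF I
  exact hs.of_nonneg_of_le (fun x => norm_nonneg _) fun x =>
    le_mul_of_one_le_left (norm_nonneg _) (one_le_pow₀ hρ.le)

theorem summable_term {F : BT ι} (hF : F ∈ convSubring p) (I : Finset ι) :
    Summable fun x => (p.term F x).coeff I := (summable_norm_term hF I).of_norm

theorem eval_add {F G : BT ι} (hF : F ∈ convSubring p) (hG : G ∈ convSubring p) :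
    p.eval (F + G) = p.eval F + p.eval G := by
  ext I
  simp only [coeff_add, p.coeff_eval, p.term_add]
  exact (summable_term hF I).tsum_add (summable_term hG I)

theorem eval_parity (F : BT ι) : p.eval (Super.parity F) = Super.parity (p.eval F) := by
  ext I
  rw [coeff_parity, p.coeff_eval, p.coeff_eval]
  simp only [p.term_parity, coeff_parity]
  change ∑' x, (-1 : ℤ) ^ I.card • (p.term F x).coeff I = (-1 : ℤ) ^ I.card • ∑' x, _
  rcases neg_one_pow_eq_or ℤ I.card with h | h <;> simp [h, tsum_neg]

theorem eval_mul {F G : BT ι} (hF : F ∈ convSubring p) (hG : G ∈ convSubring p) :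
    p.eval (F * G) = p.eval F * p.eval G := by
  classical
  ext I
  have hs : ∀ I' ∈ I.powerset, Summable fun y : (Finset ℕ × (ℕ →₀ ℕ)) × (Finset ℕ × (ℕ →₀ ℕ)) =>
      (p.term F y.1).coeff I' * (p.term G y.2).coeff (I \ I') := fun I' _ =>
    summable_mul_of_summable_norm (f := fun x => (p.term F x).coeff I')
      (g := fun x => (p.term G x).coeff (I \ I')) (summable_norm_term hF I')
      (summable_norm_term hG (I \ I'))
  have hexp : ∀ y : (Finset ℕ × (ℕ →₀ ℕ)) × (Finset ℕ × (ℕ →₀ ℕ)),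
      (p.term F y.1 * p.term G y.2).coeff I = ∑ I' ∈ I.powerset, (-1 : ℤ) ^ inv I' (I \ I') •
        ((p.term F y.1).coeff I' * (p.term G y.2).coeff (I \ I')) := by
    intro y
    rw [coeff_mul]
    simp only [par_complex]
  have hsum : Summable fun y : (Finset ℕ × (ℕ →₀ ℕ)) × (Finset ℕ × (ℕ →₀ ℕ)) =>
      (p.term F y.1 * p.term G y.2).coeff I := by
    simp only [hexp]
    exact summable_sum fun I' hI' => (hs I' hI').const_smul _
  have h1 : (p.eval F * p.eval G).coeff I =
      ∑' y : (Finset ℕ × (ℕ →₀ ℕ)) × (Finset ℕ × (ℕ →₀ ℕ)),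
        (p.term F y.1 * p.term G y.2).coeff I := by
    simp only [hexp]
    rw [Summable.tsum_finsetSum fun I' hI' => (hs I' hI').const_smul _, coeff_mul]
    refine Finset.sum_congr rfl fun I' hI' => ?_
    rw [(hs I' hI').tsum_const_smul, par_complex, p.coeff_eval, p.coeff_eval,
      tsum_mul_tsum_of_summable_norm (f := fun x => (p.term F x).coeff I')
      (g := fun x => (p.term G x).coeff (I \ I')) (summable_norm_term hF I')
      (summable_norm_term hG (I \ I'))]
  rw [h1, p.coeff_eval]
  -- Absolute summability allows the pairs of terms to be grouped by the monomial they produce; in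
  -- each group only the finitely many pairs with disjoint odd parts survive.
  have h2 := hsum.hasSum.tsum_fiberwise
    (fun y : (Finset ℕ × (ℕ →₀ ℕ)) × (Finset ℕ × (ℕ →₀ ℕ)) => (y.1.1 ∪ y.2.1, y.1.2 + y.2.2))
  rw [← h2.tsum_eq]
  congr 1
  ext x
  rw [p.term_mul, coeff_sum, tsum_subtype ((fun y : (Finset ℕ × (ℕ →₀ ℕ)) × (Finset ℕ × (ℕ →₀ ℕ)) =>
    (y.1.1 ∪ y.2.1, y.1.2 + y.2.2)) ⁻¹' {x}) fun y => (p.term F y.1 * p.term G y.2).coeff I]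
  simp only [coeff_sum]
  rw [← Finset.sum_product' (f := fun J (y : (ℕ →₀ ℕ) × (ℕ →₀ ℕ)) =>
    (p.term F (J, y.1) * p.term G (x.1 \ J, y.2)).coeff I)]
  symm
  rw [tsum_eq_sum (s := (x.1.powerset ×ˢ Finset.HasAntidiagonal.antidiagonal x.2).image
    fun z => ((z.1, z.2.1), (x.1 \ z.1, z.2.2))), Finset.sum_image]
  · refine Finset.sum_congr rfl fun z hz => ?_
    simp only [Finset.mem_product, Finset.mem_powerset,
      Finset.HasAntidiagonal.mem_antidiagonal] at hz
    rw [Set.indicator_of_mem]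
    simp only [Set.mem_preimage, Set.mem_singleton_iff, Finset.union_sdiff_of_subset hz.1, hz.2]
  · rintro ⟨J, y⟩ _ ⟨J', y'⟩ _ h
    simp only [Prod.mk.injEq] at h
    exact Prod.ext h.1.1 (Prod.ext h.1.2 h.2.2)
  · rintro ⟨⟨J, m⟩, ⟨L, n⟩⟩ hy
    by_cases hx : (J ∪ L, m + n) = x
    · subst hx
      by_cases hd : Disjoint J L
      · refine absurd (Finset.mem_image.2 ⟨(J, (m, n)), ?_, ?_⟩) hy
        · simp only [Finset.mem_product, Finset.mem_powerset,
            Finset.HasAntidiagonal.mem_antidiagonal]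
          exact ⟨Finset.subset_union_left, trivial⟩
        · simp [Finset.union_sdiff_cancel_left hd]
      · rw [Set.indicator_of_mem (by simp), p.term_mul_term_of_not_disjoint F G hd, coeff_zero]
    · rw [Set.indicator_of_notMem]
      simpa using hx

theorem term_btMonomial (p : SuperPoint ι) (J : Finset ℕ) (m : ℕ →₀ ℕ) (a : Lam ι)
    (x : Finset ℕ × (ℕ →₀ ℕ)) : p.term (btMonomial J m a) x =
      if x = (J, m) then a * p.evenMonomial m * p.oddMonomial J else 0 := by
  classical
  obtain ⟨K, n⟩ := x
  unfold SuperPoint.term btMonomial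
  rw [coeff_monomial]
  by_cases hK : K = J
  · subst hK
    by_cases hn : n = m
    · subst hn
      simp
    · simp [MvPowerSeries.coeff_monomial, hn]
  · simp [hK]

theorem eval_btMonomial (p : SuperPoint ι) (J : Finset ℕ) (m : ℕ →₀ ℕ) (a : Lam ι) :
    p.eval (btMonomial J m a) = a * p.evenMonomial m * p.oddMonomial J := by
  ext I
  rw [p.coeff_eval, tsum_eq_single (J, m)]
  · rw [term_btMonomial, if_pos rfl]
  · intro x hx
    rw [term_btMonomial, if_neg hx, coeff_zero]

end Evaluation

/-! ### The identity theorem -/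

section Identity

/-- Summing over `k` first gives the exponential of d(x) ‖ζ‖, which is at most `ρ ^ d x`. This
justifies exchanging the two sums. -/
theorem summable_exp_term {X : Type*} {a : X → ℂ} {d : X → ℕ} {ρ : ℝ}
    (hs : Summable fun x => ρ ^ d x * ‖a x‖) {ζ : ℂ} (hζ : Real.exp ‖ζ‖ ≤ ρ) :
    Summable (Function.uncurry fun (x : X) (k : ℕ) =>
      (ζ ^ k / (k.factorial : ℂ)) * ((d x : ℂ) ^ k * a x)) := by
  rw [Function.uncurry_def]
  refine Summable.of_norm ?_
  have hn : ∀ y : X × ℕ, ‖(ζ ^ y.2 / (y.2.factorial : ℂ)) * ((d y.1 : ℂ) ^ y.2 * a y.1)‖ =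
      (d y.1 * ‖ζ‖) ^ y.2 / (y.2.factorial : ℝ) * ‖a y.1‖ := by
    intro y
    simp only [norm_mul, norm_div, norm_pow, Complex.norm_natCast]
    ring
  simp only [hn]
  have hsum : ∀ x, HasSum (fun k : ℕ => (d x * ‖ζ‖) ^ k / (k.factorial : ℝ) * ‖a x‖)
      (Real.exp ‖ζ‖ ^ d x * ‖a x‖) := by
    intro x
    have h := NormedSpace.expSeries_div_hasSum_exp (d x * ‖ζ‖)
    rw [← Real.exp_eq_exp_ℝ, Real.exp_nat_mul] at h
    exact h.mul_right ‖a x‖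
  rw [summable_prod_of_nonneg fun y => by positivity]
  refine ⟨fun x => (hsum x).summable, ?_⟩
  refine hs.of_nonneg_of_le (fun x => tsum_nonneg fun k => by positivity) fun x => ?_
  rw [(hsum x).tsum_eq]
  exact mul_le_mul_of_nonneg_right (pow_le_pow_left₀ (Real.exp_pos _).le hζ _) (norm_nonneg _)

/-- The series g(s) = Σ s^{d(x)} a(x) is holomorphic for |s| < ρ, and the hypotheses say that all (s
d/ds)^k g vanish at s = 1. With s = e^ζ these are the Taylor coefficients in ζ, so g vanishes near
1, hence on the disc. At s = 0 only the term of degree 0 is left. -/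
theorem eq_zero_of_tsum_pow_mul_eq_zero {X : Type*} {a : X → ℂ} {d : X → ℕ} {ρ : ℝ} (hρ : 1 < ρ)
    (hs : Summable fun x => ρ ^ d x * ‖a x‖) (h : ∀ k : ℕ, ∑' x, (d x : ℂ) ^ k * a x = 0)
    {x₀ : X} (hx₀ : ∀ x, d x = 0 ↔ x = x₀) : a x₀ = 0 := by
  have hρ0 : 0 < ρ := by linarith
  set g : ℂ → ℂ := fun s => ∑' x, s ^ d x * a x with hg
  have hdiff : DifferentiableOn ℂ g (Metric.ball 0 ρ) := by
    refine Complex.differentiableOn_tsum_of_summable_norm hs (fun x => ?_) Metric.isOpen_ball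
      fun x s hs => ?_
    · fun_prop
    · rw [norm_mul, norm_pow]
      rw [mem_ball_zero_iff] at hs
      exact mul_le_mul_of_nonneg_right (pow_le_pow_left₀ (norm_nonneg _) hs.le _) (norm_nonneg _)
  have hexp : ∀ ζ : ℂ, Real.exp ‖ζ‖ ≤ ρ → g (Complex.exp ζ) = 0 := by
    intro ζ hζ
    have hterm : ∀ x, Complex.exp ζ ^ d x * a x =
        ∑' k : ℕ, (ζ ^ k / (k.factorial : ℂ)) * ((d x : ℂ) ^ k * a x) := by
      intro x
      have h1 := (NormedSpace.expSeries_div_hasSum_exp ((d x : ℂ) * ζ)).mul_right (a x)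
      rw [← Complex.exp_eq_exp_ℂ, Complex.exp_nat_mul] at h1
      rw [← h1.tsum_eq]
      refine tsum_congr fun k => ?_
      rw [mul_pow]
      ring
    have hsum := summable_exp_term hs hζ
    simp only [hg, hterm]
    rw [← hsum.tsum_comm]
    simp only [tsum_mul_left, h, mul_zero, tsum_zero]
  have hlog : ∀ᶠ s in nhds (1 : ℂ), g s = 0 := by
    have hcont : Filter.Tendsto (fun s : ℂ => Real.exp ‖Complex.log s‖) (nhds 1)
        (nhds (Real.exp ‖Complex.log 1‖)) := by
      have : ContinuousAt Complex.log 1 := continuousAt_clog (by simp)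
      exact (Real.continuous_exp.tendsto _).comp this.norm
    rw [Complex.log_one, norm_zero, Real.exp_zero] at hcont
    filter_upwards [hcont.eventually_le_const hρ, isOpen_ne.mem_nhds one_ne_zero] with s h1 h2
    rw [← Complex.exp_log h2]
    exact hexp _ h1
  have han : AnalyticOnNhd ℂ g (Metric.ball 0 ρ) := hdiff.analyticOnNhd Metric.isOpen_ball
  have hzero := han.eqOn_zero_of_preconnected_of_eventuallyEq_zero
    (convex_ball (0 : ℂ) ρ).isPreconnected (z₀ := 1) (by simpa using hρ) hlog
    (Metric.mem_ball_self hρ0)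
  simp only [hg, Pi.zero_apply] at hzero
  rw [tsum_eq_single x₀] at hzero
  · simpa [(hx₀ x₀).2 rfl] using hzero
  · intro x hx
    rw [zero_pow fun h => hx ((hx₀ x).1 h), zero_mul]

variable {ι : Type*} [LinearOrder ι] {p : SuperPoint ι}

/-- The Euler operator in the variables that do not vanish at `p`. -/
def SuperPoint.euler (p : SuperPoint ι) (F : BT ι) : BT ι :=
  ∑ i ∈ p.even.support, btMonomial ∅ (Finsupp.single i 1) 1 * evenDeriv i F +
    ∑ j ∈ p.odd.support, btMonomial {j} 0 1 * oddDeriv j F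

theorem coeff_evenVar_mul (i : ℕ) (F : BT ι) (J : Finset ℕ) (m : ℕ →₀ ℕ) :
    MvPowerSeries.coeff m ((btMonomial ∅ (Finsupp.single i 1) 1 * evenDeriv i F).coeff J) =
      m i • MvPowerSeries.coeff m (F.coeff J) := by
  classical
  rw [btMonomial, monomial_empty_mul, coeff_smul, smul_eq_mul, coeff_evenDeriv,
    MvPowerSeries.coeff_monomial_mul, one_mul]
  split_ifs with h
  · rw [coeff_pderiv, tsub_add_cancel_of_le h, Finsupp.tsub_apply, Finsupp.single_eq_same,
      Nat.sub_add_cancel]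
    simpa [Finsupp.single_le_iff] using h
  · have : m i = 0 := by
      rw [Finsupp.single_le_iff] at h
      omega
    rw [this, zero_smul]

theorem coeff_oddVar_mul (j : ℕ) (F : BT ι) (J : Finset ℕ) :
    (btMonomial {j} 0 1 * oddDeriv j F).coeff J = if j ∈ J then F.coeff J else 0 := by
  rw [btMonomial, MvPowerSeries.monomial_zero_one, coeff_mul]
  split_ifs with h
  · rw [Finset.sum_eq_single {j}]
    · rw [coeff_monomial, if_pos rfl, one_mul, coeff_oddDeriv, if_neg (by simp),
        Finset.card_singleton, par_one, map_zsmul, Super.parity_parity, smul_smul, ← mul_pow,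
        ← Finset.erase_eq, Finset.insert_erase h]
      simp
    · intro K _ hK
      rw [coeff_monomial, if_neg hK, zero_mul, smul_zero]
    · intro hj
      simp [h] at hj
  · refine Finset.sum_eq_zero fun K hK => ?_
    rw [coeff_monomial, if_neg, zero_mul, smul_zero]
    rintro rfl
    simp [h] at hK

/-- The Euler operator of `p` omits the variables that vanish at `p`, which keeps it a finite sum. A
monomial containing such a variable has value 0, so it still multiplies the value of each term by
its full degree. -/
theorem SuperPoint.term_euler (p : SuperPoint ι) (F : BT ι) (x : Finset ℕ × (ℕ →₀ ℕ)) :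
    p.term (p.euler F) x = totalDegree x • p.term F x := by
  obtain ⟨J, m⟩ := x
  by_cases hJ : J ⊆ p.odd.support
  · by_cases hm : m.support ⊆ p.even.support
    · have : MvPowerSeries.coeff m ((p.euler F).coeff J) =
          totalDegree (J, m) • MvPowerSeries.coeff m (F.coeff J) := by
        unfold SuperPoint.euler totalDegree
        rw [coeff_add, coeff_sum, coeff_sum, map_add, map_sum, map_sum]
        simp only [coeff_evenVar_mul, coeff_oddVar_mul]
        rw [add_smul, add_comm, ← Finset.sum_smul]
        congr 1
        · simp only [apply_ite (MvPowerSeries.coeff m), map_zero]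
          rw [← Finset.sum_filter, Finset.sum_const, Finset.filter_mem_eq_inter,
            Finset.inter_eq_right.2 hJ]
        · congr 1
          exact (Finset.sum_subset hm fun i _ hi => by simpa using hi).symm
      unfold SuperPoint.term
      simp only
      rw [this, smul_mul_assoc, smul_mul_assoc]
    · have h0 : p.evenMonomial m = 0 := by
        obtain ⟨i, hi, hi'⟩ := Finset.not_subset.1 hm
        refine List.prod_eq_zero (List.mem_map.2 ⟨i, (Finset.mem_sort _).2 hi, ?_⟩)
        rw [Finsupp.notMem_support_iff.1 hi', zero_pow (Finsupp.mem_support_iff.1 hi)]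
      simp [SuperPoint.term, h0]
  · simp [SuperPoint.term, p.oddMonomial_eq_zero hJ]

/-- Values of the iterated Euler operator are the degree moments of the terms at `p`. The argument
is applied to each component separately, and the constant term is the only one of degree 0. -/
theorem coeff_zero_eq_zero_of_eval_euler {F : BT ι} (hF : F ∈ convSubring p)
    (h : ∀ k : ℕ, p.eval (p.euler^[k] F) = 0) : MvPowerSeries.coeff 0 (F.coeff ∅) = 0 := by
  have hterm : ∀ (k : ℕ) x, p.term (p.euler^[k] F) x = totalDegree x ^ k • p.term F x := by
    intro k x
    induction k with
    | zero => simp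
    | succ k ih => rw [Function.iterate_succ_apply', p.term_euler, ih, smul_smul, pow_succ']
  ext I
  obtain ⟨ρ, hρ, hs⟩ := summable_term_near hF I
  have h1 := eq_zero_of_tsum_pow_mul_eq_zero hρ hs (x₀ := (∅, 0)) (fun k => ?_) ?_
  · simpa [SuperPoint.term, p.evenMonomial_zero, p.oddMonomial_empty] using h1
  · have h2 := congrArg (fun a => Grassmann.coeff a I) (h k)
    simp only [p.coeff_eval, hterm, coeff_zero] at h2
    rw [← h2]
    refine tsum_congr fun x => ?_
    rw [← natCast_zsmul, coeff_zsmul, zsmul_eq_mul]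
    push_cast
    rfl
  · rintro ⟨J, m⟩
    simp [totalDegree, Finsupp.degree_eq_zero_iff]

/-- Up to signs, parity and nonzero integer factors, every coefficient of `F` is the constant term
of an iterated derivative, which again lies in `S`. -/
theorem eq_zero_of_forall_coeff_zero {S : Set (BT ι)}
    (heven : ∀ F ∈ S, ∀ i, evenDeriv i F ∈ S) (hodd : ∀ F ∈ S, ∀ j, oddDeriv j F ∈ S)
    (h0 : ∀ F ∈ S, MvPowerSeries.coeff 0 (F.coeff ∅) = 0) {F : BT ι} (hF : F ∈ S) : F = 0 := by
  have key : ∀ (n : ℕ) (F : BT ι), F ∈ S → ∀ (J : Finset ℕ) (m : ℕ →₀ ℕ),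
      totalDegree (J, m) = n → MvPowerSeries.coeff m (F.coeff J) = 0 := by
    intro n
    induction n with
    | zero =>
      intro F hF J m hn
      simp only [totalDegree, Nat.add_eq_zero_iff, Finset.card_eq_zero,
        Finsupp.degree_eq_zero_iff] at hn
      rw [hn.1, hn.2]
      exact h0 F hF
    | succ n ih =>
      intro F hF J m hn
      by_cases hJ : J = ∅
      · have hm : m ≠ 0 := by
          rintro rfl
          simp [totalDegree, hJ] at hn
        obtain ⟨i, hi⟩ := Finsupp.ne_iff.1 hm
        have hle : Finsupp.single i 1 ≤ m := by
          rw [Finsupp.single_le_iff]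
          exact Nat.one_le_iff_ne_zero.2 hi
        have h1 := ih (evenDeriv i F) (heven F hF i) J (m - Finsupp.single i 1) (by
          have h2 : (m - Finsupp.single i 1).degree + 1 = m.degree := by
            conv_rhs => rw [← tsub_add_cancel_of_le hle, map_add, Finsupp.degree_single]
          simp only [totalDegree] at hn ⊢
          omega)
        rw [coeff_evenDeriv, coeff_pderiv, tsub_add_cancel_of_le hle] at h1
        have h3 := congrArg (fun a => ((((m - Finsupp.single i 1 : ℕ →₀ ℕ) i + 1 : ℕ) : ℚ)⁻¹) • a) h1
        simp only [smul_zero] at h3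
        rw [← Nat.cast_smul_eq_nsmul ℚ, smul_smul, inv_mul_cancel₀ (by positivity), one_smul] at h3
        exact h3
      · obtain ⟨j, hj⟩ := Finset.nonempty_iff_ne_empty.2 hJ
        have h1 := ih (oddDeriv j F) (hodd F hF j) (J.erase j) m (by
          have := Finset.card_erase_add_one hj
          simp only [totalDegree] at hn ⊢
          omega)
        rw [coeff_oddDeriv, if_neg (Finset.notMem_erase j J), Finset.insert_erase hj, map_zsmul,
          coeff_parity_mvPowerSeries] at h1
        have h2 := congrArg (fun a => Super.parity ((-1 : ℤ) ^ inv {j} (J.erase j) • a)) h1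
        simp only [smul_zero, map_zero, smul_smul, ← mul_pow] at h2
        simpa [Super.parity_parity] using h2
  ext J : 2
  ext m : 1
  exact key _ F hF J m rfl

/-- A set of convergent series that is stable under differentiation and under multiplication by
convergent series vanishes if its elements vanish at one point. -/
theorem eq_zero_of_eval_eq_zero {S : AddSubgroup (BT ι)} (hS : ∀ F ∈ S, F ∈ convSubring p)
    (hmul : ∀ c ∈ convSubring p, ∀ F ∈ S, c * F ∈ S)
    (heven : ∀ F ∈ S, ∀ i, evenDeriv i F ∈ S) (hodd : ∀ F ∈ S, ∀ j, oddDeriv j F ∈ S)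
    (heval : ∀ F ∈ S, p.eval F = 0) {F : BT ι} (hF : F ∈ S) : F = 0 := by
  refine eq_zero_of_forall_coeff_zero (S := (S : Set (BT ι))) heven hodd (fun F hF => ?_) hF
  refine coeff_zero_eq_zero_of_eval_euler (hS F hF) fun k => heval _ ?_
  induction k with
  | zero => exact hF
  | succ k ih =>
    rw [Function.iterate_succ_apply']
    exact add_mem
      (sum_mem fun i _ => hmul _ (btMonomial_mem_convSubring _ _ _) _ (heven _ ih i))
      (sum_mem fun j _ => hmul _ (btMonomial_mem_convSubring _ _ _) _ (hodd _ ih j))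

end Identity

/-! ### Elements with coefficients in a subgroup -/

section Coefficients

variable {A : Type*} [Ring A] [Super A]

/-- The elements of `V(A)` all of whose coefficients lie in `S`. -/
def coeffsIn (S : AddSubgroup A) : AddSubgroup (V A) where
  carrier := {v | ∀ k s, (v.coeff k).coeff s ∈ S}
  zero_mem' k s := by simp
  add_mem' {u v} hu hv k s := by
    rw [HahnSeries.coeff_add, coeff_add]
    exact add_mem (hu k s) (hv k s)
  neg_mem' {v} hv k s := by
    rw [HahnSeries.coeff_neg, coeff_neg]
    exact neg_mem (hv k s)

theorem par_mem {S : AddSubgroup A} (hS : ∀ a ∈ S, Super.parity a ∈ S) (n : ℕ) {a : A}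
    (ha : a ∈ S) : par n a ∈ S := by
  by_cases hn : Even n
  · rwa [par_of_even hn]
  · rw [par_of_odd hn]
    exact hS a ha

theorem coeffsIn_mul {S T U : AddSubgroup A} (h : ∀ s ∈ S, ∀ t ∈ T, s * t ∈ U)
    (hT : ∀ a ∈ T, Super.parity a ∈ T) {u v : V A} (hu : u ∈ coeffsIn S) (hv : v ∈ coeffsIn T) :
    u * v ∈ coeffsIn U := by
  intro k s
  rw [HahnSeries.coeff_mul, coeff_sum]
  refine sum_mem fun x _ => ?_
  rw [coeff_mul]
  exact sum_mem fun J _ => zsmul_mem (h _ (hu _ _) _ (par_mem hT _ (hv _ _))) _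

theorem coeffsIn_smul {S T U : AddSubgroup A} (h : ∀ s ∈ S, ∀ t ∈ T, s * t ∈ U) {c : A}
    {v : V A} (hc : c ∈ S) (hv : v ∈ coeffsIn T) : c • v ∈ coeffsIn U := by
  intro k s
  rw [HahnSeries.coeff_smul, coeff_smul, smul_eq_mul]
  exact h _ hc _ (hv _ _)

theorem coeffsIn_mapVAdd {S T : AddSubgroup A} {δ : A →+ A} (h : ∀ s ∈ S, δ s ∈ T) {v : V A}
    (hv : v ∈ coeffsIn S) : mapVAdd δ v ∈ coeffsIn T := by
  intro k s
  rw [coeff_mapVAdd, coeff_mapCoeffAdd]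
  exact h _ (hv _ _)

theorem coeffsIn_parity {S : AddSubgroup A} (hS : ∀ a ∈ S, Super.parity a ∈ S) {v : V A}
    (hv : v ∈ coeffsIn S) : Super.parity v ∈ coeffsIn S := by
  intro k s
  rw [coeff_parityV, coeff_parity]
  exact zsmul_mem (hS _ (hv _ _)) _

theorem one_mem_coeffsIn (C : Subring A) : (1 : V A) ∈ coeffsIn C.toAddSubgroup := by
  intro k s
  rw [HahnSeries.coeff_one]
  split_ifs
  · change (if s = ∅ then (1 : A) else 0) ∈ C
    split_ifs
    · exact one_mem C
    · exact zero_mem C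
  · exact zero_mem C

/-! ### Coefficients of nonnegative powers of `z` -/

/-- The coefficient of `θ^p z^k` in `v`, where `l = 2 k + p` and `p = 0, 1`. -/
def pc (v : V A) (l : ℕ) : A :=
  (v.coeff (-((l / 2 : ℕ) : ℤ))).coeff (if l % 2 = 0 then ∅ else {()})

theorem pc_add (u v : V A) (l : ℕ) : pc (u + v) l = pc u l + pc v l := by
  rw [pc, HahnSeries.coeff_add, coeff_add, pc, pc]

theorem pc_sub (u v : V A) (l : ℕ) : pc (u - v) l = pc u l - pc v l := by
  rw [pc, HahnSeries.coeff_sub, coeff_sub, pc, pc]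

theorem pc_smul (c : A) (v : V A) (l : ℕ) : pc (c • v) l = c * pc v l := by
  rw [pc, HahnSeries.coeff_smul, coeff_smul, smul_eq_mul, pc]

theorem pc_zsmul (n : ℤ) (v : V A) (l : ℕ) : pc (n • v) l = n • pc v l := by
  rw [pc, coeff_zsmulV, coeff_zsmul, pc]

theorem pc_sum {κ : Type*} (s : Finset κ) (f : κ → V A) (l : ℕ) :
    pc (∑ i ∈ s, f i) l = ∑ i ∈ s, pc (f i) l := by
  rw [pc, coeff_sumV, coeff_sum]
  rfl

theorem pc_parity (v : V A) (l : ℕ) : pc (Super.parity v) l = (-1 : ℤ) ^ l • Super.parity (pc v l) := by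
  rw [pc, coeff_parityV, coeff_parity, pc]
  congr 1
  refine neg_one_pow_eq_of_mod ?_
  split_ifs with h <;> simp <;> omega

theorem isNeg_iff_pc {v : V A} : IsNeg v ↔ ∀ l, pc v l = 0 := by
  constructor
  · intro h l
    rw [pc, h _ (Int.natCast_nonneg _), coeff_zero]
  · intro h k hk
    ext s
    lift k to ℕ using hk
    rw [coeff_zero]
    by_cases hs : s = ∅
    · have h1 := h (2 * k)
      rw [pc, Nat.mul_div_cancel_left k two_pos, if_pos (by omega)] at h1
      rw [hs, h1]
    · have hs' : s = {()} := by
        ext x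
        obtain ⟨y, hy⟩ := Finset.nonempty_iff_ne_empty.2 hs
        simpa using hy
      have h1 := h (2 * k + 1)
      rw [pc, show (2 * k + 1) / 2 = k by omega, if_neg (by omega)] at h1
      rw [hs', h1]

theorem IsNeg.mapVAdd {v : V A} (h : IsNeg v) (δ : A →+ A) : IsNeg (mapVAdd δ v) := by
  intro k hk
  rw [coeff_mapVAdd, h k hk, map_zero]

theorem finite_pc (v : V A) : (Function.support (pc v)).Finite := by
  refine (Set.finite_Iio (2 * (1 - v.order).toNat + 2)).subset fun l hl => ?_
  by_contra hlt
  refine hl ?_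
  rw [pc, HahnSeries.coeff_eq_zero_of_lt_order, coeff_zero]
  simp only [Set.mem_Iio, not_lt] at hlt
  omega

/-- The coefficients of the nonnegative powers of `z`. -/
def posPart (v : V A) : ℕ →₀ A := Finsupp.ofSupportFinite (pc v) (finite_pc v)

@[simp] theorem posPart_apply (v : V A) (l : ℕ) : posPart v l = pc v l := rfl

/-! ### Combinations of a sequence of elements -/

/-- The finite linear combinations of the `g l` with coefficients in `C`. -/
def comb (C : Subring A) (g : ℕ → V A) : AddSubgroup (V A) :=
  AddSubgroup.closure {v | ∃ c ∈ C, ∃ l, v = c • g l}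

/-- The linear combination of the `g l` with coefficients `c`. -/
def lincomb (c : ℕ →₀ A) (g : ℕ → V A) : V A := c.sum fun l a => a • g l

variable {C : Subring A} {g H : ℕ → V A}

theorem smul_mem_comb {c : A} (hc : c ∈ C) (l : ℕ) : c • g l ∈ comb C g :=
  AddSubgroup.subset_closure ⟨c, hc, l, rfl⟩

theorem mem_comb (l : ℕ) : g l ∈ comb C g := by
  simpa using smul_mem_comb (g := g) (one_mem C) l

theorem comb_induction {P : V A → Prop} (hsmul : ∀ c ∈ C, ∀ l, P (c • g l))
    (hadd : ∀ u v, P u → P v → P (u + v)) {v : V A} (hv : v ∈ comb C g) : P v := by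
  refine (AddSubgroup.closure_induction (p := fun v _ => P v ∧ P (-v)) ?_ ?_ ?_ ?_ hv).1
  · rintro v ⟨c, hc, l, rfl⟩
    exact ⟨hsmul c hc l, by rw [← neg_smul]; exact hsmul (-c) (neg_mem hc) l⟩
  · have := hsmul 0 (zero_mem C) 0
    rw [zero_smul] at this
    exact ⟨this, by rwa [neg_zero]⟩
  · intro u v _ _ hu hv
    exact ⟨hadd _ _ hu.1 hv.1, by rw [neg_add]; exact hadd _ _ hu.2 hv.2⟩
  · exact fun v _ h => ⟨h.2, by rw [neg_neg]; exact h.1⟩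

theorem smul_mem_comb_of_mem {c : A} (hc : c ∈ C) {v : V A} (hv : v ∈ comb C g) :
    c • v ∈ comb C g := by
  refine comb_induction (P := fun v => c • v ∈ comb C g) (fun d hd l => ?_) (fun u v hu hv => ?_) hv
  · rw [smul_smul]
    exact smul_mem_comb (mul_mem hc hd) l
  · rw [smul_add]
    exact add_mem hu hv

theorem comb_le (h : ∀ l, g l ∈ comb C H) : comb C g ≤ comb C H := fun _ hv =>
  comb_induction (fun _ hc l => smul_mem_comb_of_mem hc (h l)) (fun _ _ => add_mem) hv

theorem lincomb_mem_comb {c : ℕ →₀ A} (hc : ∀ l, c l ∈ C) : lincomb c g ∈ comb C g :=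
  sum_mem fun l _ => smul_mem_comb (hc l) l

theorem exists_lincomb {v : V A} (hv : v ∈ comb C g) :
    ∃ c : ℕ →₀ A, (∀ l, c l ∈ C) ∧ v = lincomb c g := by
  classical
  refine comb_induction (P := fun v => ∃ c : ℕ →₀ A, (∀ l, c l ∈ C) ∧ v = lincomb c g) ?_ ?_ hv
  · intro c hc l
    refine ⟨Finsupp.single l c, fun m => ?_, ?_⟩
    · rw [Finsupp.single_apply]
      split_ifs
      · exact hc
      · exact zero_mem C
    · rw [lincomb, Finsupp.sum_single_index (h := fun l a => a • g l) (zero_smul A _)]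
  · rintro u v ⟨c, hc, rfl⟩ ⟨d, hd, rfl⟩
    refine ⟨c + d, fun l => add_mem (hc l) (hd l), ?_⟩
    rw [lincomb, lincomb, lincomb, Finsupp.sum_add_index' (h := fun l a => a • g l)
      (fun _ => zero_smul A _) fun _ _ _ => add_smul _ _ _]

theorem comb_le_top : comb C g ≤ comb ⊤ g := fun _ hv =>
  comb_induction (fun _ _ l => smul_mem_comb (Subring.mem_top _) l) (fun _ _ => add_mem) hv

theorem span_le_comb_top {v : V A} (hv : v ∈ Submodule.span A (Set.range g)) :
    v ∈ comb ⊤ g := by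
  refine Submodule.span_induction ?_ (zero_mem _) (fun _ _ _ _ => add_mem)
    (fun c _ _ h => smul_mem_comb_of_mem (Subring.mem_top c) h) hv
  rintro _ ⟨l, rfl⟩
  exact mem_comb l

theorem comb_le_coeffsIn (h : ∀ l, g l ∈ coeffsIn C.toAddSubgroup) :
    comb C g ≤ coeffsIn C.toAddSubgroup := fun _ hv =>
  comb_induction (fun _ hc l => coeffsIn_smul (S := C.toAddSubgroup)
    (fun _ hs _ ht => C.mul_mem hs ht) hc (h l))
    (fun _ _ => add_mem) hv

theorem pc_mem {S : AddSubgroup A} {v : V A} (hv : v ∈ coeffsIn S) (l : ℕ) : pc v l ∈ S := hv _ _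

/-! ### Unitriangular families -/

/-- `H l = θ^p z^k + O(z⁻¹)` for `l = 2 k + p`. -/
def IsReduced (H : ℕ → V A) : Prop := ∀ l m, pc (H l) m = if m = l then 1 else 0

theorem IsReduced.pc_lincomb (h : IsReduced H) (c : ℕ →₀ A) (m : ℕ) : pc (lincomb c H) m = c m := by
  classical
  rw [lincomb, Finsupp.sum, pc_sum]
  simp only [pc_smul, h _ m, mul_ite, mul_one, mul_zero]
  rw [Finset.sum_ite_eq]
  split_ifs with hm
  · rfl
  · exact (Finsupp.notMem_support_iff.1 hm).symm

/-- The coefficient of `H l` in a combination can be read off at θ^p z^k, so the positive part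
determines the element. -/
theorem IsReduced.eq_lincomb (h : IsReduced H) {v : V A} (hv : v ∈ comb C H) :
    v = lincomb (posPart v) H := by
  obtain ⟨c, _, rfl⟩ := exists_lincomb hv
  congr 1
  ext l
  rw [posPart_apply, h.pc_lincomb]

theorem IsReduced.eq_zero (h : IsReduced H) {v : V A} (hv : v ∈ comb C H) (h0 : ∀ l, pc v l = 0) :
    v = 0 := by
  rw [h.eq_lincomb hv]
  have : posPart v = 0 := by
    ext l
    exact h0 l
  rw [this, lincomb, Finsupp.sum_zero_index]

/-- The projection of `V(A)` to the series in negative powers of `z` along the span of `H`. -/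
def negProj (H : ℕ → V A) (v : V A) : V A := v - lincomb (posPart v) H

theorem IsReduced.isNeg_negProj (h : IsReduced H) (v : V A) : IsNeg (negProj H v) := by
  rw [isNeg_iff_pc]
  intro l
  rw [negProj, pc_sub, h.pc_lincomb, posPart_apply, sub_self]

/-- `g l = θ^p z^k + ⋯` with terms of index smaller than `l = 2 k + p`. -/
structure IsUnitriangular (g : ℕ → V A) : Prop where
  pc_self : ∀ l, pc (g l) l = 1
  pc_of_lt : ∀ l m, l < m → pc (g l) m = 0

theorem IsUnitriangular.eq_zero (hg : IsUnitriangular g) {v : V A} (hv : v ∈ comb C g)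
    (h0 : ∀ l, pc v l = 0) : v = 0 := by
  obtain ⟨c, _, rfl⟩ := exists_lincomb hv
  by_cases hc : c = 0
  · rw [hc, lincomb, Finsupp.sum_zero_index]
  · exfalso
    have hne : c.support.Nonempty := Finsupp.support_nonempty_iff.2 hc
    have h1 := h0 (c.support.max' hne)
    rw [lincomb, Finsupp.sum, pc_sum, Finset.sum_eq_single (c.support.max' hne)] at h1
    · rw [pc_smul, hg.pc_self, mul_one] at h1
      exact Finsupp.mem_support_iff.1 (c.support.max'_mem hne) h1
    · intro l hl hne'
      rw [pc_smul, hg.pc_of_lt, mul_zero]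
      exact lt_of_le_of_ne (c.support.le_max' l hl) hne'
    · intro h
      exact absurd (c.support.max'_mem hne) h

/-- Gaussian elimination: the diagonal entries are 1, so no division occurs and the coefficients
stay in `C`. -/
theorem IsUnitriangular.exists_reduced (hg : IsUnitriangular g)
    (hgC : ∀ l, g l ∈ coeffsIn C.toAddSubgroup) (l : ℕ) :
    ∃ w ∈ comb C g, ∀ m, pc w m = if m = l then 1 else 0 := by
  induction l using Nat.strong_induction_on with
  | _ l ih =>
    choose! w hw hpc using ih
    refine ⟨g l - ∑ m ∈ Finset.range l, pc (g l) m • w m, sub_mem (mem_comb l)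
      (sum_mem fun m hm => smul_mem_comb_of_mem (pc_mem (hgC l) m) (hw m (Finset.mem_range.1 hm))),
      fun n => ?_⟩
    rw [pc_sub, pc_sum]
    have h1 : ∑ m ∈ Finset.range l, pc (pc (g l) m • w m) n =
        ∑ m ∈ Finset.range l, if n = m then pc (g l) m else 0 := by
      refine Finset.sum_congr rfl fun m hm => ?_
      rw [pc_smul, hpc m (Finset.mem_range.1 hm)]
      simp
    rw [h1, Finset.sum_ite_eq]
    rcases lt_trichotomy n l with h | rfl | h
    · simp [h, h.ne]
    · simp [hg.pc_self]
    · simp [hg.pc_of_lt l n h, h.ne']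

/-- A reduced element is unique in the span over the whole ring, so it coincides with the one
obtained by elimination inside `C`. In this way convergence of ĥ passes to its super currents. -/
theorem IsUnitriangular.mem_comb_of_reduced (hg : IsUnitriangular g)
    (hgC : ∀ l, g l ∈ coeffsIn C.toAddSubgroup) (hH : IsReduced H) (hHg : ∀ l, H l ∈ comb ⊤ g)
    (l : ℕ) : H l ∈ comb C g := by
  obtain ⟨w, hw, hpc⟩ := hg.exists_reduced hgC l
  have : H l - w = 0 := hg.eq_zero (sub_mem (hHg l) (comb_le_top hw)) fun m => by
    rw [pc_sub, hH, hpc, sub_self]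
  rwa [sub_eq_zero.1 this]

theorem IsUnitriangular.comb_eq (hg : IsUnitriangular g)
    (hgC : ∀ l, g l ∈ coeffsIn C.toAddSubgroup) (hH : IsReduced H) (hHg : ∀ l, H l ∈ comb ⊤ g) :
    comb C H = comb C g := by
  refine le_antisymm (comb_le (hg.mem_comb_of_reduced hgC hH hHg)) (comb_le fun l => ?_)
  have h1 : lincomb (posPart (g l)) H ∈ comb C H := lincomb_mem_comb fun m => pc_mem (hgC l) m
  have h2 : g l - lincomb (posPart (g l)) H = 0 :=
    hg.eq_zero (C := ⊤) (sub_mem (mem_comb l) (comb_le hHg (comb_le_top h1))) fun m => by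
      rw [pc_sub, hH.pc_lincomb, posPart_apply, sub_self]
  rwa [sub_eq_zero.1 h2]

end Coefficients

/-! ### Faà di Bruno polynomials -/

section FaaDiBruno

variable {ι : Type*} [LinearOrder ι]

theorem superDV_eq (v : V (BT ι)) : superDV v = mapVAdd superD v := rfl

theorem timeDerivV_eq (k : ℕ) (v : V (BT ι)) : timeDerivV k v = mapVAdd (timeDeriv k) v := rfl

theorem faaDiBruno_succ (h : V (BT ι)) (n : ℕ) :
    faaDiBruno h (n + 1) = mapVAdd superD (faaDiBruno h n) + h * faaDiBruno h n := rfl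

theorem mapVAdd_superD_superD (v : V (BT ι)) :
    mapVAdd superD (mapVAdd superD v) = mapVAdd (evenDeriv 0) v := by
  ext k s : 4
  exact superD_superD _

/-- In (𝓓 + h)² the square of the odd `h` vanishes and the mixed terms cancel, which leaves ∂_x +
𝓓h. -/
theorem faaDiBruno_add_two {h : V (BT ι)} (hh : IsPar 1 h) (n : ℕ) :
    faaDiBruno h (n + 2) =
      mapVAdd (evenDeriv 0) (faaDiBruno h n) + mapVAdd superD h * faaDiBruno h n := by
  have h0 : h * h = 0 := hh.mul_self_eq_zero
  have h1 : Super.parity h = -h := by simpa [IsPar] using hh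
  rw [faaDiBruno_succ, faaDiBruno_succ, map_add, mapVAdd_superD_superD,
    isSuperDeriv_superD.mapVAdd.leibniz, par_one, h1, mul_add, ← mul_assoc h h, h0]
  simp only [neg_mul, zero_mul, add_zero]
  abel

theorem IsSuperDeriv.isPar {A : Type*} [Ring A] [Super A] {n m : ℕ} {δ : A →+ A}
    (h : IsSuperDeriv n δ) {a : A} (ha : IsPar m a) : IsPar (n + m) (δ a) := by
  unfold IsPar at *
  have h1 := congrArg (fun x => (-1 : ℤ) ^ n • δ x) ha
  simp only [h.parity, smul_smul, ← mul_pow, map_zsmul] at h1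
  rw [pow_add]
  simpa using h1

theorem IsPar.add {A : Type*} [Ring A] [Super A] {n : ℕ} {a c : A} (ha : IsPar n a)
    (hc : IsPar n c) : IsPar n (a + c) := by
  unfold IsPar at *
  rw [map_add, ha, hc, smul_add]

theorem isPar_faaDiBruno {h : V (BT ι)} (hh : IsPar 1 h) (n : ℕ) : IsPar n (faaDiBruno h n) := by
  induction n with
  | zero => exact isPar_one
  | succ n ih =>
    rw [faaDiBruno_succ, add_comm n 1]
    exact (isSuperDeriv_superD.mapVAdd.isPar ih).add (hh.mul ih)

theorem faaDiBruno_mem_coeffsIn {C : Subring (BT ι)} (hpar : ∀ a ∈ C, Super.parity a ∈ C)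
    (hD : ∀ a ∈ C, superD a ∈ C) {h : V (BT ι)} (hh : h ∈ coeffsIn C.toAddSubgroup) (n : ℕ) :
    faaDiBruno h n ∈ coeffsIn C.toAddSubgroup := by
  induction n with
  | zero => exact one_mem_coeffsIn C
  | succ n ih =>
    rw [faaDiBruno_succ]
    exact add_mem (coeffsIn_mapVAdd hD ih)
      (coeffsIn_mul (S := C.toAddSubgroup) (fun _ hs _ ht => C.mul_mem hs ht) hpar hh ih)

theorem coeff_vMonomial {A : Type*} [Ring A] [Super A] (a : A) (p : Fin 2) (k j : ℤ) :
    (vMonomial a p k).coeff j =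
      if j = -k then Grassmann.monomial (if p = 0 then ∅ else {()}) a else 0 := by
  unfold vMonomial
  by_cases hj : j = -k
  · rw [if_pos hj, hj, HahnSeries.coeff_single_same]
  · rw [if_neg hj, HahnSeries.coeff_single_of_ne hj]

theorem IsFaaDiBrunoGenerator.coeff_of_nonpos {h : V (BT ι)} (hh : IsFaaDiBrunoGenerator h)
    {j : ℤ} (hj : j ≤ 0) : h.coeff j = (if j = 0 then Grassmann.monomial {()} 1 else 0) +
      if j = -1 then Grassmann.monomial ∅ phi else 0 := by
  have h1 := hh.asymptotics (-j) (by omega)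
  rw [neg_neg, HahnSeries.coeff_sub, HahnSeries.coeff_add, coeff_vMonomial, coeff_vMonomial,
    sub_eq_zero] at h1
  rw [h1]
  simp

/-- 𝓓 annihilates the constant coefficient of θ and 𝓓φ = 1, so 𝓓h = z + O(z⁻¹). -/
theorem IsFaaDiBrunoGenerator.coeff_superD_of_nonpos {h : V (BT ι)} (hh : IsFaaDiBrunoGenerator h)
    {j : ℤ} (hj : j ≤ 0) : (mapVAdd superD h).coeff j = if j = -1 then 1 else 0 := by
  have hphi : superD (phi : BT ι) = 1 := by
    rw [superD_apply, oddDeriv_phi, evenDeriv_phi]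
    simp
  rw [coeff_mapVAdd, hh.coeff_of_nonpos hj, map_add]
  have h1 : mapCoeffAdd superD (if j = 0 then Grassmann.monomial {()} (1 : BT ι) else 0) = 0 := by
    split_ifs
    · ext s : 2
      rw [coeff_mapCoeffAdd, coeff_monomial]
      split_ifs
      · rw [isSuperDeriv_superD.map_one, coeff_zero]
      · rw [map_zero, coeff_zero]
    · rw [map_zero]
  rw [h1, zero_add]
  split_ifs
  · ext s : 2
    rw [coeff_mapCoeffAdd, coeff_monomial]
    change _ = if s = ∅ then (1 : BT ι) else 0
    split_ifs
    · exact hphi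
    · exact map_zero _
  · rw [map_zero]

/-- Since M has no term in z⁰, the part M − z contributes only at indices above `a`. The two leading
coefficients of v, at `a` and `a + 1`, are thus merely shifted. -/
theorem coeff_mul_eq_shift {R : Type*} [Ring R] {M v : LaurentSeries R} {a : ℤ}
    (hM : ∀ j ≤ 0, M.coeff j = if j = -1 then 1 else 0) (hv : ∀ j < a, v.coeff j = 0) {j : ℤ}
    (hj : j ≤ a) : (M * v).coeff j = v.coeff (j + 1) := by
  set M' := M - HahnSeries.single (-1) 1 with hM'
  have h1 : M = M' + HahnSeries.single (-1) 1 := by rw [hM', sub_add_cancel]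
  have h2 : ∀ j ≤ 0, M'.coeff j = 0 := by
    intro j hj
    rw [hM', HahnSeries.coeff_sub, hM j hj]
    by_cases h : j = -1
    · rw [if_pos h, h, HahnSeries.coeff_single_same, sub_self]
    · rw [if_neg h, HahnSeries.coeff_single_of_ne h, sub_self]
  have h3 : (M' * v).coeff j = 0 := by
    rw [HahnSeries.coeff_mul]
    refine Finset.sum_eq_zero fun x hx => ?_
    rw [Finset.mem_antidiagonal] at hx
    by_cases hx1 : x.1 ≤ 0
    · rw [h2 _ hx1, zero_mul]
    · rw [hv _ (by omega), mul_zero]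
  have h4 : (HahnSeries.single (-1 : ℤ) (1 : R) * v).coeff j = v.coeff (j + 1) := by
    have := HahnSeries.coeff_single_mul_add (r := (1 : R)) (x := v) (a := j + 1) (b := -1)
    rw [one_mul, add_neg_cancel_right] at this
    exact this
  rw [h1, add_mul, HahnSeries.coeff_add, h3, h4, zero_add]

theorem IsFaaDiBrunoGenerator.coeff_add_two {h : V (BT ι)} (hh : IsFaaDiBrunoGenerator h) {n : ℕ}
    {a : ℤ} (ha : ∀ j < a, (faaDiBruno h n).coeff j = 0) {j : ℤ} (hj : j ≤ a) :
    (faaDiBruno h (n + 2)).coeff j = mapCoeffAdd (evenDeriv 0) ((faaDiBruno h n).coeff j) +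
      (faaDiBruno h n).coeff (j + 1) := by
  rw [faaDiBruno_add_two hh.odd.isPar, HahnSeries.coeff_add, coeff_mapVAdd,
    coeff_mul_eq_shift (fun j hj => hh.coeff_superD_of_nonpos hj) ha hj]

theorem mapCoeffAdd_evenDeriv_one :
    mapCoeffAdd (evenDeriv 0) (1 : Grassmann Unit (BT ι)) = 0 := by
  ext s : 2
  rw [coeff_mapCoeffAdd]
  change evenDeriv 0 (if s = ∅ then (1 : BT ι) else 0) = 0
  split_ifs
  · exact (isSuperDeriv_evenDeriv 0).map_one
  · exact map_zero _

theorem mapCoeffAdd_evenDeriv_phi :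
    mapCoeffAdd (evenDeriv 0) (Grassmann.monomial ∅ phi : Grassmann Unit (BT ι)) = 0 := by
  ext s : 2
  rw [coeff_mapCoeffAdd, coeff_monomial, coeff_zero]
  split_ifs
  · exact evenDeriv_phi 0
  · exact map_zero _

/-- The subleading coefficient is carried along: in the next step it is ∂_x of the leading one plus
the previous subleading one, hence again 0. -/
theorem IsFaaDiBrunoGenerator.coeff_even {h : V (BT ι)} (hh : IsFaaDiBrunoGenerator h) (k : ℕ) :
    (∀ j < -(k : ℤ), (faaDiBruno h (2 * k)).coeff j = 0) ∧
      (faaDiBruno h (2 * k)).coeff (-(k : ℤ)) = 1 ∧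
      (faaDiBruno h (2 * k)).coeff (-(k : ℤ) + 1) = 0 := by
  induction k with
  | zero =>
    change (∀ j < -((0 : ℕ) : ℤ), (1 : V (BT ι)).coeff j = 0) ∧
      (1 : V (BT ι)).coeff (-((0 : ℕ) : ℤ)) = 1 ∧ (1 : V (BT ι)).coeff (-((0 : ℕ) : ℤ) + 1) = 0
    refine ⟨fun j hj => ?_, ?_, ?_⟩
    · rw [HahnSeries.coeff_one, if_neg]
      omega
    · rw [HahnSeries.coeff_one, if_pos (by simp)]
    · rw [HahnSeries.coeff_one, if_neg (by simp)]
  | succ k ih =>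
    obtain ⟨h1, h2, h3⟩ := ih
    rw [show 2 * (k + 1) = 2 * k + 2 by ring]
    push_cast
    refine ⟨fun j hj => ?_, ?_, ?_⟩
    · rw [hh.coeff_add_two h1 (by omega), h1 j (by omega), h1 (j + 1) (by omega), map_zero, add_zero]
    · rw [hh.coeff_add_two h1 (by omega), h1 _ (by omega), map_zero, zero_add,
        show -((k : ℤ) + 1) + 1 = -k by ring, h2]
    · rw [show -((k : ℤ) + 1) + 1 = -k by ring, hh.coeff_add_two h1 le_rfl, h2, h3,
        mapCoeffAdd_evenDeriv_one, add_zero]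

/-- The leading term φ z^{k+1} lies above the diagonal position θ z^k. It is the reason for
subtracting a multiple of the next even polynomial in `triFaaDiBruno`. -/
theorem IsFaaDiBrunoGenerator.coeff_odd {h : V (BT ι)} (hh : IsFaaDiBrunoGenerator h) (k : ℕ) :
    (∀ j < -(k : ℤ) - 1, (faaDiBruno h (2 * k + 1)).coeff j = 0) ∧
      (faaDiBruno h (2 * k + 1)).coeff (-(k : ℤ) - 1) = Grassmann.monomial ∅ phi ∧
      (faaDiBruno h (2 * k + 1)).coeff (-(k : ℤ)) = Grassmann.monomial {()} 1 := by
  induction k with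
  | zero =>
    have h0 : faaDiBruno h (2 * 0 + 1) = h := by
      have h1 : mapVAdd superD (faaDiBruno h 0) = 0 := isSuperDeriv_superD.mapVAdd.map_one
      have h2 : h * faaDiBruno h 0 = h := mul_one h
      rw [faaDiBruno_succ, mul_zero, h1, h2, zero_add]
    rw [h0]
    refine ⟨fun j hj => ?_, ?_, ?_⟩
    · push_cast at hj
      rw [hh.coeff_of_nonpos (by omega), if_neg (by omega), if_neg (by omega), add_zero]
    · rw [hh.coeff_of_nonpos (by simp)]
      simp
    · rw [hh.coeff_of_nonpos (by simp)]
      simp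
  | succ k ih =>
    obtain ⟨h1, h2, h3⟩ := ih
    rw [show 2 * (k + 1) + 1 = 2 * k + 1 + 2 by ring]
    push_cast
    refine ⟨fun j hj => ?_, ?_, ?_⟩
    · rw [hh.coeff_add_two h1 (by omega), h1 j (by omega), h1 (j + 1) (by omega), map_zero, add_zero]
    · rw [hh.coeff_add_two h1 (by omega), h1 _ (by omega), map_zero, zero_add,
        show -((k : ℤ) + 1) - 1 + 1 = -k - 1 by ring, h2]
    · rw [show -((k : ℤ) + 1) = -k - 1 by ring, hh.coeff_add_two h1 le_rfl, h2,
        show -(k : ℤ) - 1 + 1 = -k by ring, h3, mapCoeffAdd_evenDeriv_phi, zero_add]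

/-- The Faà di Bruno polynomials, modified so as to form a unitriangular family. -/
def triFaaDiBruno (h : V (BT ι)) (l : ℕ) : V (BT ι) :=
  if l % 2 = 0 then faaDiBruno h l else faaDiBruno h l - (phi : BT ι) • faaDiBruno h (l + 1)

theorem IsFaaDiBrunoGenerator.isUnitriangular {h : V (BT ι)} (hh : IsFaaDiBrunoGenerator h) :
    IsUnitriangular (triFaaDiBruno h) := by
  have heven : ∀ k m, 2 * k ≤ m → pc (faaDiBruno h (2 * k)) m = if m = 2 * k then 1 else 0 := by
    intro k m hm
    obtain ⟨h1, h2, _⟩ := hh.coeff_even k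
    by_cases hmk : m / 2 = k
    · rw [pc, hmk, h2]
      change (if (if m % 2 = 0 then ∅ else {()}) = (∅ : Finset Unit) then (1 : BT ι) else 0) = _
      by_cases h0 : m % 2 = 0
      · rw [if_pos (by rw [if_pos h0]), if_pos (by omega)]
      · rw [if_neg (by rw [if_neg h0]; simp), if_neg (by omega)]
    · rw [pc, h1 _ (by omega), coeff_zero, if_neg (by omega)]
  have hodd : ∀ k m, 2 * k + 1 ≤ m → pc (faaDiBruno h (2 * k + 1)) m =
      if m = 2 * k + 1 then 1 else if m = 2 * k + 2 then phi else 0 := by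
    intro k m hm
    obtain ⟨h1, h2, h3⟩ := hh.coeff_odd k
    by_cases hmk : m / 2 = k
    · have hm' : m = 2 * k + 1 := by omega
      rw [pc, hmk, h3, coeff_monomial, if_pos (by rw [if_neg (by omega)]), if_pos hm']
    · by_cases hmk' : m / 2 = k + 1
      · rw [pc, hmk', show -((k + 1 : ℕ) : ℤ) = -k - 1 by push_cast; ring, h2, coeff_monomial,
          if_neg (show ¬ m = 2 * k + 1 by omega)]
        by_cases h0 : m % 2 = 0
        · rw [if_pos (by rw [if_pos h0]), if_pos (by omega)]
        · rw [if_neg (by rw [if_neg h0]; simp), if_neg (by omega)]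
      · rw [pc, h1 _ (by omega), coeff_zero, if_neg (by omega), if_neg (by omega)]
  -- The even polynomial used as correction has no θ z^k term, so the diagonal entry remains 1.
  have hodd' : ∀ k, pc (faaDiBruno h (2 * k + 2)) (2 * k + 1) = 0 := by
    intro k
    obtain ⟨_, _, h3⟩ := hh.coeff_even (k + 1)
    rw [pc, show (2 * k + 1) / 2 = k by omega, show 2 * k + 2 = 2 * (k + 1) by ring,
      show -(k : ℤ) = -((k + 1 : ℕ) : ℤ) + 1 by push_cast; ring, h3, coeff_zero]
  constructor
  · intro l
    rcases Nat.even_or_odd' l with ⟨k, rfl | rfl⟩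
    · rw [triFaaDiBruno, if_pos (by omega), heven k _ le_rfl, if_pos rfl]
    · rw [triFaaDiBruno, if_neg (by omega), pc_sub, pc_smul, hodd k _ le_rfl, if_pos rfl, hodd',
        mul_zero, sub_zero]
  · intro l m hlm
    rcases Nat.even_or_odd' l with ⟨k, rfl | rfl⟩
    · rw [triFaaDiBruno, if_pos (by omega), heven k _ hlm.le, if_neg (by omega)]
    · rw [triFaaDiBruno, if_neg (by omega), pc_sub, pc_smul, hodd k _ hlm.le,
        if_neg (by omega), show 2 * k + 1 + 1 = 2 * (k + 1) by ring, heven (k + 1) m (by omega)]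
      by_cases hm : m = 2 * (k + 1)
      · rw [if_pos hm, if_pos hm, mul_one, sub_self]
      · rw [if_neg hm, if_neg hm, mul_zero, sub_zero]

theorem comb_triFaaDiBruno {C : Subring (BT ι)} (hphi : phi ∈ C) (h : V (BT ι)) :
    comb C (triFaaDiBruno h) = comb C (faaDiBruno h) := by
  refine le_antisymm (comb_le fun l => ?_) (comb_le fun l => ?_)
  · unfold triFaaDiBruno
    split_ifs
    · exact mem_comb l
    · exact sub_mem (mem_comb l) (smul_mem_comb hphi _)
  · by_cases hl : l % 2 = 0
    · have := mem_comb (C := C) (g := triFaaDiBruno h) l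
      rwa [triFaaDiBruno, if_pos hl] at this
    · have h1 := mem_comb (C := C) (g := triFaaDiBruno h) l
      have h2 := smul_mem_comb (g := triFaaDiBruno h) hphi (l + 1)
      rw [triFaaDiBruno, if_neg hl] at h1
      rw [triFaaDiBruno, if_pos (by omega)] at h2
      simpa using add_mem h1 h2

theorem isReduced_of_asymptotics {A : Type*} [Ring A] [Super A] {H : ℕ → V A}
    (h : ∀ (k : ℕ) (p : Fin 2), IsNeg (H (2 * k + p) - vMonomial 1 p k)) : IsReduced H := by
  have key : ∀ (k : ℕ) (p : Fin 2) (m : ℕ), pc (vMonomial (1 : A) p k) m =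
      if m = 2 * k + p then 1 else 0 := by
    intro k p m
    rw [pc, coeff_vMonomial]
    by_cases hk : m / 2 = k
    · rw [if_pos (by rw [hk]), coeff_monomial]
      fin_cases p
      · by_cases h0 : m % 2 = 0
        · simp [show m = 2 * k by omega]
        · simp [h0, show m ≠ 2 * k by omega]
      · by_cases h0 : m % 2 = 0
        · simp [h0, show m ≠ 2 * k + 1 by omega, eq_comm]
        · simp [show m = 2 * k + 1 by omega]
    · rw [if_neg (by omega), coeff_zero, if_neg (by have := p.2; omega)]
  have key' : ∀ (k : ℕ) (p : Fin 2) (m : ℕ), pc (H (2 * k + p)) m =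
      if m = 2 * k + p then 1 else 0 := by
    intro k p m
    have h1 := isNeg_iff_pc.1 (h k p) m
    rwa [pc_sub, key, sub_eq_zero] at h1
  intro l m
  rcases Nat.even_or_odd' l with ⟨k, rfl | rfl⟩
  · simpa using key' k 0 m
  · simpa using key' k 1 m

variable {C : Subring (BT ι)} {h : V (BT ι)} {H : ℕ → V (BT ι)}

theorem IsSuperCurrents.isReduced (hH : IsSuperCurrents h H) : IsReduced H :=
  isReduced_of_asymptotics hH.asymptotics

theorem comb_currents (hpar : ∀ a ∈ C, Super.parity a ∈ C) (hD : ∀ a ∈ C, superD a ∈ C)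
    (hphi : phi ∈ C) (hgen : IsFaaDiBrunoGenerator h) (hH : IsSuperCurrents h H)
    (hh : h ∈ coeffsIn C.toAddSubgroup) : comb C H = comb C (faaDiBruno h) := by
  rw [← comb_triFaaDiBruno hphi]
  refine hgen.isUnitriangular.comb_eq (fun l => ?_) hH.isReduced fun l => ?_
  · have h1 := faaDiBruno_mem_coeffsIn hpar hD hh
    unfold triFaaDiBruno
    split_ifs
    · exact h1 l
    · exact sub_mem (h1 l) (coeffsIn_smul (S := C.toAddSubgroup)
        (fun _ hs _ ht => C.mul_mem hs ht) hphi (h1 _))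
  · rw [comb_triFaaDiBruno (Subring.mem_top _)]
    exact span_le_comb_top (hH.mem l)

theorem currents_mem_coeffsIn (hpar : ∀ a ∈ C, Super.parity a ∈ C) (hD : ∀ a ∈ C, superD a ∈ C)
    (hphi : phi ∈ C) (hgen : IsFaaDiBrunoGenerator h) (hH : IsSuperCurrents h H)
    (hh : h ∈ coeffsIn C.toAddSubgroup) (l : ℕ) : H l ∈ coeffsIn C.toAddSubgroup :=
  comb_le_coeffsIn (faaDiBruno_mem_coeffsIn hpar hD hh)
    (comb_currents hpar hD hphi hgen hH hh ▸ mem_comb l)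

/-- The span is stable under parity, and the difference of `Super.parity (H l)` and its expected
value lies in the span without nonnegative powers of z, so it is 0. -/
theorem isPar_currents (hgen : IsFaaDiBrunoGenerator h) (hH : IsSuperCurrents h H) (l : ℕ) :
    IsPar l (H l) := by
  have hcomb : comb ⊤ H = comb ⊤ (faaDiBruno h) :=
    comb_currents (fun _ _ => Subring.mem_top _) (fun _ _ => Subring.mem_top _)
      (Subring.mem_top _) hgen hH fun _ _ => Subring.mem_top _
  have hparity : ∀ v ∈ comb ⊤ H, Super.parity v ∈ comb ⊤ H := by
    rw [hcomb]
    intro v hv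
    refine comb_induction (P := fun v => Super.parity v ∈ comb ⊤ (faaDiBruno h))
      (fun c _ n => ?_) (fun u v hu hv => ?_) hv
    · have h1 : Super.parity (faaDiBruno h n) = _ := isPar_faaDiBruno hgen.odd.isPar n
      rw [parity_smulV, h1]
      exact smul_mem_comb_of_mem (Subring.mem_top _) (zsmul_mem (mem_comb n) _)
    · rw [map_add]
      exact add_mem hu hv
  have h0 := hH.isReduced.eq_zero (C := ⊤) (v := Super.parity (H l) - (-1 : ℤ) ^ l • H l)
    (sub_mem (hparity _ (mem_comb l)) (zsmul_mem (mem_comb l) _)) fun m => by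
      rw [pc_sub, pc_parity, pc_zsmul, hH.isReduced]
      split_ifs with hml
      · rw [hml, map_one, sub_self]
      · simp
  exact sub_eq_zero.1 h0

end FaaDiBruno

/-! ### Connections -/

section Connections

variable {A : Type*} [Ring A] [Super A] [SuperComm A]

/-- The operator `δ + B`. -/
def connection (δ : A →+ A) (B : V A) : V A →+ V A := mapVAdd δ + AddMonoidHom.mulLeft B

theorem connection_apply (δ : A →+ A) (B v : V A) : connection δ B v = mapVAdd δ v + B * v := rfl

theorem connection_smul {n : ℕ} {δ : A →+ A} (hδ : IsSuperDeriv n δ) {B : V A} (hB : IsPar n B)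
    (c : A) (v : V A) : connection δ B (c • v) = δ c • v + par n c • connection δ B v := by
  rw [connection_apply, connection_apply, hδ.mapVAdd_smul, hB.mul_smulV, smul_add, add_assoc]

/-- A factor annihilated by `δ` passes through the connection up to parity. It is applied to
elements that are constant in all variables. -/
theorem connection_mul {n : ℕ} {δ : A →+ A} (hδ : IsSuperDeriv n δ) {B : V A} (hB : IsPar n B)
    {f : V A} (hf : mapVAdd δ f = 0) (v : V A) :
    connection δ B (f * v) = par n f * connection δ B v := by
  rw [connection_apply, connection_apply, hδ.mapVAdd.leibniz, hf, zero_mul, zero_add, mul_add,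
    ← mul_assoc, hB.mul_eq, mul_assoc]

theorem connection_mem_comb {n : ℕ} {δ : A →+ A} (hδ : IsSuperDeriv n δ) {B : V A}
    (hB : IsPar n B) {C : Subring A} (hpar : ∀ a ∈ C, Super.parity a ∈ C)
    (hδC : ∀ a ∈ C, δ a ∈ C) {g : ℕ → V A} (hg : ∀ l, connection δ B (g l) ∈ comb C g) {v : V A}
    (hv : v ∈ comb C g) : connection δ B v ∈ comb C g := by
  refine comb_induction (P := fun v => connection δ B v ∈ comb C g) (fun c hc l => ?_)
    (fun u v hu hv => ?_) hv
  · rw [connection_smul hδ hB]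
    exact add_mem (smul_mem_comb (hδC c hc) l)
      (smul_mem_comb_of_mem (par_mem (S := C.toAddSubgroup) hpar n hc) (hg l))
  · rw [map_add]
    exact add_mem hu hv

end Connections

/-! ### Zero curvature and invariance of the span under the flows. -/

section Flows

variable {ι : Type*} [LinearOrder ι] {C : Subring (BT ι)} {h : V (BT ι)} {H : ℕ → V (BT ι)}

theorem connection_superD_mem_comb (hpar : ∀ a ∈ C, Super.parity a ∈ C)
    (hD : ∀ a ∈ C, superD a ∈ C) (hh : IsPar 1 h) {v : V (BT ι)}
    (hv : v ∈ comb C (faaDiBruno h)) : connection superD h v ∈ comb C (faaDiBruno h) :=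
  connection_mem_comb isSuperDeriv_superD hh hpar hD (fun l => mem_comb (l + 1)) hv

theorem mapVAdd_timeDeriv_superD {k : ℕ} (hk : 1 ≤ k) (v : V (BT ι)) :
    mapVAdd (timeDeriv k) (mapVAdd superD v) =
      (-1 : ℤ) ^ k • mapVAdd superD (mapVAdd (timeDeriv k) v) := by
  ext j s : 4
  rw [coeff_zsmulV, coeff_zsmul]
  exact timeDeriv_superD hk _

theorem isPar_currents_mod (hgen : IsFaaDiBrunoGenerator h) (hH : IsSuperCurrents h H) (k : ℕ) :
    IsPar (k % 2) (H k) :=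
  (isPar_currents hgen hH k).congr (neg_one_pow_eq_of_mod (by simp))

/-- Both sides are expanded by Leibniz. The derivations supercommute, H_k h and h H_k agree up to
sign, and the one remaining identity, between ∂_{t_k} h and 𝓓H_k, is the equation of the hierarchy.
-/
theorem connection_timeDeriv_superD (hsol : IsJSKPSolution h H) {k : ℕ} (hk : 1 ≤ k)
    (v : V (BT ι)) : connection (timeDeriv k) (H k) (connection superD h v) =
      (-1 : ℤ) ^ k • connection superD h (connection (timeDeriv k) (H k) v) := by
  have hh := hsol.generator.odd.isPar
  have hHk := isPar_currents_mod hsol.generator hsol.currents k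
  have hflow : mapVAdd (timeDeriv k) h = (-1 : ℤ) ^ k • mapVAdd superD (H k) := by
    rw [← timeDerivV_eq, hsol.flow k hk, superDV_eq, zsmul_eq_mul]
    push_cast
    rfl
  have hsign : (-1 : ℤ) ^ (k % 2) = (-1) ^ k := neg_one_pow_eq_of_mod (by simp)
  have hss : ∀ w : V (BT ι), (-1 : ℤ) ^ k • (-1 : ℤ) ^ k • w = w := by
    intro w
    rw [smul_smul, ← mul_pow]
    simp
  have h1 : par (k % 2) h = (-1 : ℤ) ^ k • h := by rw [hh.par_eq, mul_one, hsign]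
  have h2 : Super.parity (H k) = (-1 : ℤ) ^ k • H k := by
    rw [← hsign]
    exact hHk
  have h3 : H k * h = (-1 : ℤ) ^ k • (h * H k) := by
    rw [hHk.mul_comm_sign hh, mul_one, hsign]
  simp only [connection_apply, map_add, (isSuperDeriv_timeDeriv (ι := ι) k).mapVAdd.leibniz,
    isSuperDeriv_superD.mapVAdd.leibniz, mapVAdd_timeDeriv_superD hk, hflow, par_one, h1, h2,
    smul_add, smul_mul_assoc, hss, ← mul_assoc, h3]
  abel

/-- The generators are (𝓓 + h)^l 1. The time connection sends 1 to `H k` and supercommutes with 𝓓 +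
h, which preserves the span. -/
theorem connection_timeDeriv_mem_comb (hpar : ∀ a ∈ C, Super.parity a ∈ C)
    (hD : ∀ a ∈ C, superD a ∈ C) (htime : ∀ k, ∀ a ∈ C, timeDeriv k a ∈ C)
    (hsol : IsJSKPSolution h H) {k : ℕ} (hk : 1 ≤ k) (hHk : H k ∈ comb C (faaDiBruno h))
    {v : V (BT ι)} (hv : v ∈ comb C (faaDiBruno h)) :
    connection (timeDeriv k) (H k) v ∈ comb C (faaDiBruno h) := by
  refine connection_mem_comb (isSuperDeriv_timeDeriv k)
    (isPar_currents_mod hsol.generator hsol.currents k) hpar (htime k) (fun l => ?_) hv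
  induction l with
  | zero =>
    have h1 : mapVAdd (timeDeriv k) (faaDiBruno h 0) = 0 :=
      (isSuperDeriv_timeDeriv k).mapVAdd.map_one
    have h2 : H k * faaDiBruno h 0 = H k := mul_one (H k)
    rwa [connection_apply, h1, h2, zero_add]
  | succ l ih =>
    change connection (timeDeriv k) (H k) (connection superD h (faaDiBruno h l)) ∈ _
    rw [connection_timeDeriv_superD hsol hk]
    exact zsmul_mem (connection_superD_mem_comb hpar hD hsol.generator.odd.isPar ih) _

end Flows

/-! ### Differential ideals of obstructions -/

section Obstructions

variable {A : Type*} [Ring A] [Super A] {C : Subring A} {G : Set A}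

/-- The two-sided parity-stable ideal of `C` generated by `G`. -/
def genIdeal (C : Subring A) (G : Set A) : AddSubgroup A :=
  AddSubgroup.closure {x | ∃ a ∈ C, ∃ b ∈ C, ∃ n, ∃ g ∈ G, x = a * par n g * b}

theorem subset_genIdeal {g : A} (hg : g ∈ G) : g ∈ genIdeal C G :=
  AddSubgroup.subset_closure ⟨1, one_mem C, 1, one_mem C, 0, g, hg, by simp [par_zero]⟩

theorem genIdeal_induction {S : AddSubgroup A} (δ : A →+ A)
    (h : ∀ a ∈ C, ∀ b ∈ C, ∀ n, ∀ g ∈ G, δ (a * par n g * b) ∈ S) {x : A}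
    (hx : x ∈ genIdeal C G) : δ x ∈ S := by
  have : genIdeal C G ≤ S.comap δ := by
    refine (AddSubgroup.closure_le _).2 ?_
    rintro _ ⟨a, ha, b, hb, n, g, hg, rfl⟩
    exact h a ha b hb n g hg
  exact this hx

theorem mul_mem_genIdeal {c x : A} (hc : c ∈ C) (hx : x ∈ genIdeal C G) : c * x ∈ genIdeal C G := by
  refine genIdeal_induction (AddMonoidHom.mulLeft c) (fun a ha b hb n g hg => ?_) hx
  exact AddSubgroup.subset_closure ⟨c * a, mul_mem hc ha, b, hb, n, g, hg, by
    simp only [AddMonoidHom.coe_mulLeft, mul_assoc]⟩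

theorem genIdeal_mul_mem {c x : A} (hc : c ∈ C) (hx : x ∈ genIdeal C G) : x * c ∈ genIdeal C G := by
  refine genIdeal_induction (AddMonoidHom.mulRight c) (fun a ha b hb n g hg => ?_) hx
  exact AddSubgroup.subset_closure ⟨a, ha, b * c, mul_mem hb hc, n, g, hg, by
    simp only [AddMonoidHom.coe_mulRight, mul_assoc]⟩

theorem parity_mem_genIdeal (hpar : ∀ a ∈ C, Super.parity a ∈ C) {x : A}
    (hx : x ∈ genIdeal C G) : Super.parity x ∈ genIdeal C G := by
  refine genIdeal_induction (Super.parity : A →+* A).toAddMonoidHom (fun a ha b hb n g hg => ?_) hx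
  refine AddSubgroup.subset_closure ⟨_, hpar a ha, _, hpar b hb, 1 + n, g, hg, ?_⟩
  rw [par_add, par_one]
  simp

theorem genIdeal_le (hpar : ∀ a ∈ C, Super.parity a ∈ C) (hG : ∀ g ∈ G, g ∈ C) {x : A}
    (hx : x ∈ genIdeal C G) : x ∈ C :=
  genIdeal_induction (S := C.toAddSubgroup) (AddMonoidHom.id A) (fun _ ha _ hb n g hg =>
    C.mul_mem (C.mul_mem ha (par_mem (S := C.toAddSubgroup) hpar n (hG g hg))) hb) hx

theorem IsSuperDeriv.mem_genIdeal {n : ℕ} {δ : A →+ A} (hδ : IsSuperDeriv n δ)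
    (hpar : ∀ a ∈ C, Super.parity a ∈ C) (hδC : ∀ a ∈ C, δ a ∈ C)
    (hG : ∀ g ∈ G, δ g ∈ genIdeal C G) {x : A} (hx : x ∈ genIdeal C G) : δ x ∈ genIdeal C G := by
  refine genIdeal_induction δ (fun a ha b hb m g hg => ?_) hx
  have hC : ∀ a ∈ C, Grassmann.par n a ∈ C := fun a ha => par_mem (S := C.toAddSubgroup) hpar n ha
  have hI : ∀ m, ∀ x ∈ genIdeal C G, Grassmann.par m x ∈ genIdeal C G :=
    fun m x hx => par_mem (fun _ => parity_mem_genIdeal hpar) m hx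
  have hg' := hI m g (subset_genIdeal hg)
  rw [hδ.leibniz, hδ.leibniz, hδ.par, map_mul]
  refine add_mem (genIdeal_mul_mem hb (add_mem (mul_mem_genIdeal (hδC a ha) hg') ?_)) ?_
  · exact mul_mem_genIdeal (hC a ha) (zsmul_mem (hI m _ (hG g hg)) _)
  · exact genIdeal_mul_mem (hδC b hb) (mul_mem_genIdeal (hC a ha) (hI n _ hg'))

variable {I : AddSubgroup A} {H : ℕ → V A}

/-- Write v = w + u with w in the span. The nonnegative powers of z cancel, so those of w have
coefficients in `I`, and these are the coefficients of w in terms of `H`. -/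
theorem mem_coeffsIn_of_isNeg (hI : ∀ a ∈ I, ∀ b ∈ C, a * b ∈ I)
    (hHC : ∀ l, H l ∈ coeffsIn C.toAddSubgroup) (hH : IsReduced H) {v : V A}
    (hv : v ∈ comb C H ⊔ coeffsIn I) (hneg : IsNeg v) : v ∈ coeffsIn I := by
  obtain ⟨w, hw, u, hu, rfl⟩ := AddSubgroup.mem_sup.1 hv
  refine add_mem ?_ hu
  rw [hH.eq_lincomb hw]
  refine sum_mem fun l _ => coeffsIn_smul hI ?_ (hHC l)
  have h1 := isNeg_iff_pc.1 hneg l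
  rw [pc_add] at h1
  change pc w l ∈ I
  rw [eq_neg_of_add_eq_zero_left h1]
  exact neg_mem (pc_mem hu l)

theorem eq_negProj_add (v : V A) : v = negProj H v + lincomb (posPart v) H := by
  rw [negProj, sub_add_cancel]

theorem smul_mem_comb_sup (hI : ∀ b ∈ C, ∀ a ∈ I, b * a ∈ I) {c : A} (hc : c ∈ C) {v : V A}
    (hv : v ∈ comb C H ⊔ coeffsIn I) : c • v ∈ comb C H ⊔ coeffsIn I := by
  obtain ⟨w, hw, u, hu, rfl⟩ := AddSubgroup.mem_sup.1 hv
  rw [smul_add]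
  exact AddSubgroup.mem_sup.2 ⟨_, smul_mem_comb_of_mem hc hw, _,
    coeffsIn_smul (S := C.toAddSubgroup) hI hc hu, rfl⟩

variable [SuperComm A] [Module ℚ A]

/-- This says that `f` preserves the span modulo `I`. All `n` are needed because the odd part of a
scalar turns `f` into its parity conjugate. -/
theorem par_mul_mem_comb_sup (hhom : ∀ n, ∀ c ∈ C, homPart n c ∈ C)
    (hI : ∀ b ∈ C, ∀ a ∈ I, b * a ∈ I) {f : V A}
    (hpos : ∀ n k l, pc (par n f * H k) l ∈ C)
    (hf : ∀ n k, negProj H (par n f * H k) ∈ coeffsIn I) (n : ℕ) {v : V A} (hv : v ∈ comb C H) :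
    par n f * v ∈ comb C H ⊔ coeffsIn I := by
  have key : ∀ n k, par n f * H k ∈ comb C H ⊔ coeffsIn I := fun n k => by
    rw [eq_negProj_add (H := H) (par n f * H k)]
    exact add_mem (AddSubgroup.mem_sup_right (hf n k))
      (AddSubgroup.mem_sup_left (lincomb_mem_comb (hpos n k)))
  refine comb_induction (P := fun v => par n f * v ∈ comb C H ⊔ coeffsIn I) (fun c hc l => ?_)
    (fun u v hu hv => ?_) hv
  · rw [mul_smulV]
    refine add_mem (smul_mem_comb_sup hI (hhom 0 c hc) (key n l))
      (smul_mem_comb_sup hI (hhom 1 c hc) ?_)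
    have := key (1 + n) l
    rwa [par_add, par_one] at this
  · rw [mul_add]
    exact add_mem hu hv

/-- Let r = f H_k − w be the obstruction and ∇ = δ + B. Then ∇r = ± f ∇H_k − ∇w lies in the span
modulo `I`, up to the parity twist of `f`, and Br has coefficients in `I`. So δr = ∇r − Br lies in
the span modulo `I`; as it is O(z⁻¹), its coefficients are in `I`. -/
theorem IsSuperDeriv.negProj_mem_coeffsIn {n : ℕ} {δ : A →+ A} (hδ : IsSuperDeriv n δ)
    {B : V A} (hB : IsPar n B) (hBC : B ∈ coeffsIn C.toAddSubgroup)
    (hconn : ∀ v ∈ comb C H, connection δ B v ∈ comb C H)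
    (hhom : ∀ n, ∀ c ∈ C, homPart n c ∈ C) (hIpar : ∀ a ∈ I, Super.parity a ∈ I)
    (hIl : ∀ b ∈ C, ∀ a ∈ I, b * a ∈ I) (hIr : ∀ a ∈ I, ∀ b ∈ C, a * b ∈ I)
    (hHC : ∀ l, H l ∈ coeffsIn C.toAddSubgroup) (hH : IsReduced H) {f : V A}
    (hfδ : SuperKP.mapVAdd δ f = 0) (hpos : ∀ n k l, pc (Grassmann.par n f * H k) l ∈ C)
    (hf : ∀ n k, negProj H (Grassmann.par n f * H k) ∈ coeffsIn I) (m k : ℕ) :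
    SuperKP.mapVAdd δ (negProj H (Grassmann.par m f * H k)) ∈ coeffsIn I := by
  refine mem_coeffsIn_of_isNeg hIr hHC hH ?_ ((hH.isNeg_negProj _).mapVAdd δ)
  have h1 : SuperKP.mapVAdd δ (negProj H (Grassmann.par m f * H k)) =
      connection δ B (negProj H (Grassmann.par m f * H k)) -
        B * negProj H (Grassmann.par m f * H k) := by
    rw [connection_apply, add_sub_cancel_right]
  have h2 : SuperKP.mapVAdd δ (Grassmann.par m f) = 0 := by
    rw [hδ.mapVAdd.par, hfδ, map_zero, smul_zero]
  rw [h1]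
  refine sub_mem ?_ (AddSubgroup.mem_sup_right
    (coeffsIn_mul (S := C.toAddSubgroup) hIl hIpar hBC (hf m k)))
  rw [negProj, map_sub, connection_mul hδ hB h2, ← par_add]
  exact sub_mem (par_mul_mem_comb_sup hhom hIl hpos hf _ (hconn _ (mem_comb k)))
    (AddSubgroup.mem_sup_left (hconn _ (lincomb_mem_comb (hpos m k))))

end Obstructions

/-! ### Evaluation of Laurent series -/

section Evaluation

variable {ι : Type*} [LinearOrder ι] {p : SuperPoint ι}

theorem homPart_mem_convSubring (n : ℕ) {F : BT ι} (hF : F ∈ convSubring p) :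
    homPart n F ∈ convSubring p := by
  have key : ∀ G ∈ convSubring p, (2⁻¹ : ℚ) • G ∈ convSubring p := by
    intro G hG J I
    refine NearSummable.mono p.radius_nonneg (absCoeff_nonneg _ _ _) (fun m => ?_) (hG J I)
    unfold absCoeff
    change ‖(2⁻¹ : ℚ) • (MvPowerSeries.coeff m (G.coeff J)).coeff I‖ ≤ _
    rw [Rat.smul_def, norm_mul]
    refine mul_le_of_le_one_left (norm_nonneg _) ?_
    norm_num
  exact key _ (add_mem hF (zsmul_mem (parity_mem_convSubring hF) _))

/-- Evaluation at `p` of convergent power series. -/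
def evalHom (p : SuperPoint ι) : convSubring p →+ Lam ι where
  toFun F := p.eval F
  map_zero' := map_zero p.eval
  map_add' F G := eval_add F.2 G.2

theorem eval_sum {κ : Type*} (s : Finset κ) {F : κ → BT ι} (hF : ∀ i, F i ∈ convSubring p) :
    p.eval (∑ i ∈ s, F i) = ∑ i ∈ s, p.eval (F i) := by
  have := map_sum (evalHom p) (fun i => (⟨F i, hF i⟩ : convSubring p)) s
  rw [evalHom, AddMonoidHom.coe_mk, ZeroHom.coe_mk, AddSubmonoidClass.coe_finsetSum] at this
  exact this

theorem eval_zsmul (n : ℤ) {F : BT ι} (hF : F ∈ convSubring p) :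
    p.eval (n • F) = n • p.eval F := by
  have h1 : ((n • (⟨F, hF⟩ : convSubring p) : convSubring p) : BT ι) = n • F :=
    AddSubgroupClass.coe_zsmul _ _
  have h2 := map_zsmul (evalHom p) n ⟨F, hF⟩
  rw [evalHom, AddMonoidHom.coe_mk, ZeroHom.coe_mk, h1] at h2
  exact h2

theorem eval_par (n : ℕ) (F : BT ι) : p.eval (par n F) = par n (p.eval F) := by
  by_cases hn : Even n
  · rw [par_of_even hn, par_of_even hn]
  · rw [par_of_odd hn, par_of_odd hn, eval_parity]

theorem mapV_eval_add {u v : V (BT ι)} (hu : u ∈ coeffsIn (convSubring p).toAddSubgroup)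
    (hv : v ∈ coeffsIn (convSubring p).toAddSubgroup) :
    mapV p.eval (u + v) = mapV p.eval u + mapV p.eval v := by
  ext k s : 4
  exact eval_add (hu k s) (hv k s)

theorem mapV_eval_smul {c : BT ι} (hc : c ∈ convSubring p) {v : V (BT ι)}
    (hv : v ∈ coeffsIn (convSubring p).toAddSubgroup) :
    mapV p.eval (c • v) = p.eval c • mapV p.eval v := by
  ext k s : 4
  exact eval_mul hc (hv k s)

theorem mapV_eval_zsmul (n : ℤ) {v : V (BT ι)}
    (hv : v ∈ coeffsIn (convSubring p).toAddSubgroup) :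
    mapV p.eval (n • v) = n • mapV p.eval v := by
  ext k s : 4
  rw [coeff_mapV, mapCoeff_coeff, coeff_zsmulV, coeff_zsmulV, coeff_zsmul, coeff_zsmul]
  exact eval_zsmul n (hv k s)

theorem mapV_eval_parity {v : V (BT ι)} (hv : v ∈ coeffsIn (convSubring p).toAddSubgroup) :
    mapV p.eval (Super.parity v) = Super.parity (mapV p.eval v) := by
  ext k s : 4
  rw [coeff_mapV, mapCoeff_coeff, coeff_parityV, coeff_parityV, coeff_parity, coeff_parity,
    eval_zsmul _ (parity_mem_convSubring (hv k s)), eval_parity]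
  rfl

theorem mapV_eval_par (n : ℕ) {v : V (BT ι)} (hv : v ∈ coeffsIn (convSubring p).toAddSubgroup) :
    mapV p.eval (par n v) = par n (mapV p.eval v) := by
  by_cases hn : Even n
  · rw [par_of_even hn, par_of_even hn]
  · rw [par_of_odd hn, par_of_odd hn, mapV_eval_parity hv]

theorem support_mapV_subset {A A' : Type*} [Ring A] [Super A] [Ring A'] [Super A']
    (g : ZeroHom A A') (v : V A) : (mapV g v).support ⊆ v.support :=
  fun k hk h0 => hk (by rw [coeff_mapV, h0, map_zero])

theorem coeff_mul_mem_convSubring {a b : Grassmann Unit (BT ι)}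
    (ha : ∀ s, a.coeff s ∈ convSubring p) (hb : ∀ s, b.coeff s ∈ convSubring p) (s J : Finset Unit) :
    a.coeff J * par J.card (b.coeff (s \ J)) ∈ convSubring p := by
  refine mul_mem (ha J) ?_
  exact par_mem (S := (convSubring p).toAddSubgroup) (fun _ => parity_mem_convSubring) _ (hb _)

theorem mul_coeff_mem_convSubring {a b : Grassmann Unit (BT ι)}
    (ha : ∀ s, a.coeff s ∈ convSubring p) (hb : ∀ s, b.coeff s ∈ convSubring p) (s : Finset Unit) :
    (a * b).coeff s ∈ convSubring p := by
  rw [coeff_mul]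
  exact sum_mem fun J _ => zsmul_mem (coeff_mul_mem_convSubring ha hb s J) _

theorem mapCoeff_eval_mul {a b : Grassmann Unit (BT ι)} (ha : ∀ s, a.coeff s ∈ convSubring p)
    (hb : ∀ s, b.coeff s ∈ convSubring p) :
    mapCoeff p.eval (a * b) = mapCoeff p.eval a * mapCoeff p.eval b := by
  ext s : 2
  have hterm := coeff_mul_mem_convSubring ha hb s
  rw [mapCoeff_coeff, coeff_mul, coeff_mul]
  refine (eval_sum _ fun J => zsmul_mem (hterm J) _).trans (Finset.sum_congr rfl fun J _ => ?_)
  have h1 := par_mem (S := (convSubring p).toAddSubgroup) (fun _ => parity_mem_convSubring) J.card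
    (hb (s \ J))
  rw [mapCoeff_coeff, mapCoeff_coeff, ← eval_par]
  exact (eval_zsmul _ (hterm J)).trans (congrArg _ (eval_mul (ha J) h1))

theorem mapV_eval_mul {u v : V (BT ι)} (hu : u ∈ coeffsIn (convSubring p).toAddSubgroup)
    (hv : v ∈ coeffsIn (convSubring p).toAddSubgroup) :
    mapV p.eval (u * v) = mapV p.eval u * mapV p.eval v := by
  ext k s : 4
  have h1 : (mapV p.eval (u * v)).coeff k = mapCoeff p.eval ((u * v).coeff k) := rfl
  have h2 := coeff_mul_of_support_subset u.isPWO_support v.isPWO_support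
    (support_mapV_subset p.eval u) (support_mapV_subset p.eval v) k
  have h3 : ∀ x : ℤ × ℤ, (u.coeff x.1 * v.coeff x.2).coeff s ∈ convSubring p := fun x =>
    mul_coeff_mem_convSubring (hu x.1) (hv x.2) s
  rw [h1, h2, HahnSeries.coeff_mul, mapCoeff_coeff, coeff_sum, coeff_sum]
  refine (eval_sum _ h3).trans (Finset.sum_congr rfl fun x _ => ?_)
  rw [coeff_mapV, coeff_mapV, ← mapCoeff_eval_mul (hu x.1) (hv x.2), mapCoeff_coeff]

theorem pc_mapV {A A' : Type*} [Ring A] [Super A] [Ring A'] [Super A'] (g : ZeroHom A A') (v : V A)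
    (l : ℕ) : pc (mapV g v) l = g (pc v l) := rfl

theorem eval_one (p : SuperPoint ι) : p.eval 1 = 1 := by
  rw [btMonomial_one, eval_btMonomial, p.evenMonomial_zero, p.oddMonomial_empty, mul_one, mul_one]

theorem IsReduced.mapV_eval {H : ℕ → V (BT ι)} (hH : IsReduced H) (p : SuperPoint ι) :
    IsReduced fun l => mapV p.eval (H l) := by
  intro l m
  rw [pc_mapV, hH]
  split_ifs
  · exact eval_one p
  · exact map_zero _

theorem mapV_eval_mem_comb {H : ℕ → V (BT ι)}
    (hHC : ∀ l, H l ∈ coeffsIn (convSubring p).toAddSubgroup) {v : V (BT ι)}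
    (hv : v ∈ comb (convSubring p) H) : mapV p.eval v ∈ comb ⊤ fun l => mapV p.eval (H l) := by
  obtain ⟨c, hc, rfl⟩ := exists_lincomb hv
  have hmem : ∀ l, c l • H l ∈ coeffsIn (convSubring p).toAddSubgroup := fun l =>
    comb_le_coeffsIn hHC (smul_mem_comb (hc l) l)
  unfold lincomb Finsupp.sum
  induction c.support using Finset.cons_induction with
  | empty =>
    rw [Finset.sum_empty]
    convert zero_mem (comb ⊤ fun l => mapV p.eval (H l)) using 1
    ext k s : 4
    exact map_zero p.eval
  | cons l t hl ih =>
    rw [Finset.sum_cons, mapV_eval_add (hmem l) (sum_mem fun m _ => hmem m),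
      mapV_eval_smul (hc l) (hHC l)]
    exact add_mem (smul_mem_comb (Subring.mem_top _) l) ih

/-! ### Constants -/

/-- An element of `Λ` as a constant power series. -/
def constBT : Lam ι →+ BT ι where
  toFun a := btMonomial ∅ 0 a
  map_zero' := by
    ext J : 2
    rw [btMonomial, coeff_monomial, map_zero, ite_self, coeff_zero]
  map_add' a b := by
    ext J : 2
    rw [coeff_add, btMonomial, btMonomial, btMonomial, coeff_monomial, coeff_monomial,
      coeff_monomial]
    split_ifs <;> simp

theorem constBT_apply (a : Lam ι) : constBT a = btMonomial ∅ 0 a := rfl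

theorem eval_constBT (p : SuperPoint ι) (a : Lam ι) : p.eval (constBT a) = a := by
  rw [constBT_apply, eval_btMonomial, p.evenMonomial_zero, p.oddMonomial_empty, mul_one, mul_one]

theorem evenDeriv_constBT (i : ℕ) (a : Lam ι) : evenDeriv i (constBT a) = 0 := by
  classical
  ext J : 2
  rw [coeff_evenDeriv, constBT_apply, btMonomial, coeff_monomial, coeff_zero]
  split_ifs
  · ext m : 1
    rw [coeff_pderiv, MvPowerSeries.coeff_monomial, if_neg, smul_zero, map_zero]
    intro h
    have := DFunLike.congr_fun h i
    simp at this
  · exact map_zero _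

theorem oddDeriv_constBT (j : ℕ) (a : Lam ι) : oddDeriv j (constBT a) = 0 := by
  ext J : 2
  rw [coeff_oddDeriv, constBT_apply, btMonomial, coeff_monomial, if_neg (Finset.insert_ne_empty j J),
    map_zero, smul_zero, ite_self, coeff_zero]

theorem superD_constBT (a : Lam ι) : superD (constBT a) = 0 := by
  rw [superD_apply, oddDeriv_constBT, evenDeriv_constBT, mul_zero, add_zero]

theorem timeDeriv_constBT (k : ℕ) (a : Lam ι) : timeDeriv k (constBT a) = 0 := by
  unfold timeDeriv
  split_ifs
  · exact evenDeriv_constBT _ a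
  · exact oddDeriv_constBT _ a

theorem mapV_eval_constBT (p : SuperPoint ι) (f : V (Lam ι)) :
    mapV p.eval (mapVAdd constBT f) = f := by
  ext k s : 4
  exact eval_constBT p _

theorem constBT_mem_coeffsIn (p : SuperPoint ι) (f : V (Lam ι)) :
    mapVAdd constBT f ∈ coeffsIn (convSubring p).toAddSubgroup :=
  fun _ _ => btMonomial_mem_convSubring _ _ _

end Evaluation

/-! ### Isospectrality -/

section Isospectrality

variable {ι : Type*} [LinearOrder ι] {h : V (BT ι)} {H : ℕ → V (BT ι)} {p : SuperPoint ι}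

theorem mem_specializedSpace_iff {v : V (Lam ι)} :
    v ∈ specializedSpace H p ↔ v ∈ comb ⊤ fun l => mapV p.eval (H l) := by
  refine ⟨span_le_comb_top, fun hv => ?_⟩
  exact comb_induction (P := fun v => v ∈ specializedSpace H p)
    (fun c _ l => Submodule.smul_mem _ c (Submodule.subset_span ⟨l, rfl⟩))
    (fun _ _ => Submodule.add_mem _) hv

theorem SuperPoint.CanSpecialize.mem_coeffsIn (hp : p.CanSpecialize h) :
    h ∈ coeffsIn (convSubring p).toAddSubgroup := fun k s => (hp k s).mem_convSubring

theorem IsJSKPSolution.comb_eq (hsol : IsJSKPSolution h H) (hp : p.CanSpecialize h) :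
    comb (convSubring p) H = comb (convSubring p) (faaDiBruno h) :=
  comb_currents (fun _ => parity_mem_convSubring) (fun _ => superD_mem_convSubring)
    phi_mem_convSubring hsol.generator hsol.currents hp.mem_coeffsIn

theorem IsJSKPSolution.currents_mem (hsol : IsJSKPSolution h H) (hp : p.CanSpecialize h) (l : ℕ) :
    H l ∈ coeffsIn (convSubring p).toAddSubgroup :=
  currents_mem_coeffsIn (fun _ => parity_mem_convSubring) (fun _ => superD_mem_convSubring)
    phi_mem_convSubring hsol.generator hsol.currents hp.mem_coeffsIn l

theorem IsJSKPSolution.parity_mem_specializedSpace (hsol : IsJSKPSolution h H)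
    (hp : p.CanSpecialize h) {w : V (Lam ι)} (hw : w ∈ specializedSpace H p) :
    Super.parity w ∈ specializedSpace H p := by
  rw [mem_specializedSpace_iff] at hw ⊢
  refine comb_induction (P := fun w => Super.parity w ∈ comb ⊤ fun l => mapV p.eval (H l))
    (fun c _ l => ?_) (fun u v hu hv => ?_) hw
  · have h1 : Super.parity (H l) = _ := isPar_currents hsol.generator hsol.currents l
    rw [parity_smulV, ← mapV_eval_parity (hsol.currents_mem hp l), h1,
      mapV_eval_zsmul _ (hsol.currents_mem hp l)]
    exact smul_mem_comb_of_mem (Subring.mem_top _)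
      (zsmul_mem (mem_comb (g := fun l => mapV p.eval (H l)) l) _)
  · rw [map_add]
    exact add_mem hu hv

/-- The currents are homogeneous, so the specialized space is stable under parity and conjugation by
parity preserves its stabilizer. -/
theorem IsJSKPSolution.par_mem_stabilizer (hsol : IsJSKPSolution h H) (hp : p.CanSpecialize h)
    {f : V (Lam ι)} (hf : f ∈ stabilizer (specializedSpace H p)) (n : ℕ) :
    par n f ∈ stabilizer (specializedSpace H p) := by
  by_cases hn : Even n
  · rwa [par_of_even hn]
  · rw [par_of_odd hn]
    intro w hw
    have h1 := hsol.parity_mem_specializedSpace hp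
      (hf _ (hsol.parity_mem_specializedSpace hp hw))
    rwa [map_mul, Super.parity_parity] at h1

theorem par_constBT_mul_mem_coeffsIn (hHC : ∀ l, H l ∈ coeffsIn (convSubring p).toAddSubgroup)
    (f : V (Lam ι)) (n k : ℕ) :
    par n (mapVAdd constBT f) * H k ∈ coeffsIn (convSubring p).toAddSubgroup := by
  have hpar : ∀ a ∈ (convSubring p).toAddSubgroup, Super.parity a ∈ (convSubring p).toAddSubgroup :=
    fun _ => parity_mem_convSubring
  refine coeffsIn_mul (S := (convSubring p).toAddSubgroup)
    (fun _ hs _ ht => (convSubring p).mul_mem hs ht) hpar ?_ (hHC k)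
  exact par_mem (fun _ => coeffsIn_parity hpar) n (constBT_mem_coeffsIn p f)

/-- The coefficients of the obstructions to the invariance of the span of `H` under
multiplication by the constant element `f`. -/
def obstructions (H : ℕ → V (BT ι)) (f : V (Lam ι)) : Set (BT ι) :=
  {x | ∃ n k j s, x = ((negProj H (par n (mapVAdd constBT f) * H k)).coeff j).coeff s}

theorem negProj_mem_genIdeal (C : Subring (BT ι)) (f : V (Lam ι)) (n k : ℕ) :
    negProj H (par n (mapVAdd constBT f) * H k) ∈ coeffsIn (genIdeal C (obstructions H f)) :=
  fun j s => subset_genIdeal ⟨n, k, j, s, rfl⟩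

theorem IsJSKPSolution.deriv_mem_genIdeal (hsol : IsJSKPSolution h H) (hp : p.CanSpecialize h)
    (f : V (Lam ι)) {n : ℕ} {δ : BT ι →+ BT ι} (hδ : IsSuperDeriv n δ)
    (hδC : ∀ a ∈ convSubring p, δ a ∈ convSubring p) {B : V (BT ι)} (hB : IsPar n B)
    (hBC : B ∈ coeffsIn (convSubring p).toAddSubgroup)
    (hconn : ∀ v ∈ comb (convSubring p) H, connection δ B v ∈ comb (convSubring p) H)
    (hconst : ∀ a, δ (constBT a) = 0) {x : BT ι}
    (hx : x ∈ genIdeal (convSubring p) (obstructions H f)) :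
    δ x ∈ genIdeal (convSubring p) (obstructions H f) := by
  refine hδ.mem_genIdeal (fun _ => parity_mem_convSubring) hδC ?_ hx
  rintro _ ⟨m, k, j, s, rfl⟩
  refine hδ.negProj_mem_coeffsIn hB hBC hconn (fun n c hc => homPart_mem_convSubring n hc)
    (fun _ => parity_mem_genIdeal fun _ => parity_mem_convSubring)
    (fun _ hb _ ha => mul_mem_genIdeal hb ha) (fun _ ha _ hb => genIdeal_mul_mem hb ha)
    (hsol.currents_mem hp) hsol.currents.isReduced (f := mapVAdd constBT f) ?_
    (fun n k l => pc_mem (par_constBT_mul_mem_coeffsIn (hsol.currents_mem hp) f n k) l)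
    (negProj_mem_genIdeal _ f) m k j s
  ext i t : 4
  exact hconst _

theorem IsJSKPSolution.superD_mem_genIdeal (hsol : IsJSKPSolution h H) (hp : p.CanSpecialize h)
    (f : V (Lam ι)) {x : BT ι} (hx : x ∈ genIdeal (convSubring p) (obstructions H f)) :
    superD x ∈ genIdeal (convSubring p) (obstructions H f) := by
  refine hsol.deriv_mem_genIdeal hp f isSuperDeriv_superD (fun _ => superD_mem_convSubring)
    hsol.generator.odd.isPar hp.mem_coeffsIn (fun v hv => ?_) superD_constBT hx
  rw [hsol.comb_eq hp] at hv ⊢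
  exact connection_superD_mem_comb (fun _ => parity_mem_convSubring)
    (fun _ => superD_mem_convSubring) hsol.generator.odd.isPar hv

theorem IsJSKPSolution.timeDeriv_mem_genIdeal (hsol : IsJSKPSolution h H) (hp : p.CanSpecialize h)
    (f : V (Lam ι)) {k : ℕ} (hk : 1 ≤ k) {x : BT ι}
    (hx : x ∈ genIdeal (convSubring p) (obstructions H f)) :
    timeDeriv k x ∈ genIdeal (convSubring p) (obstructions H f) := by
  refine hsol.deriv_mem_genIdeal hp f (isSuperDeriv_timeDeriv k)
    (fun _ => timeDeriv_mem_convSubring k) (isPar_currents_mod hsol.generator hsol.currents k)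
    (hsol.currents_mem hp k) (fun v hv => ?_) (timeDeriv_constBT k) hx
  have hHk := mem_comb (C := convSubring p) (g := H) k
  rw [hsol.comb_eq hp] at hv hHk ⊢
  exact connection_timeDeriv_mem_comb (fun _ => parity_mem_convSubring)
    (fun _ => superD_mem_convSubring) (fun k _ => timeDeriv_mem_convSubring k) hsol hk hHk hv

theorem IsJSKPSolution.evenDeriv_mem_genIdeal (hsol : IsJSKPSolution h H) (hp : p.CanSpecialize h)
    (f : V (Lam ι)) (i : ℕ) {x : BT ι}
    (hx : x ∈ genIdeal (convSubring p) (obstructions H f)) :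
    evenDeriv i x ∈ genIdeal (convSubring p) (obstructions H f) := by
  rcases Nat.eq_zero_or_pos i with rfl | hi
  · rw [← superD_superD]
    exact hsol.superD_mem_genIdeal hp f (hsol.superD_mem_genIdeal hp f hx)
  · have h1 := hsol.timeDeriv_mem_genIdeal hp f (k := 2 * i) (by omega) hx
    rwa [timeDeriv, if_pos (even_two_mul i), Nat.mul_div_cancel_left i two_pos] at h1

/-- The index 0 is φ, and ∂_φ = 𝓓 − φ ∂_x; the index j ≥ 1 is the time t_{2j−1}. -/
theorem IsJSKPSolution.oddDeriv_mem_genIdeal (hsol : IsJSKPSolution h H) (hp : p.CanSpecialize h)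
    (f : V (Lam ι)) (j : ℕ) {x : BT ι}
    (hx : x ∈ genIdeal (convSubring p) (obstructions H f)) :
    oddDeriv j x ∈ genIdeal (convSubring p) (obstructions H f) := by
  rcases Nat.eq_zero_or_pos j with rfl | hj
  · rw [← add_sub_cancel_right (oddDeriv 0 x) (phi * evenDeriv 0 x), ← superD_apply]
    exact sub_mem (hsol.superD_mem_genIdeal hp f hx)
      (mul_mem_genIdeal phi_mem_convSubring (hsol.evenDeriv_mem_genIdeal hp f 0 hx))
  · have h1 := hsol.timeDeriv_mem_genIdeal hp f (k := 2 * j - 1) (by omega) hx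
    rwa [timeDeriv, if_neg (by rw [Nat.even_iff]; omega),
      show (2 * j - 1 + 1) / 2 = j by omega] at h1

/-- The value at `p` lies in the specialized space, because `f` preserves it, and is O(z⁻¹). The
specialized currents are still reduced, so it is 0. -/
theorem IsJSKPSolution.eval_obstruction (hsol : IsJSKPSolution h H) (hp : p.CanSpecialize h)
    {f : V (Lam ι)} (hf : f ∈ stabilizer (specializedSpace H p)) (n k : ℕ) :
    mapV p.eval (negProj H (par n (mapVAdd constBT f) * H k)) = 0 := by
  have hHC := hsol.currents_mem hp
  have hc := par_constBT_mul_mem_coeffsIn hHC f n k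
  have hlin : lincomb (posPart (par n (mapVAdd constBT f) * H k)) H ∈ comb (convSubring p) H :=
    lincomb_mem_comb fun l => pc_mem hc l
  have hred := hsol.currents.isReduced
  refine (hred.mapV_eval p).eq_zero (C := ⊤) ?_ fun l => ?_
  · rw [negProj, sub_eq_add_neg, ← neg_one_zsmul (lincomb _ H), mapV_eval_add hc
      (zsmul_mem (comb_le_coeffsIn hHC hlin) _), mapV_eval_zsmul _ (comb_le_coeffsIn hHC hlin),
      mapV_eval_mul (par_mem (fun _ => coeffsIn_parity fun _ => parity_mem_convSubring) n
        (constBT_mem_coeffsIn p f)) (hHC k),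
      mapV_eval_par n (constBT_mem_coeffsIn p f), mapV_eval_constBT]
    refine add_mem ?_ (zsmul_mem (mapV_eval_mem_comb hHC hlin) _)
    rw [← mem_specializedSpace_iff]
    exact hsol.par_mem_stabilizer hp hf n _ (Submodule.subset_span ⟨k, rfl⟩)
  · rw [pc_mapV, isNeg_iff_pc.1 (hred.isNeg_negProj _) l, map_zero]

/-- The obstructions generate a differential ideal of convergent series, and evaluation, being
multiplicative on these, kills the whole ideal. The conclusion is an identity of formal series,
independent of `p`. -/
theorem IsJSKPSolution.negProj_eq_zero (hsol : IsJSKPSolution h H) (hp : p.CanSpecialize h)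
    {f : V (Lam ι)} (hf : f ∈ stabilizer (specializedSpace H p)) (n k : ℕ) :
    negProj H (par n (mapVAdd constBT f) * H k) = 0 := by
  have hpar : ∀ a ∈ convSubring p, Super.parity a ∈ convSubring p :=
    fun _ => parity_mem_convSubring
  have hHC := hsol.currents_mem hp
  have hG : ∀ g ∈ obstructions H f, g ∈ convSubring p := by
    rintro _ ⟨n, k, j, s, rfl⟩
    have hc := par_constBT_mul_mem_coeffsIn hHC f n k
    have hlin : lincomb (posPart (par n (mapVAdd constBT f) * H k)) H ∈ comb (convSubring p) H :=
      lincomb_mem_comb fun l => pc_mem hc l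
    exact sub_mem hc (comb_le_coeffsIn hHC hlin) j s
  have hle : ∀ x ∈ genIdeal (convSubring p) (obstructions H f), x ∈ convSubring p :=
    fun _ => genIdeal_le hpar hG
  have heval : ∀ x ∈ genIdeal (convSubring p) (obstructions H f), p.eval x = 0 := by
    intro x hx
    refine AddSubgroup.closure_induction (p := fun x _ => p.eval x = 0) ?_ (map_zero _) ?_ ?_ hx
    · rintro _ ⟨a, ha, b, hb, m, _, ⟨n, k, j, s, rfl⟩, rfl⟩
      have h0 : p.eval (((negProj H (par n (mapVAdd constBT f) * H k)).coeff j).coeff s) = 0 :=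
        congrArg (fun v : V (Lam ι) => (v.coeff j).coeff s) (hsol.eval_obstruction hp hf n k)
      have hg := par_mem (S := (convSubring p).toAddSubgroup) hpar m (hG _ ⟨n, k, j, s, rfl⟩)
      rw [eval_mul (mul_mem ha hg) hb, eval_mul ha hg, eval_par, h0, map_zero, mul_zero, zero_mul]
    · intro x y hx hy h1 h2
      rw [eval_add (hle x hx) (hle y hy), h1, h2, add_zero]
    · intro x hx h1
      rw [← neg_one_zsmul, eval_zsmul _ (hle x hx), h1, smul_zero]
  ext j s : 4
  exact eq_zero_of_eval_eq_zero hle (fun c hc F hF => mul_mem_genIdeal hc hF)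
    (fun F hF i => hsol.evenDeriv_mem_genIdeal hp f i hF)
    (fun F hF i => hsol.oddDeriv_mem_genIdeal hp f i hF) heval (negProj_mem_genIdeal _ f n k j s)

/-- The formal identity f Ĥ^(k) ∈ W is specialized at `q`. The coefficients of the combination are
those of the nonnegative powers of z in f Ĥ^(k), so they converge near `q` because ĥ does. -/
theorem IsJSKPSolution.stabilizer_le (hsol : IsJSKPSolution h H) {q : SuperPoint ι}
    (hp : p.CanSpecialize h) (hq : q.CanSpecialize h) :
    stabilizer (specializedSpace H p) ≤ stabilizer (specializedSpace H q) := by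
  intro f hf
  have hHC := hsol.currents_mem hq
  have key : ∀ n k, par n f * mapV q.eval (H k) ∈ comb ⊤ fun l => mapV q.eval (H l) := by
    intro n k
    have h1 := sub_eq_zero.1 (hsol.negProj_eq_zero hp hf n k)
    have hc := par_constBT_mul_mem_coeffsIn hHC f n k
    have h2 := mapV_eval_mem_comb hHC (v := par n (mapVAdd constBT f) * H k)
      (h1 ▸ lincomb_mem_comb fun l => pc_mem hc l)
    rwa [mapV_eval_mul (par_mem (fun _ => coeffsIn_parity fun _ => parity_mem_convSubring) n
      (constBT_mem_coeffsIn q f)) (hHC k), mapV_eval_par n (constBT_mem_coeffsIn q f),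
      mapV_eval_constBT] at h2
  intro w hw
  rw [mem_specializedSpace_iff] at hw ⊢
  refine comb_induction (P := fun w => f * w ∈ comb ⊤ fun l => mapV q.eval (H l))
    (fun c _ l => ?_) (fun u v hu hv => ?_) hw
  · have h0 := key 0 l
    have h1 := key 1 l
    rw [par_zero] at h0
    rw [par_one] at h1
    -- The odd part of the scalar `c` calls for the parity conjugate of `f`; this is why `key` was
    -- proved for every `n`.
    rw [mul_smulV]
    exact add_mem (smul_mem_comb_of_mem (Subring.mem_top _) h0)
      (smul_mem_comb_of_mem (Subring.mem_top _) h1)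
  · rw [mul_add]
    exact add_mem hu hv

end Isospectrality

end SuperKP

end

theorem mainTheorem4 {ι : Type*} [LinearOrder ι]
    (h : SuperKP.V (SuperKP.BT ι)) (H : ℕ → SuperKP.V (SuperKP.BT ι))
    (hsol : SuperKP.IsJSKPSolution h H)
    (p q : SuperKP.SuperPoint ι) (hp : p.CanSpecialize h) (hq : q.CanSpecialize h) :
    SuperKP.stabilizer (SuperKP.specializedSpace H p) =
      SuperKP.stabilizer (SuperKP.specializedSpace H q) :=
  le_antisymm (hsol.stabilizer_le hp hq) (hsol.stabilizer_le hq hp)
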